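/- Let $\mathsf Z$ be a Polish space and $V:\mathsf Z\to[1,\infty)$ measurable. For measurable $g:\mathsf Z\to\mathbb R$ put $\|g\|_V=\sup_z |g(z)|/V(z)$ and let $L_\infty^V$ be the set of measurable $g$ with $\|g\|_V<\infty$. Let $\{\Phi_n\}_{n\ge 0}$ be a time-homogeneous Markov chain on $\mathsf Z$ with fixed initial state $\Phi_0=z_0$. Assume: (A1) The chain is $V$-uniformly ergodic with invariant probability measure $\pi$: $\pi(V)<\infty$, $\mathsf E[V(\Phi_n)\mid\Phi_0=z]<\infty$ for all $n,z$, and there are $\rho\in(0,1)$ and $B_V<\infty$ with $|\mathsf E[g(\Phi_n)\mid \Phi_0=z]-\pi(g)|\le B_V\|g\|_V\,\rho^n V(z)$ for all $g\in L_\infty^V$, $z\in\mathsf Z$, $n\ge 0$. (A2) $A$ is a real $d\times d$ Hurwitz matrix (every eigenvalue has negative real part). (A3) $f^*:\mathsf Z\to\mathbb R^d$ is measurable with $\|(f_i^*)^2\|_V<\infty$ and $\pi(f_i^*)=0$ for each $i$. Let $\Delta_n=f^*(\Phi_n)$, fix a deterministic $\tilde\theta_0\in\mathbb R^d$, and let $$\tilde\theta_{n+1}=\tilde\theta_n+\tfrac1{n+1}\bigl[A\tilde\theta_n+\Delta_{n+1}\bigr],\qquad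 n\ge 0 .$$ Write $\mathrm{Cov}(\theta_n)=\mathsf E[\tilde\theta_n\tilde\theta_n^{\mathsf T}]$ and $\Sigma_\Delta=\sum_{k=-\infty}^{\infty}\mathsf E_\pi[\Delta_k\Delta_0^{\mathsf T}]$, where $\mathsf E_\pi$ is the expectation for the stationary (two-sided) chain. A nonnegative sequence $e_n$ is said to converge to $0$ at rate $n^{-r}$ if $n^{s}e_n\to 0$ for every $s<r$ and $n^{s}e_n\to\infty$ for every $s>r$. Then the series defining $\Sigma_\Delta$ converges absolutely, $\mathsf E\|\tilde\theta_n\|^2<\infty$ for all $n$, and: (i) If every eigenvalue of $A$ has real part $<-\tfrac12$, then for some $\delta>0$ depending only on $(A,\Sigma_\Delta)$, $$\mathrm{Cov}(\theta_n)=n^{-1}\Sigma_\theta+O(n^{-1-\delta}),\qquad n\ge 1,$$ where $\Sigma_\theta$, which is positive semidefinite, is the unique solution of the Lyapunov equation $[\tfrac12 I+A]\Sigma+\Sigma[\tfrac12 I+A]^{\mathsf T}+\Sigma_\Delta=0$. Consequently $n^{s}\,\mathsf E\|\tilde\theta_n\|^2\to 0$ for every $s<1$, and, if $\Sigma_\Delta\neq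 0$, $\mathsf E\|\tilde\theta_n\|^2$ converges to $0$ at rate $n^{-1}$. (ii) Let $\lambda$ be an eigenvalue of $A$ with $-\varrho_0=\mathrm{Re}(\lambda)>-\tfrac12$, and let $v\in\mathbb C^d$, $v\ne 0$, be a corresponding left eigenvector ($v^{\mathsf T}A=\lambda v^{\mathsf T}$) with $\Sigma_\Delta v\neq 0$. Then $\mathsf E[|v^{\mathsf T}\tilde\theta_n|^2]$ converges to $0$ at rate $n^{-2\varrho_0}$; equivalently, $n^{2\varrho}\mathsf E[|v^{\mathsf T}\tilde\theta_n|^2]$ tends to $0$ for $\varrho<\varrho_0$ and to $\infty$ for $\varrho>\varrho_0$. -/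

import Mathlib

open MeasureTheory ProbabilityTheory Filter Topology Matrix

noncomputable section

namespace LinearSA

/-! ### Markov chains and `V`-uniform ergodicity -/

/-- The weighted norm `‖g‖_V = sup_z |g z| / V z`. -/
def vNorm {Z : Type*} (V g : Z → ℝ) : ℝ := ⨆ z, |g z| / V z

/-- The space `L_∞^V` of measurable functions with finite `V`-norm. -/
def MemLV {Z : Type*} [MeasurableSpace Z] (V g : Z → ℝ) : Prop :=
  Measurable g ∧ BddAbove (Set.range fun z => |g z| / V z)

/-- The chain with transition kernel `P` is `V`-uniformly ergodic with invariant distribution `π`.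
Here `P ^ n` is the `n`-step transition kernel, so `∫ g d(P ^ n) z` is the expectation of `g (Φ_n)`
given `Φ_0 = z`. The integrability clauses say that the expectations of elements of `L_∞^V` under
`π` and under every `n`-step law are finite. -/
structure VUniformlyErgodic {Z : Type*} [MeasurableSpace Z] (P : Kernel Z Z) (V : Z → ℝ)
    (π : Measure Z) : Prop where
  measurable_weight : Measurable V
  one_le_weight : ∀ z, 1 ≤ V z
  invariant : Kernel.Invariant P π
  integrable_weight : Integrable V π
  integrable_weight_pow : ∀ (n : ℕ) (z : Z), Integrable V ((P ^ n) z)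
  bound : ∃ ρ B : ℝ, 0 < ρ ∧ ρ < 1 ∧ ∀ g : Z → ℝ, MemLV V g → ∀ (z : Z) (n : ℕ),
    |(∫ y, g y ∂((P ^ n) z)) - ∫ y, g y ∂π| ≤ B * vNorm V g * ρ ^ n * V z

/-- `Φ` is, under `μ` and with respect to the filtration `ℱ`, a time-homogeneous Markov chain with
transition kernel `P`. -/
structure IsMarkovChain {Z Ω : Type*} [MeasurableSpace Z] {mΩ : MeasurableSpace Ω}
    (P : Kernel Z Z) (ℱ : Filtration ℕ mΩ) (Φ : ℕ → Ω → Z) (μ : Measure Ω) : Prop where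
  adapted : ∀ n, Measurable[ℱ n] (Φ n)
  markov : ∀ (n : ℕ) (B : Set Z), MeasurableSet B →
    μ[(Φ (n + 1) ⁻¹' B).indicator (fun _ => (1 : ℝ)) | ℱ n] =ᵐ[μ] fun ω => (P (Φ n ω)).real B

/-! ### Asymptotic covariance of the noise -/

/-- For `k : ℕ`, the lag-`k` autocovariance `E_π[f(Φ_k) f(Φ_0)ᵀ]` of the stationary chain. -/
def autocovNat {Z : Type*} [MeasurableSpace Z] {d : ℕ} (P : Kernel Z Z) (π : Measure Z)
    (f : Z → Fin d → ℝ) (k : ℕ) : Matrix (Fin d) (Fin d) ℝ :=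
  Matrix.of fun i j => ∫ z, (∫ y, f y i ∂((P ^ k) z)) * f z j ∂π

/-- The autocovariance `E_π[f(Φ_k) f(Φ_0)ᵀ]` of the stationary two-sided chain at lag `k : ℤ`;
by stationarity `E_π[f(Φ_{-k}) f(Φ_0)ᵀ] = E_π[f(Φ_k) f(Φ_0)ᵀ]ᵀ`. -/
def autocov {Z : Type*} [MeasurableSpace Z] {d : ℕ} (P : Kernel Z Z) (π : Measure Z)
    (f : Z → Fin d → ℝ) : ℤ → Matrix (Fin d) (Fin d) ℝ
  | Int.ofNat k => autocovNat P π f k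
  | Int.negSucc k => (autocovNat P π f (k + 1))ᵀ

/-- The asymptotic covariance `Σ_Δ = ∑_{k ∈ ℤ} E_π[Δ_k Δ_0ᵀ]` of `Δ_n = f(Φ_n)`. -/
def asymptoticCov {Z : Type*} [MeasurableSpace Z] {d : ℕ} (P : Kernel Z Z) (π : Measure Z)
    (f : Z → Fin d → ℝ) : Matrix (Fin d) (Fin d) ℝ :=
  Matrix.of fun i j => ∑' k : ℤ, autocov P π f k i j

/-! ### The linear recursion -/

/-- The linear stochastic approximation recursion with step size `1 / n`:
`x_{n+1} = x_n + (1 / (n + 1)) (A x_n + Δ_{n+1})`, started at `x₀`. -/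
def linSA {d : ℕ} (A : Matrix (Fin d) (Fin d) ℝ) (x₀ : Fin d → ℝ) (Δ : ℕ → Fin d → ℝ) :
    ℕ → Fin d → ℝ
  | 0 => x₀
  | n + 1 => linSA A x₀ Δ n + (1 / ((n : ℝ) + 1)) • (A *ᵥ linSA A x₀ Δ n + Δ (n + 1))

/-- The recursion driven by the noise `Δ_n = f(Φ_n)`. -/
def errorSeq {Z Ω : Type*} {d : ℕ} (A : Matrix (Fin d) (Fin d) ℝ) (x₀ : Fin d → ℝ)
    (f : Z → Fin d → ℝ) (Φ : ℕ → Ω → Z) (n : ℕ) (ω : Ω) : Fin d → ℝ :=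
  linSA A x₀ (fun k => f (Φ k ω)) n

/-- The (uncentred) second moment matrix `E[X Xᵀ]`. -/
def secondMoment {Ω : Type*} [MeasurableSpace Ω] {d : ℕ} (μ : Measure Ω) (X : Ω → Fin d → ℝ) :
    Matrix (Fin d) (Fin d) ℝ :=
  Matrix.of fun i j => ∫ ω, X ω i * X ω j ∂μ

/-! ### Linear algebra and rates -/

/-- A real matrix regarded as a complex matrix. -/
def toComplex {d : ℕ} (A : Matrix (Fin d) (Fin d) ℝ) : Matrix (Fin d) (Fin d) ℂ :=
  A.map Complex.ofReal

/-- `l` is an eigenvalue of the real matrix `A`. -/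
def IsEigenvalue {d : ℕ} (A : Matrix (Fin d) (Fin d) ℝ) (l : ℂ) : Prop :=
  Module.End.HasEigenvalue (Matrix.toLin' (toComplex A)) l

/-- Every eigenvalue of `A` has negative real part. -/
def IsHurwitz {d : ℕ} (A : Matrix (Fin d) (Fin d) ℝ) : Prop :=
  ∀ l : ℂ, IsEigenvalue A l → l.re < 0

/-- `S` solves the Lyapunov equation `(½ I + A) S + S (½ I + A)ᵀ + Q = 0`. -/
def SolvesLyapunov {d : ℕ} (A Q S : Matrix (Fin d) (Fin d) ℝ) : Prop :=
  ((1 / 2 : ℝ) • (1 : Matrix (Fin d) (Fin d) ℝ) + A) * S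
    + S * ((1 / 2 : ℝ) • (1 : Matrix (Fin d) (Fin d) ℝ) + A)ᵀ + Q = 0

/-- `e` converges to zero at rate `n ^ (-r)`: `n ^ s * |e n|` tends to `0` for every `s < r` and to
`∞` for every `s > r`. -/
def ConvergesAtRate (e : ℕ → ℝ) (r : ℝ) : Prop :=
  (∀ s < r, Tendsto (fun n : ℕ => (n : ℝ) ^ s * |e n|) atTop (𝓝 0)) ∧
    ∀ s > r, Tendsto (fun n : ℕ => (n : ℝ) ^ s * |e n|) atTop atTop

end LinearSA

end

/-! The noise is correlated, but Poisson's equation turns it into a martingale difference plus a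
telescoping term. With `h = ∑_{n ≥ 1} Pⁿ f` one has `P (f + h) = h`, so `f(Φ_{n+1}) = m_{n+1} +
h(Φ_n) - h(Φ_{n+1})`, where `m_{n+1} = f(Φ_{n+1}) + h(Φ_{n+1}) - h(Φ_n)` is orthogonal to the past.
Since `f` is only dominated by `√V`, convergence of the series and `h = O(√V)` require ergodicity in
the `√V`-norm, which a truncation extracts from (A1) (`exists_abs_integral_pow_le`). The covariance
of `m_{n+1}` tends geometrically to `π((f+h)(f+h)ᵀ) - π(hhᵀ)`, which equals `Σ_Δ`
(`exists_isPoissonCorrection`, `exists_martingale_covariance_bound`).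

The telescoping term is absorbed in the state: `y_n = x_n + h(Φ_n)/n` satisfies `y_{n+1} = (1 +
A/(n+1)) y_n + m_{n+1}/(n+1) + O(n⁻²)` in `L²` (`recursion_corrected`). By orthogonality its second
moments obey a deterministic recursion, and `x_n` differs from `y_n` by `O(1/n)` in `L²`.

For (i), the covariances satisfy `K_{n+1} = (1 + A/(n+1)) K_n (1 + A/(n+1))ᵀ + (n+1)⁻² (Σ_Δ +
o(1))`. The Lyapunov equation says exactly that `S/n` solves this up to `O(n⁻³)` (`lyapunov_step`).
In a norm adapted to `A` (`exists_isAdaptedNorm`) the linear part contracts by `(1 - a/(n+1))²` with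
`a > 1/2`, so `K_n - S/n = O(n^{-2a})`, and `δ = 2a - 1`. The remainder depends on `y_n` itself, so
a crude bound `y_n = O(n^{-1/4})` is proved first (`crossGram_first_bound`). Unique solvability of
the Lyapunov equation follows from the same estimate, and positivity of `S` from `S = lim n
Cov(θ_n)`.

For (ii), `vᵀ x_n` follows a scalar recursion with factor `1 + λ/(n+1)`, whose squared modulus is `1
- 2ϱ₀/(n+1) + O(n⁻²)`. As `2ϱ₀ < 1`, inputs of size `n⁻²` to the variance are too small to alter the
rate `n^{-2ϱ₀}` from above, while the limit noise variance `v* Σ_Δ v > 0` prevents the variance from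
vanishing, which gives the lower bound (`norm_sq_recursion_bounds`). -/

namespace LinearSA

/-! ### Scalar recursions -/

/-- The weight `exp (a H_n + c ∑_{k ≤ n} k⁻²)`, which is comparable with `n ^ a`. -/
noncomputable def rateWeight (a c : ℝ) (n : ℕ) : ℝ :=
  Real.exp (∑ k ∈ Finset.range n, (a / ((k : ℝ) + 1) + c / ((k : ℝ) + 1) ^ 2))

lemma rateWeight_pos (a c : ℝ) (n : ℕ) : 0 < rateWeight a c n := Real.exp_pos _

lemma rateWeight_succ (a c : ℝ) (n : ℕ) : rateWeight a c (n + 1) =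
    rateWeight a c n * Real.exp (a / ((n : ℝ) + 1) + c / ((n : ℝ) + 1) ^ 2) := by
  simp [rateWeight, Finset.sum_range_succ, Real.exp_add]

lemma rateWeight_neg (a c : ℝ) (n : ℕ) : rateWeight (-a) (-c) n = (rateWeight a c n)⁻¹ := by
  rw [rateWeight, rateWeight, ← Real.exp_neg, ← Finset.sum_neg_distrib]
  congr 1
  refine Finset.sum_congr rfl fun k _ => ?_
  ring

/-- The harmonic number is within `1` of `log n` and the sum of the `c / k²` stays bounded, so the
exponent is `a log n + O(1)`. -/
lemma exists_rateWeight_le (a c : ℝ) :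
    ∃ D : ℝ, 0 < D ∧ ∀ n : ℕ, 1 ≤ n → rateWeight a c n ≤ D * (n : ℝ) ^ a := by
  have hs : Summable fun k : ℕ => 1 / ((k : ℝ) + 1) ^ 2 := by
    have := (summable_nat_add_iff 1).2 (Real.summable_one_div_nat_pow.2 (by norm_num : 1 < 2))
    simpa using this
  refine ⟨Real.exp (|a| + |c| * ∑' k : ℕ, 1 / ((k : ℝ) + 1) ^ 2), Real.exp_pos _, fun n hn => ?_⟩
  have hn' : (0 : ℝ) < n := by exact_mod_cast hn
  rw [Real.rpow_def_of_pos hn', ← Real.exp_add, rateWeight, Real.exp_le_exp,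
    Finset.sum_add_distrib]
  have h1 : ∑ k ∈ Finset.range n, a / ((k : ℝ) + 1) = a * (harmonic n : ℝ) := by
    rw [harmonic]
    push_cast
    rw [Finset.mul_sum]
    rfl
  have h2 : ∑ k ∈ Finset.range n, c / ((k : ℝ) + 1) ^ 2 ≤
      |c| * ∑' k : ℕ, 1 / ((k : ℝ) + 1) ^ 2 := by
    calc _ = c * ∑ k ∈ Finset.range n, 1 / ((k : ℝ) + 1) ^ 2 := by
            rw [Finset.mul_sum]
            exact Finset.sum_congr rfl fun k _ => by ring
      _ ≤ |c| * ∑ k ∈ Finset.range n, 1 / ((k : ℝ) + 1) ^ 2 :=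
            mul_le_mul_of_nonneg_right (le_abs_self c) (Finset.sum_nonneg fun _ _ => by positivity)
      _ ≤ _ := mul_le_mul_of_nonneg_left
            (hs.sum_le_tsum _ fun _ _ => by positivity) (abs_nonneg c)
  have h3 : |(harmonic n : ℝ) - Real.log n| ≤ 1 := by
    have ha := log_add_one_le_harmonic n
    have hb := harmonic_le_one_add_log n
    have hc : Real.log n ≤ Real.log (n + 1 : ℕ) := Real.log_le_log hn' (by push_cast; linarith)
    rw [abs_le]
    constructor <;> linarith
  have h4 : a * (harmonic n : ℝ) - a * Real.log n ≤ |a| := by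
    rw [← mul_sub]
    refine (le_abs_self _).trans ?_
    rw [abs_mul]
    exact mul_le_of_le_one_right (abs_nonneg a) h3
  rw [h1]
  linarith

lemma exists_le_rateWeight (a c : ℝ) :
    ∃ D : ℝ, 0 < D ∧ ∀ n : ℕ, 1 ≤ n → D * (n : ℝ) ^ a ≤ rateWeight a c n := by
  obtain ⟨D, hD, h⟩ := exists_rateWeight_le (-a) (-c)
  refine ⟨D⁻¹, inv_pos.2 hD, fun n hn => ?_⟩
  have hn' : (0 : ℝ) < n := by exact_mod_cast hn
  have := h n hn
  rw [rateWeight_neg, Real.rpow_neg hn'.le, ← div_eq_mul_inv, inv_le_iff_one_le_mul₀ (rateWeight_pos _ _ _)] at this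
  rw [inv_mul_le_iff₀ hD]
  have hp : 0 < (n : ℝ) ^ a := Real.rpow_pos_of_pos hn' a
  rw [div_mul_eq_mul_div, le_div_iff₀ hp] at this
  linarith

/-- A nonnegative sequence that contracts by `1 - a / n + O(n⁻²)` and receives inputs of a size
`O(n ^ (-b))` with `b > a + 1` is `O(n ^ (-a))`. -/
lemma exists_le_rpow_of_recursion {u : ℕ → ℝ} {a b C : ℝ} (hu : ∀ n, 0 ≤ u n) (hab : a + 1 < b)
    (hC : 0 ≤ C)
    (h : ∀ᶠ n : ℕ in atTop, u (n + 1) ≤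
      (1 - a / ((n : ℝ) + 1) + C / ((n : ℝ) + 1) ^ 2) * u n + C * ((n : ℝ) + 1) ^ (-b)) :
    ∃ D : ℝ, 0 ≤ D ∧ ∀ᶠ n : ℕ in atTop, u n ≤ D * (n : ℝ) ^ (-a) := by
  obtain ⟨N, hN⟩ := eventually_atTop.1 h
  obtain ⟨E, hE, hEw⟩ := exists_rateWeight_le a (-C)
  obtain ⟨F, hF, hFw⟩ := exists_rateWeight_le (-a) C
  have hs : Summable fun k : ℕ => ((k : ℝ) + 1) ^ (a - b) := by
    have := (summable_nat_add_iff 1).2 (Real.summable_nat_rpow.2 (by linarith : a - b < -1))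
    simpa using this
  -- Integrating factor: `1 - a t + C t² ≤ exp (-(a t - C t²)) = w n / w (n + 1)` with `t = 1 / (n +
  -- 1)`. Hence `u n * w n` grows only through the inputs, which after weighting are `O(n ^ (a -
  -- b))` and summable because `a - b < -1`.
  set w := rateWeight a (-C)
  have hw : ∀ n, 0 < w n := rateWeight_pos _ _
  have step : ∀ n, N ≤ n → u (n + 1) * w (n + 1) ≤
      u n * w n + C * E * ((n : ℝ) + 1) ^ (a - b) := by
    intro n hn
    have hn1 : (0 : ℝ) < (n : ℝ) + 1 := by positivity
    have h1 : (1 - a / ((n : ℝ) + 1) + C / ((n : ℝ) + 1) ^ 2) ≤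
        Real.exp (-(a / ((n : ℝ) + 1) + (-C) / ((n : ℝ) + 1) ^ 2)) := by
      refine le_trans (le_of_eq ?_) (Real.add_one_le_exp _)
      ring
    have h2 : Real.exp (-(a / ((n : ℝ) + 1) + (-C) / ((n : ℝ) + 1) ^ 2)) * w (n + 1) = w n := by
      simp only [w, rateWeight_succ]
      rw [mul_comm, mul_assoc, ← Real.exp_add]
      simp
    have h3 : w (n + 1) ≤ E * ((n : ℝ) + 1) ^ a := by
      have := hEw (n + 1) (by omega)
      push_cast at this
      exact this
    calc u (n + 1) * w (n + 1)
        ≤ (Real.exp (-(a / ((n : ℝ) + 1) + (-C) / ((n : ℝ) + 1) ^ 2)) * u n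
            + C * ((n : ℝ) + 1) ^ (-b)) * w (n + 1) := by
          refine mul_le_mul_of_nonneg_right ((hN n hn).trans ?_) (hw _).le
          gcongr
          exact hu n
      _ = u n * w n + C * ((n : ℝ) + 1) ^ (-b) * w (n + 1) := by rw [← h2]; ring
      _ ≤ u n * w n + C * ((n : ℝ) + 1) ^ (-b) * (E * ((n : ℝ) + 1) ^ a) := by gcongr
      _ = _ := by
          rw [sub_eq_add_neg, Real.rpow_add hn1]
          ring
  have bound : ∀ j, u (N + j) * w (N + j) ≤
      u N * w N + C * E * ∑ k ∈ Finset.range (N + j), ((k : ℝ) + 1) ^ (a - b) := by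
    intro j
    induction j with
    | zero =>
      have : 0 ≤ ∑ k ∈ Finset.range (N + 0), ((k : ℝ) + 1) ^ (a - b) :=
        Finset.sum_nonneg fun _ _ => by positivity
      simp only [Nat.add_zero] at this ⊢
      nlinarith [mul_nonneg (mul_nonneg hC hE.le) this]
    | succ j ih =>
      have := step (N + j) (by omega)
      rw [← Nat.add_assoc, Finset.sum_range_succ]
      nlinarith
  set G := u N * w N + C * E * ∑' k : ℕ, ((k : ℝ) + 1) ^ (a - b)
  have hG : 0 ≤ G := add_nonneg (mul_nonneg (hu _) (hw _).le)
    (mul_nonneg (mul_nonneg hC hE.le) (tsum_nonneg fun _ => by positivity))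
  refine ⟨G * F, mul_nonneg hG hF.le, ?_⟩
  filter_upwards [eventually_ge_atTop (N + 1)] with n hn
  obtain ⟨j, rfl⟩ := Nat.exists_eq_add_of_le (show N ≤ n by omega)
  have h1 : u (N + j) * w (N + j) ≤ G := (bound j).trans (by
    simp only [G]
    gcongr
    exact hs.sum_le_tsum _ fun _ _ => by positivity)
  have h2 := hFw (N + j) (by omega)
  have h3 : rateWeight (-a) C (N + j) = (w (N + j))⁻¹ := by
    rw [← rateWeight_neg, neg_neg]
  rw [h3] at h2
  calc u (N + j) = (u (N + j) * w (N + j)) * (w (N + j))⁻¹ := by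
        rw [mul_assoc, mul_inv_cancel₀ (hw _).ne', mul_one]
    _ ≤ G * (F * ((N + j : ℕ) : ℝ) ^ (-a)) := by
        refine mul_le_mul h1 h2 (inv_nonneg.2 (hw _).le) hG
    _ = _ := by ring

/-- An eventually positive sequence that contracts by no more than `1 - a / n - O(n⁻²)` is bounded
below by a multiple of `n ^ (-a)`. -/
lemma exists_rpow_le_of_recursion {u : ℕ → ℝ} {a C : ℝ} (hu : ∀ᶠ n in atTop, 0 < u n)
    (hC : 0 ≤ C)
    (h : ∀ᶠ n : ℕ in atTop,
      (1 - a / ((n : ℝ) + 1) - C / ((n : ℝ) + 1) ^ 2) * u n ≤ u (n + 1)) :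
    ∃ D : ℝ, 0 < D ∧ ∀ᶠ n : ℕ in atTop, D * (n : ℝ) ^ (-a) ≤ u n := by
  -- The surplus `2 (|a| + C)²` makes the exponent of the integrating factor at least `x + 2 x²` for
  -- `x = a t + C t²`. Since `(1 - x)(1 + x + 2 x²) = 1 + x² (1 - 2 x) ≥ 1` once `x ≤ 1/2`, the
  -- product `u n * w n` is eventually nondecreasing.
  set C' := C + 2 * (|a| + C) ^ 2
  obtain ⟨F, hF, hFw⟩ := exists_le_rateWeight (-a) (-C')
  set w := rateWeight a C'
  have hw : ∀ n, 0 < w n := rateWeight_pos _ _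
  have hlarge : ∀ᶠ n : ℕ in atTop, 2 * (|a| + C) ≤ (n : ℝ) :=
    tendsto_natCast_atTop_atTop.eventually_ge_atTop _
  obtain ⟨N, hN⟩ := eventually_atTop.1 ((hu.and h).and hlarge)
  have step : ∀ n, N ≤ n → u n * w n ≤ u (n + 1) * w (n + 1) := by
    intro n hn
    obtain ⟨⟨h0, h1⟩, h2⟩ := hN n hn
    have hn1 : (0 : ℝ) < (n : ℝ) + 1 := by positivity
    set t := ((n : ℝ) + 1)⁻¹
    have ht : 0 < t := inv_pos.2 hn1
    have ht1 : t ≤ 1 := inv_le_one_of_one_le₀ (by linarith [(Nat.cast_nonneg n : (0 : ℝ) ≤ n)])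
    set x := a * t + C * t ^ 2
    have e1 : a / ((n : ℝ) + 1) = a * t := div_eq_mul_inv _ _
    have e2 : ∀ c : ℝ, c / ((n : ℝ) + 1) ^ 2 = c * t ^ 2 := fun c => by
      simp only [t, div_eq_mul_inv, inv_pow]
    have hxa : |x| ≤ (|a| + C) * t := by
      calc |x| ≤ |a * t| + |C * t ^ 2| := abs_add_le _ _
        _ = |a| * t + C * t ^ 2 := by
            rw [abs_mul, abs_of_pos ht, abs_of_nonneg (by positivity : 0 ≤ C * t ^ 2)]
        _ ≤ _ := by nlinarith [mul_nonneg hC ht.le]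
    have hxh : (|a| + C) * t ≤ 1 / 2 := by
      rw [← div_eq_mul_inv, div_le_iff₀ hn1]
      linarith
    have hx2 : x ≤ 1 / 2 := (le_abs_self x).trans (hxa.trans hxh)
    have hx3 : x ^ 2 ≤ (|a| + C) ^ 2 * t ^ 2 := by
      rw [← mul_pow, ← sq_abs x]
      exact pow_le_pow_left₀ (abs_nonneg _) hxa 2
    have key : 1 ≤ (1 - x) * Real.exp (a * t + C' * t ^ 2) := by
      have h3 : 1 + (x + 2 * x ^ 2) ≤ Real.exp (a * t + C' * t ^ 2) := by
        refine le_trans ?_ (Real.add_one_le_exp _)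
        simp only [C', x] at hx3 ⊢
        nlinarith
      have h4 : 1 ≤ (1 - x) * (1 + (x + 2 * x ^ 2)) := by nlinarith [sq_nonneg x]
      exact h4.trans (mul_le_mul_of_nonneg_left h3 (by linarith))
    rw [e1, e2] at h1
    simp only [w, rateWeight_succ, e1, e2]
    have h5 : (1 - x) * u n ≤ u (n + 1) := by
      refine le_trans (le_of_eq ?_) h1
      simp only [x]; ring
    calc u n * rateWeight a C' n
        ≤ u n * rateWeight a C' n * ((1 - x) * Real.exp (a * t + C' * t ^ 2)) :=
          le_mul_of_one_le_right (mul_pos h0 (hw n)).le key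
      _ = (1 - x) * u n * (rateWeight a C' n * Real.exp (a * t + C' * t ^ 2)) := by ring
      _ ≤ _ := mul_le_mul_of_nonneg_right h5 (mul_pos (hw n) (Real.exp_pos _)).le
  have bound : ∀ j, u N * w N ≤ u (N + j) * w (N + j) := by
    intro j
    induction j with
    | zero => simp
    | succ j ih => exact ih.trans (step (N + j) (by omega))
  have hpos : 0 < u N * w N := mul_pos (hN N le_rfl).1.1 (hw N)
  refine ⟨u N * w N * F, mul_pos hpos hF, ?_⟩
  filter_upwards [eventually_ge_atTop (N + 1)] with n hn
  obtain ⟨j, rfl⟩ := Nat.exists_eq_add_of_le (show N ≤ n by omega)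
  have h2 := hFw (N + j) (by omega)
  rw [rateWeight_neg] at h2
  calc u N * w N * F * ((N + j : ℕ) : ℝ) ^ (-a)
      = u N * w N * (F * ((N + j : ℕ) : ℝ) ^ (-a)) := by ring
    _ ≤ (u (N + j) * w (N + j)) * (w (N + j))⁻¹ :=
        mul_le_mul (bound j) h2 (by positivity) (hpos.le.trans (bound j))
    _ = u (N + j) := by rw [mul_assoc, mul_inv_cancel₀ (hw _).ne', mul_one]

end LinearSA

namespace LinearSA

/-! ### Norms adapted to a stable matrix -/

/-- If the powers of `X` and `Y` are `O(r ^ n)`, an equivalent norm makes the multiplication by `X`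
from the left and the multiplication by `Y` from the right contract by `r`. -/
lemma exists_norm_mul_le {R : Type*} [NormedRing R] [NormedAlgebra ℝ R] {X Y : R} {r C : ℝ}
    (hr : 0 < r) (hX : ∀ n, ‖X ^ n‖ ≤ C * r ^ n) (hY : ∀ n, ‖Y ^ n‖ ≤ C * r ^ n) :
    ∃ N : R → ℝ, (∀ E, ‖E‖ ≤ N E) ∧ (∀ E, N E ≤ C ^ 2 * ‖E‖) ∧
      (∀ E F, N (E + F) ≤ N E + N F) ∧ (∀ c : ℝ, 0 ≤ c → ∀ E, N (c • E) ≤ c * N E) ∧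
      (∀ E, N (X * E) ≤ r * N E) ∧ ∀ E, N (E * Y) ≤ r * N E := by
  have hC : 0 ≤ C := by
    have := (norm_nonneg _).trans (hX 0)
    simpa using this
  -- The norm is the supremum of these terms. Multiplication by `X` or `Y` only shifts the index, at
  -- the price of a factor `r`.
  set t : R → ℕ × ℕ → ℝ := fun E p => (r ^ (p.1 + p.2))⁻¹ * ‖X ^ p.1 * E * Y ^ p.2‖
  have ht : ∀ E p, t E p ≤ C ^ 2 * ‖E‖ := by
    intro E p
    have h1 : ‖X ^ p.1 * E * Y ^ p.2‖ ≤ (C * r ^ p.1) * ‖E‖ * (C * r ^ p.2) := by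
      refine (norm_mul_le _ _).trans ?_
      refine mul_le_mul ((norm_mul_le _ _).trans ?_) (hY _) (norm_nonneg _) (by positivity)
      exact mul_le_mul_of_nonneg_right (hX _) (norm_nonneg _)
    rw [inv_mul_le_iff₀ (by positivity)]
    refine h1.trans (le_of_eq ?_)
    rw [pow_add]
    ring
  have hb : ∀ E, BddAbove (Set.range (t E)) := fun E => ⟨C ^ 2 * ‖E‖, by
    rintro _ ⟨p, rfl⟩; exact ht E p⟩
  refine ⟨fun E => ⨆ p, t E p, fun E => ?_, fun E => ciSup_le (ht E), fun E F => ?_,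
    fun c hc E => ?_, fun E => ?_, fun E => ?_⟩
  · refine le_trans (le_of_eq ?_) (le_ciSup (hb E) (0, 0))
    simp [t]
  · refine ciSup_le fun p => ?_
    refine le_trans ?_ (add_le_add (le_ciSup (hb E) p) (le_ciSup (hb F) p))
    simp only [t]
    rw [← mul_add, mul_add (X ^ p.1), add_mul]
    gcongr
    exact norm_add_le _ _
  · refine ciSup_le fun p => ?_
    refine le_trans (le_of_eq ?_) (mul_le_mul_of_nonneg_left (le_ciSup (hb E) p) hc)
    simp only [t]
    rw [mul_smul_comm, smul_mul_assoc, norm_smul, Real.norm_of_nonneg hc]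
    ring
  · refine ciSup_le fun p => ?_
    refine le_trans (le_of_eq ?_) (mul_le_mul_of_nonneg_left (le_ciSup (hb E) (p.1 + 1, p.2)) hr.le)
    simp only [t]
    rw [pow_succ X, mul_assoc (X ^ p.1) X E, show p.1 + 1 + p.2 = p.1 + p.2 + 1 by ring,
      pow_succ r]
    field_simp
  · refine ciSup_le fun p => ?_
    refine le_trans (le_of_eq ?_) (mul_le_mul_of_nonneg_left (le_ciSup (hb E) (p.1, p.2 + 1)) hr.le)
    simp only [t]
    rw [pow_succ' Y, ← mul_assoc, ← mul_assoc _ Y, ← mul_assoc, show p.1 + (p.2 + 1) = p.1 + p.2 + 1 by ring,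
      pow_succ r]
    field_simp

/-- A norm `N` on matrices, equivalent to the sup norm of the entries, with respect to which
`E ↦ (1 + A / n) E (1 + A / n)ᵀ` contracts by `(1 - a / n) ^ 2` for large `n`. -/
structure IsAdaptedNorm {d : ℕ} (A : Matrix (Fin d) (Fin d) ℝ) (a : ℝ)
    (N : Matrix (Fin d) (Fin d) ℝ → ℝ) : Prop where
  nonneg : ∀ E, 0 ≤ N E
  abs_le : ∀ E i j, |E i j| ≤ N E
  le_of_abs_le : ∃ D : ℝ, 0 ≤ D ∧ ∀ E c, 0 ≤ c → (∀ i j, |E i j| ≤ c) → N E ≤ D * c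
  add_le : ∀ E F, N (E + F) ≤ N E + N F
  smul_le : ∀ c : ℝ, 0 ≤ c → ∀ E, N (c • E) ≤ c * N E
  contract : ∀ᶠ n : ℕ in atTop, ∀ E,
    N ((1 + (1 / ((n : ℝ) + 1)) • A) * E * (1 + (1 / ((n : ℝ) + 1)) • A)ᵀ)
      ≤ (1 - a / ((n : ℝ) + 1)) ^ 2 * N E

open scoped Matrix.Norms.Frobenius

lemma abs_entry_le_frobenius {d : ℕ} (E : Matrix (Fin d) (Fin d) ℝ) (i j : Fin d) :
    |E i j| ≤ ‖E‖ := by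
  rw [frobenius_norm_def, ← Real.sqrt_eq_rpow]
  apply Real.le_sqrt_of_sq_le
  have h1 : ∀ i j, ‖E i j‖ ^ (2 : ℝ) = |E i j| ^ 2 := fun i j => by
    rw [Real.norm_eq_abs]; norm_cast
  simp_rw [h1]
  calc |E i j| ^ 2 ≤ ∑ j, |E i j| ^ 2 :=
        Finset.single_le_sum (f := fun j => |E i j| ^ 2) (fun _ _ => by positivity)
          (Finset.mem_univ j)
    _ ≤ _ := Finset.single_le_sum (f := fun i => ∑ j, |E i j| ^ 2)
        (fun _ _ => Finset.sum_nonneg fun _ _ => by positivity) (Finset.mem_univ i)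

lemma frobenius_le_of_abs_entry_le {d : ℕ} (E : Matrix (Fin d) (Fin d) ℝ) {c : ℝ} (hc : 0 ≤ c)
    (h : ∀ i j, |E i j| ≤ c) : ‖E‖ ≤ d * c := by
  rw [frobenius_norm_def, ← Real.sqrt_eq_rpow]
  refine Real.sqrt_le_iff.2 ⟨by positivity, ?_⟩
  have h1 : ∀ i j, ‖E i j‖ ^ (2 : ℝ) ≤ c ^ 2 := fun i j => by
    rw [Real.norm_eq_abs]
    norm_cast
    exact pow_le_pow_left₀ (abs_nonneg _) (h i j) 2
  refine (Finset.sum_le_sum fun i _ => Finset.sum_le_sum fun j _ => h1 i j).trans (le_of_eq ?_)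
  simp
  ring

/-- Gelfand's formula gives `‖T ^ n‖ ≤ r ^ n` for large `n`; the finitely many remaining powers go
into the constant. -/
lemma exists_norm_pow_le_of_spectrum {d : ℕ} (T : Matrix (Fin d) (Fin d) ℂ) {r : ℝ} (hr : 0 < r)
    (h : ∀ l ∈ spectrum ℂ T, ‖l‖ < r) : ∃ C : ℝ, ∀ n : ℕ, ‖T ^ n‖ ≤ C * r ^ n := by
  rcases Nat.eq_zero_or_pos d with rfl | hd
  · refine ⟨0, fun n => ?_⟩
    rw [Subsingleton.elim (T ^ n) 0]
    simp
  have : Nonempty (Fin d) := ⟨⟨0, hd⟩⟩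
  have : CompleteSpace (Matrix (Fin d) (Fin d) ℂ) := FiniteDimensional.complete ℂ _
  have h1 : spectralRadius ℂ T < ENNReal.ofReal r :=
    spectrum.spectralRadius_lt_of_forall_lt T fun z hz => by
      rw [← NNReal.coe_lt_coe, Real.coe_toNNReal r hr.le]
      exact h z hz
  have h2 := (spectrum.pow_norm_pow_one_div_tendsto_nhds_spectralRadius T).eventually
    (gt_mem_nhds h1)
  have h3 : ∀ᶠ n : ℕ in atTop, ‖T ^ n‖ ≤ r ^ n := by
    filter_upwards [h2, eventually_ge_atTop 1] with n hn hn1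
    have h4 := (ENNReal.ofReal_lt_ofReal_iff hr).1 hn
    have h5 := pow_le_pow_left₀ (Real.rpow_nonneg (norm_nonneg _) _) h4.le n
    rwa [← Real.rpow_natCast, ← Real.rpow_mul (norm_nonneg _), one_div,
      inv_mul_cancel₀ (by positivity), Real.rpow_one] at h5
  obtain ⟨M, hM⟩ := eventually_atTop.1 h3
  refine ⟨1 + ∑ k ∈ Finset.range M, ‖T ^ k‖ / r ^ k, fun n => ?_⟩
  have hs : 0 ≤ ∑ k ∈ Finset.range M, ‖T ^ k‖ / r ^ k := Finset.sum_nonneg fun _ _ => by positivity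
  rcases le_or_gt M n with hn | hn
  · exact (hM n hn).trans (le_mul_of_one_le_left (by positivity) (by linarith))
  · have h6 : ‖T ^ n‖ / r ^ n ≤ ∑ k ∈ Finset.range M, ‖T ^ k‖ / r ^ k :=
      Finset.single_le_sum (f := fun k => ‖T ^ k‖ / r ^ k) (fun _ _ => by positivity)
        (Finset.mem_range.2 hn)
    rw [← div_le_iff₀ (by positivity)]
    linarith

lemma isEigenvalue_of_mem_spectrum {d : ℕ} (A : Matrix (Fin d) (Fin d) ℝ) {e : ℝ} (he : 0 < e)
    {l : ℂ} (hl : l ∈ spectrum ℂ (toComplex (1 + e • A))) : IsEigenvalue A ((l - 1) / e) := by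
  have he' : (e : ℂ) ≠ 0 := by exact_mod_cast he.ne'
  rw [← Matrix.spectrum_toLin', ← Module.End.hasEigenvalue_iff_mem_spectrum] at hl
  obtain ⟨v, hv⟩ := hl.exists_hasEigenvector
  refine Module.End.hasEigenvalue_of_hasEigenvector (x := v) ⟨?_, hv.2⟩
  rw [Module.End.mem_eigenspace_iff]
  have h1 : toComplex (1 + e • A) *ᵥ v = l • v := by
    simpa [Matrix.toLin'_apply] using hv.apply_eq_smul
  have h2 : toComplex (1 + e • A) = 1 + (e : ℂ) • toComplex A := by
    ext i j
    simp only [toComplex, Matrix.map_apply, Matrix.add_apply, Matrix.smul_apply, Matrix.one_apply,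
      smul_eq_mul]
    split_ifs <;> simp
  rw [h2, Matrix.add_mulVec, Matrix.one_mulVec, Matrix.smul_mulVec] at h1
  rw [Matrix.toLin'_apply, div_eq_inv_mul, mul_smul, sub_smul, one_smul, ← h1, add_sub_cancel_left,
    inv_smul_smul₀ he']

/-- If all eigenvalues of `A` have a real part below `-b`, then `A` has an adapted norm with a rate
above `b`. -/
lemma exists_isAdaptedNorm {d : ℕ} (A : Matrix (Fin d) (Fin d) ℝ) {b b' : ℝ} (hb : 0 < b)
    (hbb : b < b') (hA : ∀ l : ℂ, IsEigenvalue A l → l.re < -b) :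
    ∃ a N, b < a ∧ a < b' ∧ IsAdaptedNorm A a N := by
  have hfin : {l : ℂ | IsEigenvalue A l}.Finite := Module.End.finite_hasEigenvalue _
  -- There are finitely many eigenvalues, so the strict bound survives for some `c > b`. The gap
  -- between `a` and `c` will absorb quadratic terms.
  obtain ⟨c, hbc, hcb, hc⟩ : ∃ c, b < c ∧ c < b' ∧ ∀ l, IsEigenvalue A l → l.re < -c := by
    have h1 : ∀ᶠ c in 𝓝[>] b, ∀ l ∈ {l : ℂ | IsEigenvalue A l}, l.re < -c := by
      rw [Filter.eventually_all_finite hfin]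
      intro l hl
      have : ∀ᶠ c in 𝓝 b, l.re < -c := by
        have h2 : Tendsto (fun c : ℝ => -c) (𝓝 b) (𝓝 (-b)) := tendsto_id.neg
        exact h2.eventually (lt_mem_nhds (hA l hl))
      exact this.filter_mono nhdsWithin_le_nhds
    obtain ⟨c, h3, h4, h5⟩ := (h1.and (Ioo_mem_nhdsGT hbb)).exists
    exact ⟨c, h4, h5, h3⟩
  set a := (b + c) / 2
  have hba : b < a := by simp only [a]; linarith
  have hac : a < c := by simp only [a]; linarith
  obtain ⟨M, hM0, hM⟩ : ∃ M : ℝ, 0 < M ∧ ∀ l, IsEigenvalue A l → ‖l‖ ^ 2 ≤ M := by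
    obtain ⟨M, hM⟩ := (hfin.image fun l => ‖l‖ ^ 2).bddAbove
    exact ⟨max M 1, by positivity, fun l hl => (hM ⟨l, hl, rfl⟩).trans (le_max_left _ _)⟩
  -- An eigenvalue `k` of `A` yields `|1 + e k|² = 1 + 2 e Re k + e² |k|²`. The second bound on `e`
  -- gives `e² |k|² ≤ e (c - a)`, hence `|1 + e k| < 1 - e a`; the first keeps `1 - e a` positive.
  set e := min (1 / (2 * a)) ((c - a) / M)
  have ha0 : 0 < a := hb.trans hba
  have he0 : 0 < e := lt_min (by positivity) (div_pos (by linarith) hM0)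
  have hea : e * a ≤ 1 / 2 := by
    have : e ≤ 1 / (2 * a) := min_le_left _ _
    rw [le_div_iff₀ (by positivity)] at this
    linarith
  have heM : e * M ≤ c - a := by
    have : e ≤ (c - a) / M := min_le_right _ _
    rwa [le_div_iff₀ hM0] at this
  set r := 1 - e * a
  have hr : 0 < r := by simp only [r]; linarith
  have hspec : ∀ l ∈ spectrum ℂ (toComplex (1 + e • A)), ‖l‖ < r := by
    intro l hl
    have hk := isEigenvalue_of_mem_spectrum A he0 hl
    set k : ℂ := (l - 1) / e
    have hl2 : l = 1 + e * k := by
      have he' : (e : ℂ) ≠ 0 := by exact_mod_cast he0.ne'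
      simp only [k]
      field_simp
      ring
    have h1 : ‖l‖ ^ 2 = 1 + 2 * e * k.re + e ^ 2 * ‖k‖ ^ 2 := by
      rw [hl2, ← Complex.normSq_eq_norm_sq, ← Complex.normSq_eq_norm_sq, Complex.normSq_apply,
        Complex.normSq_apply]
      simp
      ring
    have h2 := hc k hk
    have h3 := hM k hk
    refine lt_of_pow_lt_pow_left₀ 2 hr.le ?_
    rw [h1]
    have h4 : e ^ 2 * ‖k‖ ^ 2 ≤ e * (c - a) := by nlinarith [mul_pos he0 he0]
    simp only [r]
    nlinarith [mul_pos he0 (sub_pos.2 hac), mul_pos he0 ha0]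
  obtain ⟨C, hC⟩ := exists_norm_pow_le_of_spectrum _ hr hspec
  set X := 1 + e • A
  have hX : ∀ n, ‖X ^ n‖ ≤ C * r ^ n := by
    intro n
    refine le_trans (le_of_eq ?_) (hC n)
    have : toComplex X ^ n = toComplex (X ^ n) := by
      simp only [toComplex]
      exact (map_pow (Complex.ofRealHom.mapMatrix (m := Fin d)) X n).symm
    rw [this, toComplex, frobenius_norm_map_eq _ _ fun x => Complex.norm_real x]
  have hY : ∀ n, ‖Xᵀ ^ n‖ ≤ C * r ^ n := by
    intro n
    rw [← Matrix.transpose_pow, frobenius_norm_transpose]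
    exact hX n
  obtain ⟨N, h1, h2, h3, h4, h5, h6⟩ := exists_norm_mul_le hr hX hY
  refine ⟨a, N, hba, hac.trans hcb, ⟨fun E => (norm_nonneg _).trans (h1 E),
    fun E i j => (abs_entry_le_frobenius E i j).trans (h1 E),
    ⟨C ^ 2 * d, by positivity, fun E c hc' hE => (h2 E).trans ?_⟩, h3, h4, ?_⟩⟩
  · rw [mul_assoc]
    exact mul_le_mul_of_nonneg_left (frobenius_le_of_abs_entry_le E hc' hE) (by positivity)
  have hlarge : ∀ᶠ n : ℕ in atTop, 1 / e ≤ (n : ℝ) :=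
    tendsto_natCast_atTop_atTop.eventually_ge_atTop _
  filter_upwards [hlarge] with n hn E
  set s := 1 / ((n : ℝ) + 1)
  have hs0 : 0 < s := by positivity
  set p := s / e
  have hp0 : 0 ≤ p := by positivity
  have hp1 : p ≤ 1 := by
    simp only [p, s]
    rw [div_le_one he0, div_le_iff₀ (by positivity)]
    rw [div_le_iff₀ he0] at hn
    nlinarith
  -- For small steps `1 + s A` is a convex combination of `1` and `X = 1 + e A`, so a single norm
  -- adapted to `X` serves all large `n`: the factor is `1 - p + p (1 - e a) = 1 - s a`.
  have hB : 1 + s • A = (1 - p) • (1 : Matrix (Fin d) (Fin d) ℝ) + p • X := by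
    have : p * e = s := div_mul_cancel₀ _ he0.ne'
    simp only [X, smul_add, smul_smul, this, sub_smul, one_smul]
    abel
  have hp1' : 0 ≤ 1 - p := by linarith
  have hL : ∀ F, N ((1 + s • A) * F) ≤ (1 - p + p * r) * N F := by
    intro F
    rw [hB, add_mul, smul_mul_assoc, smul_mul_assoc, one_mul]
    calc _ ≤ N ((1 - p) • F) + N (p • (X * F)) := h3 _ _
      _ ≤ (1 - p) * N F + p * (r * N F) := add_le_add (h4 _ hp1' _)
          ((h4 _ hp0 _).trans (mul_le_mul_of_nonneg_left (h5 F) hp0))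
      _ = _ := by ring
  have hR : ∀ F, N (F * (1 + s • A)ᵀ) ≤ (1 - p + p * r) * N F := by
    intro F
    rw [hB, transpose_add, transpose_smul, transpose_smul, transpose_one, mul_add, mul_smul_comm,
      mul_smul_comm, mul_one]
    calc _ ≤ N ((1 - p) • F) + N (p • (F * Xᵀ)) := h3 _ _
      _ ≤ (1 - p) * N F + p * (r * N F) := add_le_add (h4 _ hp1' _)
          ((h4 _ hp0 _).trans (mul_le_mul_of_nonneg_left (h6 F) hp0))
      _ = _ := by ring
  have hpr : 1 - p + p * r = 1 - a / ((n : ℝ) + 1) := by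
    simp only [r, p, s]
    field_simp
    ring
  have hpr0 : 0 ≤ 1 - p + p * r := by positivity
  rw [← hpr]
  refine (hR _).trans ?_
  rw [pow_two, mul_assoc]
  exact mul_le_mul_of_nonneg_left (hL E) hpr0

end LinearSA

namespace LinearSA

/-! ### Rates -/

lemma tendsto_rpow_mul_abs_zero {e : ℕ → ℝ} {r D : ℝ}
    (h : ∀ᶠ n : ℕ in atTop, |e n| ≤ D * (n : ℝ) ^ (-r)) {s : ℝ} (hs : s < r) :
    Tendsto (fun n : ℕ => (n : ℝ) ^ s * |e n|) atTop (𝓝 0) := by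
  have h1 : Tendsto (fun n : ℕ => D * (n : ℝ) ^ (-(r - s))) atTop (𝓝 0) := by
    have := ((tendsto_rpow_neg_atTop (sub_pos.2 hs)).comp tendsto_natCast_atTop_atTop).const_mul D
    simpa using this
  refine tendsto_of_tendsto_of_tendsto_of_le_of_le' tendsto_const_nhds h1
    (Eventually.of_forall fun n => by positivity) ?_
  filter_upwards [h, eventually_ge_atTop 1] with n hn hn1
  have hn' : (0 : ℝ) < n := by exact_mod_cast hn1
  calc (n : ℝ) ^ s * |e n| ≤ (n : ℝ) ^ s * (D * (n : ℝ) ^ (-r)) := by gcongr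
    _ = D * (n : ℝ) ^ (-(r - s)) := by
      rw [show -(r - s) = s + -r by ring, Real.rpow_add hn']
      ring

lemma convergesAtRate_of_bounds {e : ℕ → ℝ} {r c D : ℝ} (hc : 0 < c)
    (hl : ∀ᶠ n : ℕ in atTop, c * (n : ℝ) ^ (-r) ≤ |e n|)
    (hu : ∀ᶠ n : ℕ in atTop, |e n| ≤ D * (n : ℝ) ^ (-r)) : ConvergesAtRate e r := by
  refine ⟨fun s hs => tendsto_rpow_mul_abs_zero hu hs, fun s hs => ?_⟩
  have h1 : Tendsto (fun n : ℕ => c * (n : ℝ) ^ (s - r)) atTop atTop :=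
    ((tendsto_rpow_atTop (sub_pos.2 hs)).comp tendsto_natCast_atTop_atTop).const_mul_atTop hc
  refine tendsto_atTop_mono' _ ?_ h1
  filter_upwards [hl, eventually_ge_atTop 1] with n hn hn1
  have hn' : (0 : ℝ) < n := by exact_mod_cast hn1
  calc c * (n : ℝ) ^ (s - r) = (n : ℝ) ^ s * (c * (n : ℝ) ^ (-r)) := by
        rw [sub_eq_add_neg, Real.rpow_add hn']
        ring
    _ ≤ _ := by gcongr

/-! ### The scalar recursion in a Hilbert space -/

/-- Absorbing the coboundary part of the noise into the state of the recursion. -/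
lemma recursion_corrected {E : Type*} [AddCommGroup E] [Module ℝ E] (L : E →ₗ[ℝ] E)
    {x y m h h' : E} {t : ℝ} (ht : 0 < t)
    (hrec : y = x + (1 / (t + 1)) • (L x + (m + h - h'))) :
    y + (1 / (t + 1)) • h' = (x + (1 / t) • h) + (1 / (t + 1)) • L (x + (1 / t) • h)
      + (1 / (t + 1)) • m + (1 / (t + 1)) ^ 2 • (-((t + 1) / t)) • (h + L h) := by
  have ht1 : t + 1 ≠ 0 := by positivity
  have ht0 : t ≠ 0 := ht.ne'
  subst hrec
  rw [map_add, map_smul]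
  match_scalars <;> field_simp <;> ring

open scoped InnerProductSpace

section Scalar

variable {H : Type*} [NormedAddCommGroup H] [InnerProductSpace ℂ H]

lemma norm_sq_add_of_orthogonal {u v m : H} {b c : ℂ} {s : ℝ} (hu : ⟪m, u⟫_ℂ = 0)
    (hv : ⟪m, v⟫_ℂ = 0) :
    ‖b • u + s • m + c • v‖ ^ 2 = ‖b • u + c • v‖ ^ 2 + s ^ 2 * ‖m‖ ^ 2 := by
  have h0 : ⟪b • u + c • v, s • m⟫_ℂ = 0 := by
    rw [inner_eq_zero_symm, inner_add_right, inner_smul_right, inner_smul_right,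
      inner_smul_left_eq_smul, inner_smul_left_eq_smul, hu, hv]
    simp
  have h1 := norm_add_sq_eq_norm_sq_add_norm_sq_of_inner_eq_zero _ _ h0
  rw [show b • u + s • m + c • v = (b • u + c • v) + s • m by abel, pow_two, h1, norm_smul,
    Real.norm_eq_abs, ← sq_abs s]
  ring

lemma norm_sq_one_add_mul (t : ℝ) (l : ℂ) :
    ‖1 + (t : ℂ) * l‖ ^ 2 = 1 - 2 * (-l.re) * t + t ^ 2 * ‖l‖ ^ 2 := by
  rw [← Complex.normSq_eq_norm_sq, ← Complex.normSq_eq_norm_sq, Complex.normSq_apply,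
    Complex.normSq_apply]
  simp
  ring

lemma norm_one_add_mul_le {t : ℝ} (ht : 0 ≤ t) (ht1 : t ≤ 1) (l : ℂ) :
    ‖1 + (t : ℂ) * l‖ ≤ 1 + ‖l‖ := by
  refine (norm_add_le _ _).trans ?_
  rw [norm_mul, Complex.norm_real, Real.norm_of_nonneg ht, norm_one]
  nlinarith [norm_nonneg l]

/-- The cross term carries a factor `t²`; splitting it by `2 w G ≤ w² + G²` changes the contraction
only at second order and adds an input `O(t²)`. -/
lemma norm_sq_step_le {t G : ℝ} (ht : 0 ≤ t) (ht1 : t ≤ 1) (hG : 0 ≤ G) {y g : H} (l : ℂ)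
    (hg : ‖g‖ ≤ G) :
    ‖(1 + (t : ℂ) * l) • y + ((t ^ 2 : ℝ) : ℂ) • g‖ ^ 2 ≤
      (1 - 2 * (-l.re) * t + (‖l‖ ^ 2 + (1 + ‖l‖)) * t ^ 2) * ‖y‖ ^ 2
        + ((1 + ‖l‖) * G ^ 2 + G ^ 2) * t ^ 2 := by
  have n1 : ‖(1 + (t : ℂ) * l) • y + ((t ^ 2 : ℝ) : ℂ) • g‖ ≤
      ‖1 + (t : ℂ) * l‖ * ‖y‖ + t ^ 2 * G := by
    refine (norm_add_le _ _).trans ?_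
    rw [norm_smul, norm_smul, Complex.norm_real, Real.norm_of_nonneg (by positivity)]
    gcongr
  refine (pow_le_pow_left₀ (norm_nonneg _) n1 2).trans ?_
  have n3 := norm_sq_one_add_mul t l
  have n4 := norm_one_add_mul_le ht ht1 l
  have hq : 0 ≤ 1 + ‖l‖ := by positivity
  generalize 1 + ‖l‖ = q at *
  generalize ‖1 + (t : ℂ) * l‖ = B at *
  have hw : 0 ≤ ‖y‖ := norm_nonneg _
  generalize ‖y‖ = w at *
  have n5 : 2 * (B * w) * (t ^ 2 * G) ≤ t ^ 2 * (q * (w ^ 2 + G ^ 2)) := by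
    have : 2 * B * w * G ≤ q * (w ^ 2 + G ^ 2) := by
      calc 2 * B * w * G = B * (2 * w * G) := by ring
        _ ≤ q * (w ^ 2 + G ^ 2) := mul_le_mul n4 (by nlinarith [sq_nonneg (w - G)])
            (by positivity) (by linarith)
    nlinarith [mul_le_mul_of_nonneg_left this (sq_nonneg t)]
  have n6 : (t ^ 2 * G) ^ 2 ≤ t ^ 2 * G ^ 2 := by
    have : t ^ 2 ≤ 1 := pow_le_one₀ ht ht1
    nlinarith [mul_le_mul_of_nonneg_left this (mul_nonneg (sq_nonneg t) (sq_nonneg G))]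
  have n8 : (B * w + t ^ 2 * G) ^ 2 = (1 - 2 * (-l.re) * t + t ^ 2 * ‖l‖ ^ 2) * w ^ 2
      + 2 * (B * w) * (t ^ 2 * G) + (t ^ 2 * G) ^ 2 := by
    rw [← n3]; ring
  linarith

/-- Young's inequality with weight `σ` bounds the cross term by `σ t²` plus a multiple of `t² ‖y‖²`.
The free parameter lets the loss `σ t²` be kept below the contribution of the noise. -/
lemma le_norm_sq_step {t G σ : ℝ} (ht : 0 ≤ t) (ht1 : t ≤ 1) (hG : 0 ≤ G) (hσ : 0 < σ) {y g : H}
    (l : ℂ) (hg : ‖g‖ ≤ G) :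
    (1 - 2 * (-l.re) * t - (((1 + ‖l‖) * G) ^ 2 / σ) * t ^ 2) * ‖y‖ ^ 2 - σ * t ^ 2 ≤
      ‖(1 + (t : ℂ) * l) • y + ((t ^ 2 : ℝ) : ℂ) • g‖ ^ 2 := by
  have n1 : ‖1 + (t : ℂ) * l‖ * ‖y‖ ≤
      ‖(1 + (t : ℂ) * l) • y + ((t ^ 2 : ℝ) : ℂ) • g‖ + t ^ 2 * G := by
    have := norm_sub_le ((1 + (t : ℂ) * l) • y + ((t ^ 2 : ℝ) : ℂ) • g) (((t ^ 2 : ℝ) : ℂ) • g)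
    rw [add_sub_cancel_right, norm_smul, norm_smul ((t ^ 2 : ℝ) : ℂ), Complex.norm_real,
      Real.norm_of_nonneg (by positivity)] at this
    refine this.trans ?_
    gcongr
  have hW : 0 ≤ ‖(1 + (t : ℂ) * l) • y + ((t ^ 2 : ℝ) : ℂ) • g‖ := norm_nonneg _
  generalize ‖(1 + (t : ℂ) * l) • y + ((t ^ 2 : ℝ) : ℂ) • g‖ = W at *
  have n3 := norm_sq_one_add_mul t l
  have n4 := norm_one_add_mul_le ht ht1 l
  have hq : 0 ≤ 1 + ‖l‖ := by positivity
  generalize 1 + ‖l‖ = q at *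
  have hB0 : 0 ≤ ‖1 + (t : ℂ) * l‖ := norm_nonneg _
  generalize ‖1 + (t : ℂ) * l‖ = B at *
  have hw : 0 ≤ ‖y‖ := norm_nonneg _
  generalize ‖y‖ = w at *
  have n5 : (B * w) ^ 2 - 2 * (B * w) * (t ^ 2 * G) ≤ W ^ 2 := by
    have h1 : 0 ≤ t ^ 2 * G := by positivity
    rcases le_total (B * w) (t ^ 2 * G) with h2 | h2
    · nlinarith [mul_nonneg hB0 hw]
    · have h3 : (B * w - t ^ 2 * G) ^ 2 ≤ W ^ 2 :=
        pow_le_pow_left₀ (by linarith) (by linarith) 2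
      nlinarith
  have n6 : 2 * (B * w) * (t ^ 2 * G) ≤ t ^ 2 * (σ + (q * G) ^ 2 / σ * w ^ 2) := by
    have h1 : 2 * (q * G) * w ≤ σ + (q * G) ^ 2 / σ * w ^ 2 := by
      have h2 : (q * G) ^ 2 / σ * σ = (q * G) ^ 2 := div_mul_cancel₀ _ hσ.ne'
      have h3 : 0 ≤ (σ - (q * G) * w) ^ 2 := sq_nonneg _
      have h4 : 0 ≤ σ * (σ + (q * G) ^ 2 / σ * w ^ 2 - 2 * (q * G) * w) := by
        have h5 : σ * (σ + (q * G) ^ 2 / σ * w ^ 2 - 2 * (q * G) * w)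
          = σ ^ 2 + ((q * G) ^ 2 / σ * σ) * w ^ 2 - 2 * σ * ((q * G) * w) := by ring
        rw [h5, h2]
        linarith
      linarith [nonneg_of_mul_nonneg_right h4 hσ]
    have h2 : 2 * (B * w) * G ≤ 2 * (q * G) * w := by
      nlinarith [mul_le_mul_of_nonneg_right n4 (mul_nonneg hw hG)]
    nlinarith [mul_le_mul_of_nonneg_left (h2.trans h1) (sq_nonneg t)]
  have n8 : (B * w) ^ 2 = (1 - 2 * (-l.re) * t + t ^ 2 * ‖l‖ ^ 2) * w ^ 2 := by rw [← n3]; ring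
  have n9 : 0 ≤ t ^ 2 * ‖l‖ ^ 2 * w ^ 2 := by positivity
  linarith

lemma one_div_succ_le_one (n : ℕ) : 1 / ((n : ℝ) + 1) ≤ 1 := by
  rw [div_le_one (by positivity)]
  linarith [(Nat.cast_nonneg n : (0 : ℝ) ≤ n)]

/-- Upper and lower bounds for `‖y n‖ ^ 2` when `y` follows a scalar recursion with orthogonal
noise and inputs of the size `O(n⁻²)`. -/
lemma norm_sq_recursion_bounds {y m g : ℕ → H} {l : ℂ} {G σ : ℝ} (hl : -(1 / 2) < l.re)
    (hσ : 0 < σ) (hG0 : 0 ≤ G) (hG : ∀ n, 1 ≤ n → ‖g n‖ ≤ G)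
    (hm : Tendsto (fun n => ‖m n‖ ^ 2) atTop (𝓝 σ))
    (hstep : ∀ n : ℕ, 1 ≤ n → ‖y (n + 1)‖ ^ 2 =
      ‖(1 + ((1 / ((n : ℝ) + 1) : ℝ) : ℂ) * l) • y n
        + (((1 / ((n : ℝ) + 1)) ^ 2 : ℝ) : ℂ) • g n‖ ^ 2
      + (1 / ((n : ℝ) + 1)) ^ 2 * ‖m (n + 1)‖ ^ 2) :
    (∃ D : ℝ, 0 ≤ D ∧ ∀ᶠ n : ℕ in atTop, ‖y n‖ ^ 2 ≤ D * (n : ℝ) ^ (-(2 * (-l.re)))) ∧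
    ∃ c : ℝ, 0 < c ∧ ∀ᶠ n : ℕ in atTop, c * (n : ℝ) ^ (-(2 * (-l.re))) ≤ ‖y n‖ ^ 2 := by
  have hm1 : ∀ᶠ n : ℕ in atTop, ‖m (n + 1)‖ ^ 2 ≤ 2 * σ ∧ σ / 2 ≤ ‖m (n + 1)‖ ^ 2 := by
    have := (tendsto_add_atTop_iff_nat 1).2 hm
    filter_upwards [this.eventually (ge_mem_nhds (by linarith : σ < 2 * σ)),
      this.eventually (le_mem_nhds (by linarith : σ / 2 < σ))] with n h1 h2 using ⟨h1, h2⟩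
  have tpos : ∀ n : ℕ, 0 < 1 / ((n : ℝ) + 1) := fun n => by positivity
  constructor
  · set C1 := ‖l‖ ^ 2 + (1 + ‖l‖)
    set C2 := (1 + ‖l‖) * G ^ 2 + G ^ 2
    have hC1 : 0 ≤ C1 := by positivity
    have hC2 : 0 ≤ C2 := by positivity
    -- The inputs are `O(n⁻²)`, and the condition `a + 1 < 2` with `a = 2 (-l.re)` is the assumption
    -- `-1/2 < l.re`.
    refine exists_le_rpow_of_recursion (u := fun n => ‖y n‖ ^ 2) (b := 2)
      (C := C1 + C2 + 2 * σ) (fun n => by positivity) (by linarith) (by positivity) ?_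
    filter_upwards [hm1, eventually_ge_atTop 1] with n hn hn1
    rw [hstep n hn1]
    have e1 : ((n : ℝ) + 1) ^ (-2 : ℝ) = (1 / ((n : ℝ) + 1)) ^ 2 := by
      rw [Real.rpow_neg (by positivity)]
      norm_cast
      simp
    have e2 : (1 - 2 * (-l.re) / ((n : ℝ) + 1) + (C1 + C2 + 2 * σ) / ((n : ℝ) + 1) ^ 2)
        = 1 - 2 * (-l.re) * (1 / ((n : ℝ) + 1)) + (C1 + C2 + 2 * σ) * (1 / ((n : ℝ) + 1)) ^ 2 := by
      field_simp
    rw [e1, e2]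
    have h1 := norm_sq_step_le (tpos n).le (one_div_succ_le_one n) hG0 (y := y n) l (hG n hn1)
    have h2 := tpos n
    generalize 1 / ((n : ℝ) + 1) = t at *
    have h3 : t ^ 2 * ‖m (n + 1)‖ ^ 2 ≤ t ^ 2 * (2 * σ) := by gcongr; exact hn.1
    have h4 : 0 ≤ (C2 + 2 * σ) * t ^ 2 * ‖y n‖ ^ 2 := by positivity
    have h5 : 0 ≤ C1 * t ^ 2 := by positivity
    linarith
  -- The noise eventually contributes at least `t² σ / 2` and Young's inequality costs `t² σ / 4`.
  -- The surplus `t² σ / 4` makes `y` nonzero, which is what the lower bound for contracting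
  -- sequences needs.
  · set C' := ((1 + ‖l‖) * G) ^ 2 / (σ / 4)
    have hC' : 0 ≤ C' := by positivity
    have hlow : ∀ᶠ n : ℕ in atTop,
        (1 - 2 * (-l.re) / ((n : ℝ) + 1) - C' / ((n : ℝ) + 1) ^ 2) * ‖y n‖ ^ 2
          + (1 / ((n : ℝ) + 1)) ^ 2 * (σ / 4) ≤ ‖y (n + 1)‖ ^ 2 := by
      filter_upwards [hm1, eventually_ge_atTop 1] with n hn hn1
      rw [hstep n hn1]
      have e2 : (1 - 2 * (-l.re) / ((n : ℝ) + 1) - C' / ((n : ℝ) + 1) ^ 2)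
          = 1 - 2 * (-l.re) * (1 / ((n : ℝ) + 1)) - C' * (1 / ((n : ℝ) + 1)) ^ 2 := by
        field_simp
      rw [e2]
      have h1 := le_norm_sq_step (tpos n).le (one_div_succ_le_one n) hG0
        (show 0 < σ / 4 by positivity) (y := y n) l (hG n hn1)
      generalize 1 / ((n : ℝ) + 1) = t at *
      change (1 - 2 * (-l.re) * t - C' * t ^ 2) * _ - _ ≤ _ at h1
      have h3 : t ^ 2 * (σ / 2) ≤ t ^ 2 * ‖m (n + 1)‖ ^ 2 := by gcongr; exact hn.2
      linarith
    have hcoef : ∀ᶠ n : ℕ in atTop,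
        0 ≤ 1 - 2 * (-l.re) / ((n : ℝ) + 1) - C' / ((n : ℝ) + 1) ^ 2 := by
      have h1 : Tendsto (fun n : ℕ => (1 : ℝ) / ((n : ℝ) + 1)) atTop (𝓝 0) :=
        tendsto_one_div_add_atTop_nhds_zero_nat
      have h2 : Tendsto (fun n : ℕ =>
          1 - 2 * (-l.re) * (1 / ((n : ℝ) + 1)) - C' * (1 / ((n : ℝ) + 1)) ^ 2)
          atTop (𝓝 (1 - 2 * (-l.re) * 0 - C' * 0 ^ 2)) :=
        (tendsto_const_nhds.sub (h1.const_mul _)).sub ((h1.pow 2).const_mul C')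
      filter_upwards [h2.eventually
        (le_mem_nhds (by norm_num : (0 : ℝ) < 1 - 2 * (-l.re) * 0 - C' * 0 ^ 2))] with n hn
      refine hn.trans (le_of_eq ?_)
      field_simp
    have hpos : ∀ᶠ n in atTop, 0 < ‖y n‖ ^ 2 := by
      obtain ⟨M, hM⟩ := eventually_atTop.1 (hlow.and hcoef)
      filter_upwards [eventually_ge_atTop (M + 1)] with n hn
      obtain ⟨j, rfl⟩ := Nat.exists_eq_add_of_le' (show 1 ≤ n by omega)
      obtain ⟨h1, h2⟩ := hM j (by omega)
      refine lt_of_lt_of_le ?_ h1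
      have := tpos j
      positivity
    refine exists_rpow_le_of_recursion (C := C') hpos hC' ?_
    filter_upwards [hlow] with n hn
    have := tpos n
    linarith [show 0 ≤ (1 / ((n : ℝ) + 1)) ^ 2 * (σ / 4) by positivity]

/-- Two sequences at a distance `O(1 / n)` share the rate `n ^ (-a)` of their squared norms if
`a < 2`. -/
lemma convergesAtRate_norm_sq_of_close {E : Type*} [NormedAddCommGroup E] {x y : ℕ → E}
    {K a c D : ℝ} (ha : a < 2) (hK : 0 ≤ K)
    (hxy : ∀ n : ℕ, 1 ≤ n → ‖x n - y n‖ ≤ K * (n : ℝ) ^ (-1 : ℝ)) (hc0 : 0 < c) (hD0 : 0 ≤ D)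
    (hD : ∀ᶠ n : ℕ in atTop, ‖y n‖ ^ 2 ≤ D * (n : ℝ) ^ (-a))
    (hc : ∀ᶠ n : ℕ in atTop, c * (n : ℝ) ^ (-a) ≤ ‖y n‖ ^ 2) :
    ConvergesAtRate (fun n => ‖x n‖ ^ 2) a := by
  have hsq : ∀ n : ℕ, (n : ℝ) ^ (-a) = ((n : ℝ) ^ (-(a / 2))) ^ 2 := by
    intro n
    rw [← Real.rpow_natCast, ← Real.rpow_mul (by positivity)]
    congr 1
    push_cast
    ring
  -- Because `a / 2 < 1`, the distance `O(1 / n)` is negligible against the size `n ^ (-(a / 2))` of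
  -- `y`.
  have hsmall : ∀ η : ℝ, 0 < η →
      ∀ᶠ n : ℕ in atTop, K * (n : ℝ) ^ (-1 : ℝ) ≤ η * (n : ℝ) ^ (-(a / 2)) := by
    intro η hη
    have h1 := tendsto_rpow_mul_abs_zero (e := fun n : ℕ => K * (n : ℝ) ^ (-1 : ℝ)) (r := 1)
      (D := K) (Eventually.of_forall fun n => by
        rw [abs_of_nonneg (by positivity)]) (show a / 2 < 1 by linarith)
    filter_upwards [h1.eventually (ge_mem_nhds hη), eventually_ge_atTop 1] with n hn hn1
    have hn' : (0 : ℝ) < n := by exact_mod_cast hn1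
    rw [abs_of_nonneg (by positivity)] at hn
    rwa [Real.rpow_neg hn'.le (a / 2), ← div_eq_mul_inv, le_div_iff₀ (by positivity), mul_comm]
  refine convergesAtRate_of_bounds (c := c / 4) (D := (Real.sqrt D + 1) ^ 2) (by positivity) ?_ ?_
  · filter_upwards [hc, hsmall (Real.sqrt c / 2) (by positivity), eventually_ge_atTop 1]
      with n h1 h2 hn
    rw [hsq n] at h1 ⊢
    rw [abs_of_nonneg (by positivity)]
    have h3 : Real.sqrt c * (n : ℝ) ^ (-(a / 2)) ≤ ‖y n‖ := by
      refine le_of_sq_le_sq ?_ (norm_nonneg _)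
      rwa [mul_pow, Real.sq_sqrt hc0.le]
    have h4 : ‖y n‖ - ‖x n‖ ≤ ‖x n - y n‖ := by
      rw [norm_sub_rev]; exact norm_sub_norm_le _ _
    have h5 := hxy n hn
    have h6 : Real.sqrt c / 2 * (n : ℝ) ^ (-(a / 2)) ≤ ‖x n‖ := by linarith
    have h7 := pow_le_pow_left₀ (by positivity) h6 2
    rw [mul_pow, div_pow, Real.sq_sqrt hc0.le] at h7
    linarith
  · filter_upwards [hD, hsmall 1 one_pos, eventually_ge_atTop 1] with n h1 h2 hn
    rw [hsq n] at h1 ⊢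
    rw [abs_of_nonneg (by positivity), ← mul_pow]
    refine pow_le_pow_left₀ (norm_nonneg _) ?_ 2
    have h3 : ‖y n‖ ≤ Real.sqrt D * (n : ℝ) ^ (-(a / 2)) := by
      refine le_of_sq_le_sq ?_ (by positivity)
      rwa [mul_pow, Real.sq_sqrt hD0]
    have h4 : ‖x n‖ - ‖y n‖ ≤ ‖x n - y n‖ := norm_sub_norm_le _ _
    have h5 := hxy n hn
    linarith

/-- The corrected state `y n = x n + h n / n` has noise orthogonal to its past, so Pythagoras turns
the recursion into one for `‖y n‖ ^ 2`. The application is to `vᵀ x n` in complex `L²`. -/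
lemma convergesAtRate_norm_sq {x m h : ℕ → H} {l : ℂ} {K σ : ℝ} (hl : -(1 / 2) < l.re)
    (hσ : 0 < σ)
    (hrec : ∀ n : ℕ, x (n + 1) =
      x n + (1 / ((n : ℝ) + 1)) • (l • x n + (m (n + 1) + h n - h (n + 1))))
    (hmx : ∀ n, ⟪m (n + 1), x n⟫_ℂ = 0) (hmh : ∀ n, ⟪m (n + 1), h n⟫_ℂ = 0)
    (hh : ∀ n, ‖h n‖ ≤ K) (hm : Tendsto (fun n => ‖m n‖ ^ 2) atTop (𝓝 σ)) :
    ConvergesAtRate (fun n => ‖x n‖ ^ 2) (2 * (-l.re)) := by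
  have hK : 0 ≤ K := (norm_nonneg _).trans (hh 0)
  set y : ℕ → H := fun n => x n + (1 / (n : ℝ)) • h n
  set g : ℕ → H := fun n => (-(((n : ℝ) + 1) / n)) • (h n + l • h n)
  have hG : ∀ n, 1 ≤ n → ‖g n‖ ≤ 2 * ((1 + ‖l‖) * K) := by
    intro n hn
    have hn' : (1 : ℝ) ≤ n := by exact_mod_cast hn
    simp only [g, norm_smul, norm_neg]
    have h1 : ‖((n : ℝ) + 1) / n‖ ≤ 2 := by
      rw [Real.norm_of_nonneg (by positivity), div_le_iff₀ (by positivity)]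
      linarith
    have h2 : ‖h n + l • h n‖ ≤ (1 + ‖l‖) * K := by
      refine (norm_add_le _ _).trans ?_
      rw [norm_smul]
      have := hh n
      nlinarith [mul_le_mul_of_nonneg_left this (norm_nonneg l)]
    exact mul_le_mul h1 h2 (norm_nonneg _) (by norm_num)
  have hstep : ∀ n : ℕ, 1 ≤ n → ‖y (n + 1)‖ ^ 2 =
      ‖(1 + ((1 / ((n : ℝ) + 1) : ℝ) : ℂ) * l) • y n
        + (((1 / ((n : ℝ) + 1)) ^ 2 : ℝ) : ℂ) • g n‖ ^ 2
      + (1 / ((n : ℝ) + 1)) ^ 2 * ‖m (n + 1)‖ ^ 2 := by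
    intro n hn
    have hn' : (0 : ℝ) < n := by exact_mod_cast hn
    have hz : y (n + 1) = (1 + ((1 / ((n : ℝ) + 1) : ℝ) : ℂ) * l) • y n
        + (1 / ((n : ℝ) + 1)) • m (n + 1) + (((1 / ((n : ℝ) + 1)) ^ 2 : ℝ) : ℂ) • g n := by
      have := recursion_corrected (l • (LinearMap.id : H →ₗ[ℝ] H)) hn' (hrec n)
      simp only [y, g, Nat.cast_add, Nat.cast_one]
      rw [this]
      simp only [LinearMap.smul_apply, LinearMap.id_apply]
      rw [add_smul (1 : ℂ), one_smul, mul_smul, Complex.coe_smul, Complex.coe_smul]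
    have o1 : ⟪m (n + 1), y n⟫_ℂ = 0 := by
      simp only [y]
      rw [inner_add_right, hmx, inner_smul_right_eq_smul, hmh]
      simp
    have o2 : ⟪m (n + 1), g n⟫_ℂ = 0 := by
      simp only [g]
      rw [inner_smul_right_eq_smul, inner_add_right, inner_smul_right, hmh]
      simp
    rw [hz, norm_sq_add_of_orthogonal o1 o2]
  obtain ⟨⟨D, hD0, hD⟩, c, hc0, hc⟩ :=
    norm_sq_recursion_bounds hl hσ (by positivity) hG hm hstep
  refine convergesAtRate_norm_sq_of_close (y := y) (by linarith) hK (fun n hn => ?_) hc0 hD0 hD hc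
  have hn' : (0 : ℝ) < n := by exact_mod_cast hn
  simp only [y, sub_add_cancel_left, norm_neg, norm_smul]
  rw [Real.rpow_neg_one, Real.norm_of_nonneg (by positivity), one_div, mul_comm]
  exact mul_le_mul_of_nonneg_right (hh n) (by positivity)

end Scalar

end LinearSA

namespace LinearSA

/-! ### Matrix recursions and the Lyapunov equation -/

/-- The part of `W` proportional to `N (E n)` is harmless, as the factor `(n + 1)⁻²` makes it a
second-order change of the contraction. The lemma is used twice: with `b = 1/2`, `r = 0` for an a
priori bound, then with `b = 2 a`, `r = 1/4`. -/
lemma IsAdaptedNorm.exists_le_rpow {d : ℕ} {A : Matrix (Fin d) (Fin d) ℝ} {a : ℝ}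
    {N : Matrix (Fin d) (Fin d) ℝ → ℝ} (hN : IsAdaptedNorm A a N) {b C : ℝ} {r : ℝ}
    (hb : b ≤ 2 * a) (hr : b + 1 < 2 + r) (hC : 0 ≤ C) {E W : ℕ → Matrix (Fin d) (Fin d) ℝ}
    (hE : ∀ᶠ n : ℕ in atTop, E (n + 1) =
      (1 + (1 / ((n : ℝ) + 1)) • A) * E n * (1 + (1 / ((n : ℝ) + 1)) • A)ᵀ
        + (1 / ((n : ℝ) + 1)) ^ 2 • W n)
    (hW : ∀ᶠ n : ℕ in atTop, ∀ i j, |W n i j| ≤ C * N (E n) + C * ((n : ℝ) + 1) ^ (-r)) :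
    ∃ D : ℝ, 0 ≤ D ∧ ∀ᶠ n : ℕ in atTop, N (E n) ≤ D * (n : ℝ) ^ (-b) := by
  obtain ⟨D, hD0, hD⟩ := hN.le_of_abs_le
  refine exists_le_rpow_of_recursion (u := fun n => N (E n)) (b := 2 + r)
    (C := a ^ 2 + D * C) (fun n => hN.nonneg _) hr (by positivity) ?_
  filter_upwards [hE, hW, hN.contract] with n h1 h2 h3
  have e1 : ((n : ℝ) + 1) ^ (-(2 + r)) = (1 / ((n : ℝ) + 1)) ^ 2 * ((n : ℝ) + 1) ^ (-r) := by
    rw [neg_add, Real.rpow_add (by positivity), Real.rpow_neg (by positivity)]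
    norm_cast
    simp
  have e2 : (1 - b / ((n : ℝ) + 1) + (a ^ 2 + D * C) / ((n : ℝ) + 1) ^ 2)
      = 1 - b * (1 / ((n : ℝ) + 1)) + (a ^ 2 + D * C) * (1 / ((n : ℝ) + 1)) ^ 2 := by
    field_simp
  have e3 : 1 - a / ((n : ℝ) + 1) = 1 - a * (1 / ((n : ℝ) + 1)) := by field_simp
  have ht : 0 ≤ 1 / ((n : ℝ) + 1) := by positivity
  have hp : 0 ≤ ((n : ℝ) + 1) ^ (-r) := by positivity
  have h4 := h3 (E n)
  rw [h1, e1, e2]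
  rw [e3] at h4
  have hu := hN.nonneg (E n)
  generalize ((n : ℝ) + 1) ^ (-r) = z at *
  generalize 1 / ((n : ℝ) + 1) = t at *
  have h5 := hD (W n) (C * N (E n) + C * z) (by positivity) h2
  have h6 := hN.smul_le (t ^ 2) (by positivity) (W n)
  have h7 := hN.add_le ((1 + t • A) * E n * (1 + t • A)ᵀ) (t ^ 2 • W n)
  have h8 : t ^ 2 * N (W n) ≤ t ^ 2 * (D * (C * N (E n) + C * z)) := by gcongr
  have h9 : 0 ≤ (2 * a - b) * (t * N (E n)) :=
    mul_nonneg (by linarith) (mul_nonneg ht hu)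
  have h10 : 0 ≤ a ^ 2 * (t ^ 2 * z) := by positivity
  linarith

/-- The error made by replacing the solution of the covariance recursion by `S / n`. -/
lemma lyapunov_step {d : ℕ} {A Q S : Matrix (Fin d) (Fin d) ℝ} (hS : SolvesLyapunov A Q S)
    {t : ℝ} (ht : 0 < t) (K K' R : Matrix (Fin d) (Fin d) ℝ)
    (hK : K' = (1 + (1 / (t + 1)) • A) * K * (1 + (1 / (t + 1)) • A)ᵀ
      + (1 / (t + 1)) ^ 2 • (Q + R)) :
    K' - (t + 1)⁻¹ • S =
      (1 + (1 / (t + 1)) • A) * (K - t⁻¹ • S) * (1 + (1 / (t + 1)) • A)ᵀ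
      + (1 / (t + 1)) ^ 2 • (R + t⁻¹ • (A * S * Aᵀ - Q)) := by
  have ht1 : t + 1 ≠ 0 := by positivity
  -- The two halves of the identity in the Lyapunov equation add up to `S`, which accounts for the
  -- decrease `S / t - S / (t + 1) = S / (t (t + 1))`. The terms of leading order then cancel.
  have hQ : Q = -(S + A * S + S * Aᵀ) := by
    have h := hS
    rw [SolvesLyapunov] at h
    rw [eq_neg_iff_add_eq_zero, ← h]
    simp only [transpose_add, transpose_smul, transpose_one, add_mul, mul_add, smul_mul_assoc,
      mul_smul_comm, one_mul, mul_one]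
    module
  subst hK
  rw [hQ]
  simp only [transpose_add, transpose_smul, transpose_one, add_mul, mul_add, smul_mul_assoc,
      mul_smul_comm, one_mul, mul_one, mul_sub, sub_mul]
  match_scalars <;> field_simp <;> ring

lemma rpow_neg_le_two_mul {n : ℕ} (hn : 1 ≤ n) {r : ℝ} (hr : 0 ≤ r) (hr1 : r ≤ 1) :
    (n : ℝ) ^ (-r) ≤ 2 * ((n : ℝ) + 1) ^ (-r) := by
  have hn' : (1 : ℝ) ≤ n := by exact_mod_cast hn
  have h1 : ((n : ℝ) + 1) ^ r ≤ 2 * (n : ℝ) ^ r := by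
    calc ((n : ℝ) + 1) ^ r ≤ (2 * (n : ℝ)) ^ r := by
          apply Real.rpow_le_rpow <;> linarith
      _ = 2 ^ r * (n : ℝ) ^ r := Real.mul_rpow (by norm_num) (by linarith)
      _ ≤ 2 * (n : ℝ) ^ r := by
          gcongr
          calc (2 : ℝ) ^ r ≤ 2 ^ (1 : ℝ) := Real.rpow_le_rpow_of_exponent_le (by norm_num) hr1
            _ = 2 := Real.rpow_one 2
  rw [Real.rpow_neg (by positivity), Real.rpow_neg (by positivity), inv_eq_one_div,
    ← div_eq_mul_inv, div_le_div_iff₀ (by positivity) (by positivity)]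
  linarith

lemma eventually_inv_le_rpow {r : ℝ} (hr : 0 ≤ r) (hr1 : r ≤ 1) :
    ∀ᶠ n : ℕ in atTop, ((n : ℝ))⁻¹ ≤ 2 * ((n : ℝ) + 1) ^ (-r) := by
  filter_upwards [eventually_ge_atTop 1] with n hn
  refine le_trans ?_ (rpow_neg_le_two_mul hn hr hr1)
  rw [← Real.rpow_neg_one]
  exact Real.rpow_le_rpow_of_exponent_le (by exact_mod_cast hn) (by linarith)

/-- A deterministic covariance recursion whose inputs converge to `Q` is asymptotic to `S / n`. -/
lemma IsAdaptedNorm.exists_sub_le_rpow {d : ℕ} {A Q S : Matrix (Fin d) (Fin d) ℝ} {a : ℝ}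
    {N : Matrix (Fin d) (Fin d) ℝ → ℝ} (hN : IsAdaptedNorm A a N) (ha : a < 5 / 8)
    (hS : SolvesLyapunov A Q S) {K R : ℕ → Matrix (Fin d) (Fin d) ℝ} {C : ℝ} (hC : 0 ≤ C)
    (hK : ∀ n : ℕ, 1 ≤ n → K (n + 1) =
      (1 + (1 / ((n : ℝ) + 1)) • A) * K n * (1 + (1 / ((n : ℝ) + 1)) • A)ᵀ
        + (1 / ((n : ℝ) + 1)) ^ 2 • (Q + R n))
    (hR : ∀ᶠ n : ℕ in atTop, ∀ i j, |R n i j| ≤ C * ((n : ℝ) + 1) ^ (-(1 / 4 : ℝ))) :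
    ∃ D : ℝ, 0 ≤ D ∧ ∀ᶠ n : ℕ in atTop, ∀ i j,
      |K n i j - (n : ℝ)⁻¹ * S i j| ≤ D * (n : ℝ) ^ (-(2 * a)) := by
  set F := A * S * Aᵀ - Q
  obtain ⟨M, hM0, hM⟩ : ∃ M : ℝ, 0 ≤ M ∧ ∀ i j, |F i j| ≤ M :=
    ⟨∑ i, ∑ j, |F i j|, Finset.sum_nonneg fun _ _ => Finset.sum_nonneg fun _ _ => abs_nonneg _,
      fun i j => (Finset.single_le_sum (f := fun j => |F i j|) (fun _ _ => abs_nonneg _)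
        (Finset.mem_univ j)).trans (Finset.single_le_sum (f := fun i => ∑ j, |F i j|)
        (fun _ _ => Finset.sum_nonneg fun _ _ => abs_nonneg _) (Finset.mem_univ i))⟩
  -- Here `2 a + 1 < 2 + 1/4` is required, whence `a < 5/8`.
  obtain ⟨D, hD0, hD⟩ := hN.exists_le_rpow (b := 2 * a) (C := C + 2 * M) (r := 1 / 4) le_rfl
    (by linarith) (by positivity) (E := fun n => K n - (n : ℝ)⁻¹ • S)
    (W := fun n => R n + (n : ℝ)⁻¹ • F) (by
      filter_upwards [eventually_ge_atTop 1] with n hn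
      have := lyapunov_step hS (t := (n : ℝ)) (by exact_mod_cast hn) (K n) _ (R n) (hK n hn)
      push_cast
      exact this) (by
      filter_upwards [hR, eventually_inv_le_rpow (r := 1 / 4) (by norm_num) (by norm_num)]
        with n h1 h2 i j
      have h3 := hN.nonneg (K n - (n : ℝ)⁻¹ • S)
      have h4 : |(R n + (n : ℝ)⁻¹ • F) i j| ≤ |R n i j| + (n : ℝ)⁻¹ * |F i j| := by
        rw [Matrix.add_apply, Matrix.smul_apply, smul_eq_mul]
        refine (abs_add_le _ _).trans ?_
        rw [abs_mul, abs_of_nonneg (by positivity : 0 ≤ (n : ℝ)⁻¹)]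
      have h5 : (n : ℝ)⁻¹ * |F i j| ≤ (2 * ((n : ℝ) + 1) ^ (-(1 / 4 : ℝ))) * M :=
        mul_le_mul h2 (hM i j) (abs_nonneg _) (by positivity)
      have h6 := h1 i j
      have h7 : 0 ≤ (C + 2 * M) * N (K n - (n : ℝ)⁻¹ • S) := by positivity
      linarith)
  refine ⟨D, hD0, ?_⟩
  filter_upwards [hD] with n hn i j
  have := (hN.abs_le _ i j).trans hn
  simpa using this

lemma tendsto_mul_rpow_neg {b D : ℝ} (hb : 1 < b) :
    Tendsto (fun n : ℕ => (n : ℝ) * (D * (n : ℝ) ^ (-b))) atTop (𝓝 0) := by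
  have h1 : Tendsto (fun n : ℕ => D * (n : ℝ) ^ (-(b - 1))) atTop (𝓝 0) := by
    have := ((tendsto_rpow_neg_atTop (sub_pos.2 hb)).comp tendsto_natCast_atTop_atTop).const_mul D
    simpa using this
  refine h1.congr' ?_
  filter_upwards [eventually_ge_atTop 1] with n hn
  have hn' : (0 : ℝ) < n := by exact_mod_cast hn
  rw [show -(b - 1) = 1 + -b by ring, Real.rpow_add hn', Real.rpow_one]
  ring

/-- The zero sequence solves the covariance recursion with `Q = 0`, so comparison with `S / n` gives
`S / n = O(n ^ (-2 a))`, where `2 a > 1`. -/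
lemma IsAdaptedNorm.lyapunov_injective {d : ℕ} {A S : Matrix (Fin d) (Fin d) ℝ} {a : ℝ}
    {N : Matrix (Fin d) (Fin d) ℝ → ℝ} (hN : IsAdaptedNorm A a N) (ha : a < 5 / 8)
    (ha1 : 1 / 2 < a) (hS : SolvesLyapunov A 0 S) : S = 0 := by
  obtain ⟨D, -, hD⟩ := hN.exists_sub_le_rpow ha hS (K := fun _ => 0) (R := fun _ => 0)
    (C := 0) le_rfl (fun n _ => by simp) (Eventually.of_forall fun n i j => by simp)
  ext i j
  have h1 : Tendsto (fun _ : ℕ => |S i j|) atTop (𝓝 0) := by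
    refine tendsto_of_tendsto_of_tendsto_of_le_of_le' tendsto_const_nhds
      (tendsto_mul_rpow_neg (b := 2 * a) (D := D) (by linarith))
      (Eventually.of_forall fun _ => abs_nonneg _) ?_
    filter_upwards [hD, eventually_ge_atTop 1] with n hn hn1
    have hn' : (0 : ℝ) < n := by exact_mod_cast hn1
    have h2 := hn i j
    rw [Matrix.zero_apply, zero_sub, abs_neg, abs_mul, abs_of_pos (inv_pos.2 hn'),
      inv_mul_le_iff₀ hn'] at h2
    exact h2
  have h2 := tendsto_nhds_unique h1 tendsto_const_nhds
  simpa using h2.symm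

/-- The Lyapunov operator is an injective endomorphism of a finite-dimensional space, hence
surjective. -/
lemma IsAdaptedNorm.existsUnique_lyapunov {d : ℕ} {A : Matrix (Fin d) (Fin d) ℝ} {a : ℝ}
    {N : Matrix (Fin d) (Fin d) ℝ → ℝ} (hN : IsAdaptedNorm A a N) (ha : a < 5 / 8)
    (ha1 : 1 / 2 < a) (Q : Matrix (Fin d) (Fin d) ℝ) : ∃! S, SolvesLyapunov A Q S := by
  set B := (1 / 2 : ℝ) • (1 : Matrix (Fin d) (Fin d) ℝ) + A
  set L : Matrix (Fin d) (Fin d) ℝ →ₗ[ℝ] Matrix (Fin d) (Fin d) ℝ :=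
    LinearMap.mulLeft ℝ B + LinearMap.mulRight ℝ Bᵀ
  have hL : ∀ Q S, SolvesLyapunov A Q S ↔ L S = -Q := fun Q S => by
    rw [eq_neg_iff_add_eq_zero]
    rfl
  have hinj : Function.Injective L := by
    rw [← LinearMap.ker_eq_bot, LinearMap.ker_eq_bot']
    intro S hS
    exact hN.lyapunov_injective ha ha1 ((hL 0 S).2 (by rw [hS, neg_zero]))
  obtain ⟨S, hS⟩ := LinearMap.injective_iff_surjective.1 hinj (-Q)
  exact ⟨S, (hL _ _).2 hS, fun S' hS' => hinj (by rw [hS, (hL _ _).1 hS'])⟩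

open scoped InnerProductSpace

/-! ### Gram matrices and the covariance recursion in a Hilbert space -/

section Gram

variable {H : Type*} [NormedAddCommGroup H] [InnerProductSpace ℝ H] {d : ℕ}

/-- The matrix of the inner products of the entries of two vectors. -/
noncomputable def crossGram (u v : Fin d → H) : Matrix (Fin d) (Fin d) ℝ :=
  Matrix.of fun i j => ⟪u i, v j⟫_ℝ

/-- The action of a real matrix on vectors with entries in `H`. -/
noncomputable def matrixAct (B : Matrix (Fin d) (Fin d) ℝ) : (Fin d → H) →ₗ[ℝ] (Fin d → H) where
  toFun u i := ∑ j, B i j • u j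
  map_add' u v := by
    ext i
    simp [Finset.sum_add_distrib]
  map_smul' c u := by
    ext i
    simp [Finset.smul_sum, smul_comm c]

lemma matrixAct_apply (B : Matrix (Fin d) (Fin d) ℝ) (u : Fin d → H) (i : Fin d) :
    matrixAct B u i = ∑ j, B i j • u j := rfl

lemma matrixAct_one_add_smul (A : Matrix (Fin d) (Fin d) ℝ) (t : ℝ) (u : Fin d → H) :
    matrixAct (1 + t • A) u = u + t • matrixAct A u := by
  ext i
  simp [matrixAct_apply, add_smul, Finset.sum_add_distrib, Matrix.one_apply, Finset.smul_sum,
    mul_smul, ite_smul]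

lemma crossGram_transpose (u v : Fin d → H) : (crossGram u v)ᵀ = crossGram v u := by
  ext i j
  simp [crossGram, real_inner_comm]

lemma crossGram_add_left (u u' v : Fin d → H) :
    crossGram (u + u') v = crossGram u v + crossGram u' v := by
  ext i j
  simp [crossGram, inner_add_left]

lemma crossGram_smul_left (c : ℝ) (u v : Fin d → H) :
    crossGram (c • u) v = c • crossGram u v := by
  ext i j
  simp [crossGram, real_inner_smul_left]

lemma crossGram_matrixAct_left (B : Matrix (Fin d) (Fin d) ℝ) (u v : Fin d → H) :
    crossGram (matrixAct B u) v = B * crossGram u v := by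
  ext i j
  simp [crossGram, matrixAct_apply, Matrix.mul_apply, sum_inner, real_inner_smul_left]

lemma crossGram_add_right (u v v' : Fin d → H) :
    crossGram u (v + v') = crossGram u v + crossGram u v' := by
  ext i j
  simp [crossGram, inner_add_right]

lemma crossGram_smul_right (c : ℝ) (u v : Fin d → H) :
    crossGram u (c • v) = c • crossGram u v := by
  ext i j
  simp [crossGram, real_inner_smul_right]

lemma crossGram_matrixAct_right (B : Matrix (Fin d) (Fin d) ℝ) (u v : Fin d → H) :
    crossGram u (matrixAct B v) = crossGram u v * Bᵀ := by
  rw [← crossGram_transpose, crossGram_matrixAct_left, transpose_mul, crossGram_transpose]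

lemma abs_mul_apply_le {B X : Matrix (Fin d) (Fin d) ℝ} {b x : ℝ} (hb0 : 0 ≤ b)
    (hb : ∀ i j, |B i j| ≤ b) (hx : ∀ i j, |X i j| ≤ x) (i j : Fin d) :
    |(B * X) i j| ≤ d * (b * x) := by
  rw [Matrix.mul_apply]
  refine (Finset.abs_sum_le_sum_abs _ _).trans ?_
  calc ∑ k, |B i k * X k j| ≤ ∑ _k : Fin d, b * x := by
        refine Finset.sum_le_sum fun k _ => ?_
        rw [abs_mul]
        exact mul_le_mul (hb i k) (hx k j) (abs_nonneg _) hb0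
    _ = _ := by simp

lemma exists_abs_apply_le (A : Matrix (Fin d) (Fin d) ℝ) :
    ∃ M : ℝ, 0 ≤ M ∧ ∀ i j, |A i j| ≤ M :=
  ⟨∑ i, ∑ j, |A i j|, Finset.sum_nonneg fun _ _ => Finset.sum_nonneg fun _ _ => abs_nonneg _,
    fun i j => (Finset.single_le_sum (f := fun j => |A i j|) (fun _ _ => abs_nonneg _)
      (Finset.mem_univ j)).trans (Finset.single_le_sum (f := fun i => ∑ j, |A i j|)
      (fun _ _ => Finset.sum_nonneg fun _ _ => abs_nonneg _) (Finset.mem_univ i))⟩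

/-- The covariance recursion of the corrected sequence, with bounds on the remainder. -/
lemma crossGram_recursion {A : Matrix (Fin d) (Fin d) ℝ} {x m h : ℕ → Fin d → H} {κ : ℝ}
    (hrec : ∀ n : ℕ, x (n + 1) =
      x n + (1 / ((n : ℝ) + 1)) • (matrixAct A (x n) + (m (n + 1) + h n - h (n + 1))))
    (hmx : ∀ n i j, ⟪m (n + 1) i, x n j⟫_ℝ = 0) (hmh : ∀ n i j, ⟪m (n + 1) i, h n j⟫_ℝ = 0)
    (hh : ∀ n i, ‖h n i‖ ≤ κ) (hκ : 0 ≤ κ) :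
    ∃ (R : ℕ → Matrix (Fin d) (Fin d) ℝ) (C : ℝ), 0 ≤ C ∧
      (∀ n : ℕ, 1 ≤ n →
        crossGram (x (n + 1) + (1 / ((n : ℝ) + 1)) • h (n + 1))
            (x (n + 1) + (1 / ((n : ℝ) + 1)) • h (n + 1)) =
          (1 + (1 / ((n : ℝ) + 1)) • A) *
            crossGram (x n + (1 / (n : ℝ)) • h n) (x n + (1 / (n : ℝ)) • h n)
            * (1 + (1 / ((n : ℝ) + 1)) • A)ᵀ
          + (1 / ((n : ℝ) + 1)) ^ 2 • (crossGram (m (n + 1)) (m (n + 1)) + R n)) ∧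
      ∀ n : ℕ, 1 ≤ n → ∀ s : ℝ, (∀ i, ‖x n i + (1 / (n : ℝ)) • h n i‖ ≤ s) → ∀ i j,
        |R n i j| ≤ C * (s + 1 / ((n : ℝ) + 1)) := by
  obtain ⟨α, hα0, hα⟩ := exists_abs_apply_le A
  -- This is the input left over when the coboundary is absorbed; `(n + 1) / n ≤ 2` for `n ≥ 1`
  -- explains the factor in `G`.
  set g : ℕ → Fin d → H := fun n => (-(((n : ℝ) + 1) / n)) • (h n + matrixAct A (h n))
  set y : ℕ → Fin d → H := fun n => x n + (1 / (n : ℝ)) • h n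
  set B : ℕ → Matrix (Fin d) (Fin d) ℝ := fun n => 1 + (1 / ((n : ℝ) + 1)) • A
  set G := 2 * (κ + d * (α * κ))
  have hG0 : 0 ≤ G := by positivity
  have hG : ∀ n, 1 ≤ n → ∀ i, ‖g n i‖ ≤ G := by
    intro n hn i
    have hn' : (1 : ℝ) ≤ n := by exact_mod_cast hn
    simp only [g, Pi.smul_apply, norm_smul, norm_neg, Pi.add_apply]
    have h1 : ‖((n : ℝ) + 1) / n‖ ≤ 2 := by
      rw [Real.norm_of_nonneg (by positivity), div_le_iff₀ (by positivity)]
      linarith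
    have h2 : ‖matrixAct A (h n) i‖ ≤ d * (α * κ) := by
      rw [matrixAct_apply]
      refine (norm_sum_le _ _).trans ?_
      calc ∑ j, ‖A i j • h n j‖ ≤ ∑ _j : Fin d, α * κ := by
            refine Finset.sum_le_sum fun j _ => ?_
            rw [norm_smul]
            exact mul_le_mul (hα i j) (hh n j) (norm_nonneg _) hα0
        _ = _ := by simp
    exact mul_le_mul h1 ((norm_add_le _ _).trans (add_le_add (hh n i) h2)) (norm_nonneg _)
      (by norm_num)
  have hB : ∀ n i j, |B n i j| ≤ 1 + α := by
    intro n i j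
    simp only [B, Matrix.add_apply, Matrix.smul_apply, smul_eq_mul, Matrix.one_apply]
    refine (abs_add_le _ _).trans (add_le_add ?_ ?_)
    · split_ifs <;> simp
    · rw [abs_mul, abs_of_nonneg (by positivity)]
      have h1 := mul_le_mul (one_div_succ_le_one n) (hα i j) (abs_nonneg _) zero_le_one
      linarith
  -- Orthogonality removes every product of `m` with `y` or `g`. What remains besides the main terms
  -- are the cross terms of `B y` with `t² g` and the Gram matrix of `t² g`, divided by `t²`.
  refine ⟨fun n => (B n * crossGram (y n) (g n) + (B n * crossGram (y n) (g n))ᵀ)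
    + (1 / ((n : ℝ) + 1)) ^ 2 • crossGram (g n) (g n),
    2 * (d * ((1 + α) * G)) + G ^ 2, by positivity, fun n hn => ?_, fun n hn s hs i j => ?_⟩
  · have hn' : (0 : ℝ) < n := by exact_mod_cast hn
    have hz := recursion_corrected (E := Fin d → H) (matrixAct A) (x := x n)
      (y := x (n + 1)) (m := m (n + 1)) (h := h n) (h' := h (n + 1)) hn' (hrec n)
    have o1 : crossGram (m (n + 1)) (y n) = 0 := by
      ext i j
      simp [crossGram, y, inner_add_right, real_inner_smul_right, hmx, hmh]
    have o2 : crossGram (m (n + 1)) (g n) = 0 := by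
      ext i j
      simp [crossGram, g, inner_add_right, real_inner_smul_right, hmh, matrixAct_apply, inner_sum]
    have o1' : crossGram (y n) (m (n + 1)) = 0 := by rw [← crossGram_transpose, o1]; rfl
    have o2' : crossGram (g n) (m (n + 1)) = 0 := by rw [← crossGram_transpose, o2]; rfl
    have hz' : x (n + 1) + (1 / ((n : ℝ) + 1)) • h (n + 1) = matrixAct (B n) (y n)
        + (1 / ((n : ℝ) + 1)) • m (n + 1) + (1 / ((n : ℝ) + 1)) ^ 2 • g n := by
      rw [hz, matrixAct_one_add_smul]
    rw [hz']
    change _ = B n * crossGram (y n) (y n) * (B n)ᵀ + _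
    simp only [crossGram_add_left, crossGram_add_right, crossGram_smul_left, crossGram_smul_right,
      crossGram_matrixAct_left, crossGram_matrixAct_right, o1, o2, o1', o2', transpose_mul,
      crossGram_transpose, Matrix.mul_zero, smul_zero, add_zero, zero_add,
      smul_add, smul_smul, Matrix.add_mul, Matrix.smul_mul]
    module
  · have hs0 : 0 ≤ s := (norm_nonneg _).trans (hs i)
    have h1 : ∀ i j, |crossGram (y n) (g n) i j| ≤ s * G := fun i j =>
      (abs_real_inner_le_norm _ _).trans
        (mul_le_mul (hs i) (hG n hn j) (norm_nonneg _) hs0)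
    have h2 : |crossGram (g n) (g n) i j| ≤ G * G := (abs_real_inner_le_norm _ _).trans
        (mul_le_mul (hG n hn i) (hG n hn j) (norm_nonneg _) hG0)
    have h3 := abs_mul_apply_le (by positivity : 0 ≤ 1 + α) (hB n) h1
    simp only [Matrix.add_apply, Matrix.smul_apply, Matrix.transpose_apply, smul_eq_mul]
    have ht : 0 ≤ 1 / ((n : ℝ) + 1) := by positivity
    have ht1 := one_div_succ_le_one n
    generalize 1 / ((n : ℝ) + 1) = t at *
    have h4 : |t ^ 2 * crossGram (g n) (g n) i j| ≤ t * (G * G) := by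
      rw [abs_mul, abs_of_nonneg (by positivity : 0 ≤ t ^ 2)]
      exact mul_le_mul (by nlinarith) h2 (abs_nonneg _) ht
    have h5 := (abs_add_le ((B n * crossGram (y n) (g n)) i j + (B n * crossGram (y n) (g n)) j i)
      (t ^ 2 * crossGram (g n) (g n) i j)).trans
      (add_le_add ((abs_add_le _ _).trans (add_le_add (h3 i j) (h3 j i))) h4)
    refine h5.trans ?_
    have h6 : 0 ≤ G ^ 2 * s := by positivity
    have h7 : 0 ≤ 2 * (d * ((1 + α) * G)) * t := by positivity
    nlinarith

end Gram

end LinearSA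

namespace LinearSA

open scoped InnerProductSpace

/-! ### Two-pass asymptotics of the Gram matrices -/

section GramAsymptotics

variable {H : Type*} [NormedAddCommGroup H] [InnerProductSpace ℝ H] {d : ℕ}

lemma norm_le_sqrt_of_crossGram_le {y : Fin d → H} {i : Fin d} {c : ℝ}
    (h : |crossGram y y i i| ≤ c) : ‖y i‖ ≤ Real.sqrt c := by
  refine Real.le_sqrt_of_sq_le ?_
  rw [← real_inner_self_eq_norm_sq]
  exact (le_abs_self _).trans h

lemma abs_inner_sub_inner_sub_smul_le {u v p q : H} {t s κ : ℝ} (ht : 0 ≤ t)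
    (hu : ‖u + t • p‖ ≤ s) (hv : ‖v + t • q‖ ≤ s) (hp : ‖p‖ ≤ κ) (hq : ‖q‖ ≤ κ) :
    |⟪u, v⟫_ℝ - ⟪u + t • p, v + t • q⟫_ℝ| ≤ t * (2 * s * κ) + t ^ 2 * κ ^ 2 := by
  have hs : 0 ≤ s := (norm_nonneg _).trans hu
  have hκ : 0 ≤ κ := (norm_nonneg _).trans hp
  have e : ⟪u, v⟫_ℝ - ⟪u + t • p, v + t • q⟫_ℝ
      = -(t * ⟪p, v + t • q⟫_ℝ) - t * ⟪u + t • p, q⟫_ℝ + t ^ 2 * ⟪p, q⟫_ℝ := by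
    simp only [inner_add_left, inner_add_right, real_inner_smul_left, real_inner_smul_right]
    ring
  have h1 : |⟪p, v + t • q⟫_ℝ| ≤ κ * s :=
    (abs_real_inner_le_norm _ _).trans (mul_le_mul hp hv (norm_nonneg _) hκ)
  have h2 : |⟪u + t • p, q⟫_ℝ| ≤ s * κ :=
    (abs_real_inner_le_norm _ _).trans (mul_le_mul hu hq (norm_nonneg _) hs)
  have h3 : |⟪p, q⟫_ℝ| ≤ κ * κ :=
    (abs_real_inner_le_norm _ _).trans (mul_le_mul hp hq (norm_nonneg _) hκ)
  rw [e]
  have h1' := mul_le_mul_of_nonneg_left h1 ht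
  have h2' := mul_le_mul_of_nonneg_left h2 ht
  have h3' := mul_le_mul_of_nonneg_left h3 (sq_nonneg t)
  calc _ ≤ |(-(t * ⟪p, v + t • q⟫_ℝ))| + |t * ⟪u + t • p, q⟫_ℝ| + |t ^ 2 * ⟪p, q⟫_ℝ| :=
        (abs_add_le _ _).trans (add_le_add (abs_sub _ _) le_rfl)
    _ ≤ _ := by
      rw [abs_neg, abs_mul, abs_mul, abs_mul, abs_of_nonneg ht, abs_of_nonneg (sq_nonneg t)]
      linarith

/-- The remainder is controlled only through the size of `y`, so some decay of `y` must come first.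
The inequality `√u ≤ u + 1` makes the bound on the remainder linear in the covariance, and even the
modest rate `n ^ (-1/2)` for covariances then yields `n ^ (-1/4)` for norms. -/
lemma crossGram_first_bound {A : Matrix (Fin d) (Fin d) ℝ} {a : ℝ}
    {N : Matrix (Fin d) (Fin d) ℝ → ℝ} (hN : IsAdaptedNorm A a N) (ha1 : 1 / 2 < a)
    {y m : ℕ → Fin d → H} {R : ℕ → Matrix (Fin d) (Fin d) ℝ} {C M : ℝ} (hC : 0 ≤ C) (hM : 0 ≤ M)
    (hK : ∀ n : ℕ, 1 ≤ n → crossGram (y (n + 1)) (y (n + 1)) =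
      (1 + (1 / ((n : ℝ) + 1)) • A) * crossGram (y n) (y n) * (1 + (1 / ((n : ℝ) + 1)) • A)ᵀ
      + (1 / ((n : ℝ) + 1)) ^ 2 • (crossGram (m (n + 1)) (m (n + 1)) + R n))
    (hR : ∀ n : ℕ, 1 ≤ n → ∀ s : ℝ, (∀ i, ‖y n i‖ ≤ s) → ∀ i j,
      |R n i j| ≤ C * (s + 1 / ((n : ℝ) + 1)))
    (hm : ∀ n i j, |crossGram (m (n + 1)) (m (n + 1)) i j| ≤ M) :
    ∃ D : ℝ, 0 ≤ D ∧ ∀ᶠ n : ℕ in atTop, ∀ i,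
      ‖y n i‖ ≤ D * ((n : ℝ) + 1) ^ (-(1 / 4 : ℝ)) := by
  obtain ⟨D, hD0, hD⟩ := hN.exists_le_rpow (b := 1 / 2) (C := M + 2 * C) (r := 0) (by linarith)
    (by norm_num) (by positivity) (E := fun n => crossGram (y n) (y n))
    (W := fun n => crossGram (m (n + 1)) (m (n + 1)) + R n)
    (by filter_upwards [eventually_ge_atTop 1] with n hn using hK n hn) (by
      filter_upwards [eventually_ge_atTop 1] with n hn i j
      have h1 := hR n hn _ (fun i => norm_le_sqrt_of_crossGram_le (hN.abs_le _ i i)) i j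
      have h2 : Real.sqrt (N (crossGram (y n) (y n))) ≤ N (crossGram (y n) (y n)) + 1 := by
        have h3 := hN.nonneg (crossGram (y n) (y n))
        rw [Real.sqrt_le_left (by linarith)]
        nlinarith
      have h4 := one_div_succ_le_one n
      have h5 : C * (Real.sqrt (N (crossGram (y n) (y n))) + 1 / ((n : ℝ) + 1)) ≤
          C * (N (crossGram (y n) (y n)) + 1 + 1) := by gcongr
      have h6 := hm n i j
      have h7 := abs_add_le (crossGram (m (n + 1)) (m (n + 1)) i j) (R n i j)
      rw [neg_zero, Real.rpow_zero, Matrix.add_apply]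
      have h8 := hN.nonneg (crossGram (y n) (y n))
      nlinarith [mul_nonneg hM h8, mul_nonneg hC h8])
  refine ⟨2 * Real.sqrt D, by positivity, ?_⟩
  filter_upwards [hD, eventually_ge_atTop 1] with n hn hn1 i
  have h1 := norm_le_sqrt_of_crossGram_le ((hN.abs_le _ i i).trans hn)
  have h2 : Real.sqrt (D * (n : ℝ) ^ (-(1 / 2 : ℝ))) = Real.sqrt D * (n : ℝ) ^ (-(1 / 4 : ℝ)) := by
    rw [Real.sqrt_mul hD0, Real.sqrt_eq_rpow ((n : ℝ) ^ _), ← Real.rpow_mul (by positivity)]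
    norm_num
  rw [h2] at h1
  have h3 := rpow_neg_le_two_mul hn1 (r := 1 / 4) (by norm_num) (by norm_num)
  calc _ ≤ _ := h1
    _ ≤ Real.sqrt D * (2 * ((n : ℝ) + 1) ^ (-(1 / 4 : ℝ))) := by gcongr
    _ = _ := by ring

/-- The covariance of a linear recursion driven by orthogonal noise and a coboundary. -/
lemma inner_asymptotics {A Q S : Matrix (Fin d) (Fin d) ℝ} {a : ℝ}
    {N : Matrix (Fin d) (Fin d) ℝ → ℝ} (hN : IsAdaptedNorm A a N) (ha1 : 1 / 2 < a)
    (ha : a < 5 / 8) (hS : SolvesLyapunov A Q S) {x m h : ℕ → Fin d → H} {κ c : ℝ}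
    (hrec : ∀ n : ℕ, x (n + 1) =
      x n + (1 / ((n : ℝ) + 1)) • (matrixAct A (x n) + (m (n + 1) + h n - h (n + 1))))
    (hmx : ∀ n i j, ⟪m (n + 1) i, x n j⟫_ℝ = 0) (hmh : ∀ n i j, ⟪m (n + 1) i, h n j⟫_ℝ = 0)
    (hκ : 0 ≤ κ) (hh : ∀ n i, ‖h n i‖ ≤ κ) (hc : 0 ≤ c)
    (hm : ∀ (n : ℕ) i j, |⟪m (n + 1) i, m (n + 1) j⟫_ℝ - Q i j| ≤
      c * ((n : ℝ) + 1) ^ (-(1 / 4 : ℝ))) :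
    ∃ D : ℝ, 0 ≤ D ∧ ∀ᶠ n : ℕ in atTop, ∀ i j,
      |⟪x n i, x n j⟫_ℝ - (n : ℝ)⁻¹ * S i j| ≤ D * (n : ℝ) ^ (-(2 * a)) := by
  obtain ⟨R, C, hC, hK, hR⟩ := crossGram_recursion hrec hmx hmh hh hκ
  obtain ⟨q, hq0, hq⟩ := exists_abs_apply_le Q
  obtain ⟨σ, hσ0, hσ⟩ := exists_abs_apply_le S
  set y : ℕ → Fin d → H := fun n => x n + (1 / (n : ℝ)) • h n
  have hK' : ∀ n : ℕ, 1 ≤ n → crossGram (y (n + 1)) (y (n + 1)) =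
      (1 + (1 / ((n : ℝ) + 1)) • A) * crossGram (y n) (y n) * (1 + (1 / ((n : ℝ) + 1)) • A)ᵀ
      + (1 / ((n : ℝ) + 1)) ^ 2 • (crossGram (m (n + 1)) (m (n + 1)) + R n) := by
    intro n hn
    have := hK n hn
    simp only [y]
    push_cast
    exact this
  have hpow1 : ∀ n : ℕ, ((n : ℝ) + 1) ^ (-(1 / 4 : ℝ)) ≤ 1 := fun n =>
    Real.rpow_le_one_of_one_le_of_nonpos (by linarith [(Nat.cast_nonneg n : (0 : ℝ) ≤ n)])
      (by norm_num)
  obtain ⟨D1, hD10, hD1⟩ := crossGram_first_bound hN ha1 hC (add_nonneg hq0 hc) hK' hR (by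
    intro n i j
    have h1 := hm n i j
    have h2 : c * ((n : ℝ) + 1) ^ (-(1 / 4 : ℝ)) ≤ c * 1 := by gcongr; exact hpow1 n
    have h3 := hq i j
    have h4 := abs_sub_abs_le_abs_sub (⟪m (n + 1) i, m (n + 1) j⟫_ℝ) (Q i j)
    simp only [crossGram, Matrix.of_apply]
    linarith)
  -- Second pass: the a priori bound turns the remainder, together with the error in the noise
  -- covariance, into an input of size `n ^ (-1/4)`.
  obtain ⟨D2, hD20, hD2⟩ := hN.exists_sub_le_rpow ha hS (K := fun n => crossGram (y n) (y n))
    (R := fun n => crossGram (m (n + 1)) (m (n + 1)) - Q + R n) (C := c + C * (D1 + 1))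
    (by positivity) (fun n hn => by
      rw [hK' n hn, ← add_assoc, add_sub_cancel]) (by
    filter_upwards [hD1, eventually_ge_atTop 1] with n h1 hn1 i j
    have h2 := hR n hn1 _ h1 i j
    have h3 : 1 / ((n : ℝ) + 1) ≤ ((n : ℝ) + 1) ^ (-(1 / 4 : ℝ)) := by
      rw [one_div, ← Real.rpow_neg_one]
      exact Real.rpow_le_rpow_of_exponent_le
        (by linarith [(Nat.cast_nonneg n : (0 : ℝ) ≤ n)]) (by norm_num)
    have h4 := hm n i j
    have h5 : C * (D1 * ((n : ℝ) + 1) ^ (-(1 / 4 : ℝ)) + 1 / ((n : ℝ) + 1)) ≤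
      C * (D1 * ((n : ℝ) + 1) ^ (-(1 / 4 : ℝ)) + ((n : ℝ) + 1) ^ (-(1 / 4 : ℝ))) := by gcongr
    have h6 := abs_add_le (crossGram (m (n + 1)) (m (n + 1)) i j - Q i j) (R n i j)
    have h7 : |crossGram (m (n + 1)) (m (n + 1)) i j - Q i j| ≤
      c * ((n : ℝ) + 1) ^ (-(1 / 4 : ℝ)) := h4
    simp only [Matrix.add_apply, Matrix.sub_apply]
    linarith)
  refine ⟨D2 + (2 * Real.sqrt (σ + D2) * κ + κ ^ 2), by positivity, ?_⟩
  filter_upwards [hD2, eventually_ge_atTop 1] with n h2 hn i j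
  have hn' : (1 : ℝ) ≤ n := by exact_mod_cast hn
  have hy : ∀ i, ‖x n i + (n : ℝ)⁻¹ • h n i‖ ≤ Real.sqrt (σ + D2) * (n : ℝ) ^ (-(1 / 2 : ℝ)) := by
    intro i
    have h3 : |crossGram (y n) (y n) i i| ≤ (σ + D2) * (n : ℝ)⁻¹ := by
      have h4 := abs_sub_abs_le_abs_sub (crossGram (y n) (y n) i i) ((n : ℝ)⁻¹ * S i i)
      have h5 := h2 i i
      have h6 : |(n : ℝ)⁻¹ * S i i| ≤ (n : ℝ)⁻¹ * σ := by
        rw [abs_mul, abs_of_nonneg (by positivity)]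
        gcongr
        exact hσ i i
      have h7 : D2 * (n : ℝ) ^ (-(2 * a)) ≤ D2 * (n : ℝ)⁻¹ := by
        rw [← Real.rpow_neg_one (n : ℝ)]
        exact mul_le_mul_of_nonneg_left (Real.rpow_le_rpow_of_exponent_le hn' (by linarith)) hD20
      linarith
    have h4 := norm_le_sqrt_of_crossGram_le h3
    rw [Real.sqrt_mul (by positivity), ← Real.rpow_neg_one (n : ℝ), Real.sqrt_eq_rpow ((n : ℝ) ^ _),
      ← Real.rpow_mul (by positivity)] at h4
    simp only [y, one_div, Pi.add_apply, Pi.smul_apply] at h4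
    rwa [show (-1 : ℝ) * 2⁻¹ = -(1 / 2) by norm_num] at h4
  -- Now `y = O(n ^ (-1/2))`, so the return from `y` to `x` costs `O(n ^ (-3/2))`, which is within
  -- `n ^ (-2 a)` since `2 a < 5/4`.
  have h3 := abs_inner_sub_inner_sub_smul_le (by positivity) (hy i) (hy j) (hh n i) (hh n j)
  have h4 : |⟪x n i + (n : ℝ)⁻¹ • h n i, x n j + (n : ℝ)⁻¹ • h n j⟫_ℝ - (n : ℝ)⁻¹ * S i j| ≤
      D2 * (n : ℝ) ^ (-(2 * a)) := by
    have := h2 i j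
    simpa [crossGram, y] using this
  have h5 : (n : ℝ)⁻¹ * (n : ℝ) ^ (-(1 / 2 : ℝ)) ≤ (n : ℝ) ^ (-(2 * a)) := by
    rw [← Real.rpow_neg_one, ← Real.rpow_add (by positivity)]
    exact Real.rpow_le_rpow_of_exponent_le hn' (by linarith)
  have h6 : ((n : ℝ)⁻¹) ^ 2 ≤ (n : ℝ) ^ (-(2 * a)) := by
    rw [← Real.rpow_neg_one, ← Real.rpow_natCast, ← Real.rpow_mul (by positivity)]
    exact Real.rpow_le_rpow_of_exponent_le hn' (by push_cast; linarith)
  have h7 := abs_add_le (⟪x n i, x n j⟫_ℝ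
      - ⟪x n i + (n : ℝ)⁻¹ • h n i, x n j + (n : ℝ)⁻¹ • h n j⟫_ℝ)
    (⟪x n i + (n : ℝ)⁻¹ • h n i, x n j + (n : ℝ)⁻¹ • h n j⟫_ℝ - (n : ℝ)⁻¹ * S i j)
  rw [sub_add_sub_cancel] at h7
  have h8 : 2 * Real.sqrt (σ + D2) * κ * ((n : ℝ)⁻¹ * (n : ℝ) ^ (-(1 / 2 : ℝ))) ≤
    2 * Real.sqrt (σ + D2) * κ * (n : ℝ) ^ (-(2 * a)) := by gcongr
  have h9 : ((n : ℝ)⁻¹) ^ 2 * κ ^ 2 ≤ (n : ℝ) ^ (-(2 * a)) * κ ^ 2 := by gcongr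
  linarith

end GramAsymptotics

end LinearSA

namespace LinearSA

/-! ### Iterates of a `V`-uniformly ergodic kernel -/

section Kernel

variable {Z : Type*} [MeasurableSpace Z]

instance isMarkovKernel_pow (P : Kernel Z Z) [IsMarkovKernel P] (n : ℕ) :
    IsMarkovKernel (P ^ n) := by
  induction n with
  | zero =>
    rw [pow_zero]
    exact inferInstanceAs (IsMarkovKernel Kernel.id)
  | succ n ih =>
    rw [Kernel.pow_add]
    rw [pow_one]
    infer_instance

lemma pow_zero_apply (P : Kernel Z Z) (z : Z) : (P ^ 0) z = Measure.dirac z := by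
  rw [pow_zero]
  exact Kernel.id_apply z

lemma integral_pow_zero (P : Kernel Z Z) {f : Z → ℝ} (hf : Measurable f) (z : Z) :
    ∫ y, f y ∂((P ^ 0) z) = f z := by
  rw [pow_zero_apply, integral_dirac' _ _ hf.stronglyMeasurable]

lemma integral_integral_pow (P : Kernel Z Z) [IsMarkovKernel P] {f : Z → ℝ} {n : ℕ} {z : Z}
    (hf : Integrable f ((P ^ (n + 1)) z)) :
    ∫ y, (∫ w, f w ∂((P ^ n) y)) ∂(P z) = ∫ w, f w ∂((P ^ (n + 1)) z) := by
  have h : P ^ (n + 1) = (P ^ n) ∘ₖ P := by rw [Kernel.pow_add, pow_one]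
  rw [h] at hf ⊢
  rw [Kernel.integral_comp hf]

lemma measurable_integral_pow (P : Kernel Z Z) {f : Z → ℝ} (hf : Measurable f) (n : ℕ) :
    Measurable fun z => ∫ y, f y ∂((P ^ n) z) :=
  (hf.stronglyMeasurable.integral_kernel (κ := P ^ n)).measurable

end Kernel

namespace VUniformlyErgodic

variable {Z : Type*} [MeasurableSpace Z] {P : Kernel Z Z} {V : Z → ℝ}
  {π : Measure Z}

lemma exists_bound (hE : VUniformlyErgodic P V π) : ∃ ρ B : ℝ, 0 < ρ ∧ ρ < 1 ∧ 0 ≤ B ∧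
    ∀ (g : Z → ℝ) (c : ℝ), Measurable g → 0 ≤ c → (∀ z, |g z| ≤ c * V z) → ∀ (z : Z) (n : ℕ),
      |(∫ y, g y ∂((P ^ n) z)) - ∫ y, g y ∂π| ≤ B * c * ρ ^ n * V z := by
  obtain ⟨ρ, B, hρ, hρ1, hB⟩ := hE.bound
  refine ⟨ρ, |B|, hρ, hρ1, abs_nonneg B, fun g c hg hc hgc z n => ?_⟩
  have hV : ∀ z, 0 < V z := fun z => one_pos.trans_le (hE.one_le_weight z)
  have h1 : ∀ z, |g z| / V z ≤ c := fun z => by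
    rw [div_le_iff₀ (hV z)]
    exact hgc z
  have h2 : vNorm V g ≤ c := by
    have : Nonempty Z := ⟨z⟩
    exact ciSup_le h1
  have h3 : 0 ≤ vNorm V g := Real.iSup_nonneg fun z => div_nonneg (abs_nonneg _) (hV z).le
  refine (hB g ⟨hg, ⟨c, by rintro _ ⟨w, rfl⟩; exact h1 w⟩⟩ z n).trans ?_
  have h4 : 0 ≤ ρ ^ n * V z := mul_nonneg (pow_nonneg hρ.le n) (hV z).le
  have h5 : B * vNorm V g ≤ |B| * c := mul_le_mul (le_abs_self B) h2 h3 (abs_nonneg B)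
  nlinarith [mul_le_mul_of_nonneg_right h5 h4]

lemma sqrt_weight_le (hE : VUniformlyErgodic P V π) (z : Z) : Real.sqrt (V z) ≤ V z := by
  have := hE.one_le_weight z
  rw [Real.sqrt_le_left (by linarith)]
  nlinarith

lemma abs_le_mul_weight (hE : VUniformlyErgodic P V π) {f : Z → ℝ} {K : ℝ} (hK : 0 ≤ K)
    (hfK : ∀ z, |f z| ≤ K * Real.sqrt (V z)) (z : Z) : |f z| ≤ K * V z :=
  (hfK z).trans (mul_le_mul_of_nonneg_left (hE.sqrt_weight_le z) hK)

lemma abs_mul_le_mul_weight (hE : VUniformlyErgodic P V π) {f g : Z → ℝ} {K : ℝ} (hK : 0 ≤ K)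
    (hfK : ∀ z, |f z| ≤ K * Real.sqrt (V z)) (hgK : ∀ z, |g z| ≤ K * Real.sqrt (V z)) (z : Z) :
    |f z * g z| ≤ K ^ 2 * V z := by
  have hV := hE.one_le_weight z
  rw [abs_mul]
  calc |f z| * |g z| ≤ (K * Real.sqrt (V z)) * (K * Real.sqrt (V z)) :=
        mul_le_mul (hfK z) (hgK z) (abs_nonneg _) (by positivity)
    _ = K ^ 2 * (Real.sqrt (V z) * Real.sqrt (V z)) := by ring
    _ = _ := by rw [Real.mul_self_sqrt (by linarith)]

lemma integrable_of_abs_le {ν : Measure Z} (hν : Integrable V ν) {g : Z → ℝ} (hg : Measurable g)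
    {c : ℝ} (hgc : ∀ z, |g z| ≤ c * V z) : Integrable g ν :=
  (hν.const_mul c).mono' hg.aestronglyMeasurable (Eventually.of_forall hgc)

/-- The `n`-step expectations of `V` are dominated by `V`. -/
lemma exists_integral_weight_le (hE : VUniformlyErgodic P V π) : ∃ C : ℝ, 0 ≤ C ∧
    ∀ (z : Z) (n : ℕ), ∫ y, V y ∂((P ^ n) z) ≤ C * V z := by
  obtain ⟨ρ, B, hρ, hρ1, hB0, hB⟩ := hE.exists_bound
  have hπ : 0 ≤ ∫ y, V y ∂π := integral_nonneg fun z => zero_le_one.trans (hE.one_le_weight z)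
  refine ⟨(∫ y, V y ∂π) + B, by positivity, fun z n => ?_⟩
  have hV := hE.one_le_weight z
  have h1 := hB V 1 hE.measurable_weight zero_le_one (fun z => by
    rw [abs_of_nonneg (zero_le_one.trans (hE.one_le_weight z)), one_mul]) z n
  have h2 := (le_abs_self _).trans h1
  have h3 : B * 1 * ρ ^ n * V z ≤ B * V z := by
    have : ρ ^ n ≤ 1 := pow_le_one₀ hρ.le hρ1.le
    have h4 : B * ρ ^ n ≤ B * 1 := mul_le_mul_of_nonneg_left this hB0
    nlinarith
  nlinarith [mul_le_mul_of_nonneg_left hV hπ]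

/-- `V`-uniform ergodicity implies geometric convergence in the weighted norm of `√V`. -/
lemma exists_abs_integral_pow_le [IsMarkovKernel P] [IsProbabilityMeasure π]
    (hE : VUniformlyErgodic P V π) {K : ℝ} (hK : 0 < K) : ∃ r D : ℝ, 0 < r ∧ r < 1 ∧ 0 ≤ D ∧
    ∀ f : Z → ℝ, Measurable f → (∀ z, |f z| ≤ K * Real.sqrt (V z)) → ∫ y, f y ∂π = 0 →
      ∀ (n : ℕ) (z : Z), |∫ y, f y ∂((P ^ n) z)| ≤ D * r ^ n * Real.sqrt (V z) := by
  obtain ⟨ρ, B, hρ, hρ1, hB0, hB⟩ := hE.exists_bound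
  refine ⟨Real.sqrt ρ, (2 + B) * K, Real.sqrt_pos.2 hρ, ?_, by positivity,
    fun f hf hfK hπ n z => ?_⟩
  · rw [Real.sqrt_lt' one_pos]
    simpa using hρ1
  have hV : ∀ z, 0 < V z := fun z => one_pos.trans_le (hE.one_le_weight z)
  -- Truncation of `f` at the level `t = K s`. The bounded part contributes at most `2 t`. The
  -- excess is at most `f² / t ≤ (K / s) V`, so (A1) bounds its error by `B (K / s) ρ ^ n V z = B K
  -- s`. The choice of `s` balances the two.
  set s := Real.sqrt ρ ^ n * Real.sqrt (V z)
  have hs : 0 < s := mul_pos (pow_pos (Real.sqrt_pos.2 hρ) n) (Real.sqrt_pos.2 (hV z))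
  have hs2 : s ^ 2 = ρ ^ n * V z := by
    simp only [s]
    rw [mul_pow, ← pow_mul, mul_comm n 2, pow_mul, Real.sq_sqrt hρ.le, Real.sq_sqrt (hV z).le]
  set t := K * s
  have ht : 0 < t := mul_pos hK hs
  have hset : MeasurableSet {y | |f y| ≤ t} :=
    measurableSet_le (continuous_abs.measurable.comp hf) measurable_const
  set f1 := {y | |f y| ≤ t}.indicator f
  set f2 := fun y => f y - f1 y
  have hf1 : Measurable f1 := hf.indicator hset
  have hf2 : Measurable f2 := hf.sub hf1
  have hf1t : ∀ y, ‖f1 y‖ ≤ t := by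
    intro y
    simp only [f1, Set.indicator]
    split_ifs with h
    · exact h
    · simpa using ht.le
  have hf2V : ∀ y, |f2 y| ≤ K / s * V y := by
    intro y
    simp only [f2, f1, Set.indicator]
    split_ifs with h
    · rw [sub_self, abs_zero]
      exact mul_nonneg (by positivity) (hV y).le
    · rw [sub_zero]
      have h1 : t < |f y| := not_le.1 h
      have h2 : |f y| ^ 2 ≤ K ^ 2 * V y := by
        have := pow_le_pow_left₀ (abs_nonneg _) (hfK y) 2
        rwa [mul_pow, Real.sq_sqrt (hV y).le] at this
      have h3 : t * |f y| ≤ K ^ 2 * V y := by nlinarith [abs_nonneg (f y)]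
      rw [div_mul_eq_mul_div, le_div_iff₀ hs]
      simp only [t] at h3
      have h4 : K * (|f y| * s) ≤ K * (K * V y) := by linarith
      exact le_of_mul_le_mul_left h4 hK
  have hfint : ∀ ν : Measure Z, Integrable V ν → Integrable f ν := fun ν hν =>
    integrable_of_abs_le hν hf (hE.abs_le_mul_weight hK.le hfK)
  have hf1int : ∀ ν : Measure Z, IsProbabilityMeasure ν → Integrable f1 ν := fun ν _ =>
    Integrable.of_bound hf1.aestronglyMeasurable t (Eventually.of_forall hf1t)
  have hsplit : ∀ ν : Measure Z, IsProbabilityMeasure ν → Integrable V ν →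
      ∫ y, f y ∂ν = ∫ y, f1 y ∂ν + ∫ y, f2 y ∂ν := by
    intro ν hν hνV
    simp only [f2]
    rw [integral_sub (hfint ν hνV) (hf1int ν hν)]
    ring
  have hb1 : ∀ ν : Measure Z, IsProbabilityMeasure ν → |∫ y, f1 y ∂ν| ≤ t := by
    intro ν hν
    have := norm_integral_le_of_norm_le_const (μ := ν) (Eventually.of_forall hf1t)
    simpa using this
  have h1 := hsplit _ inferInstance (hE.integrable_weight_pow n z)
  have h2 := hsplit π inferInstance hE.integrable_weight
  have h3 := hB f2 (K / s) hf2 (by positivity) hf2V z n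
  have h4 := hb1 _ (inferInstance : IsProbabilityMeasure ((P ^ n) z))
  have h5 := hb1 π inferInstance
  have h6 : B * (K / s) * ρ ^ n * V z = B * K * s := by
    rw [mul_assoc _ (ρ ^ n), ← hs2]
    field_simp
  rw [h6] at h3
  have h7 : (2 + B) * K * Real.sqrt ρ ^ n * Real.sqrt (V z) = 2 * t + B * K * s := by
    simp only [t, s]
    ring
  rw [hπ] at h2
  rw [h7, h1]
  rw [abs_le] at h3 h4 h5 ⊢
  constructor <;> linarith

end VUniformlyErgodic

/-! ### Poisson's equation -/

/-- The correction term `∑_{n ≥ 1} Pⁿ f` of the solution `∑_{n ≥ 0} Pⁿ f` of Poisson's equation. -/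
noncomputable def poissonTail {Z : Type*} [MeasurableSpace Z] (P : Kernel Z Z) (f : Z → ℝ)
    (z : Z) : ℝ :=
  ∑' n : ℕ, ∫ y, f y ∂((P ^ (n + 1)) z)

section Poisson

variable {Z : Type*} [MeasurableSpace Z] {P : Kernel Z Z} {V : Z → ℝ} {f : Z → ℝ} {r D : ℝ}

lemma summable_integral_pow (hr : 0 < r) (hr1 : r < 1)
    (h : ∀ (n : ℕ) (z : Z), |∫ y, f y ∂((P ^ n) z)| ≤ D * r ^ n * Real.sqrt (V z)) (z : Z) :
    Summable fun n : ℕ => ∫ y, f y ∂((P ^ n) z) := by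
  refine Summable.of_norm_bounded (g := fun n => D * r ^ n * Real.sqrt (V z)) ?_ fun n => h n z
  exact ((summable_geometric_of_lt_one hr.le hr1).mul_left D).mul_right _

lemma measurable_poissonTail (hf : Measurable f) (hr : 0 < r) (hr1 : r < 1)
    (h : ∀ (n : ℕ) (z : Z), |∫ y, f y ∂((P ^ n) z)| ≤ D * r ^ n * Real.sqrt (V z)) :
    Measurable (poissonTail P f) := by
  refine measurable_of_tendsto_metrizable
    (f := fun N z => ∑ n ∈ Finset.range N, ∫ y, f y ∂((P ^ (n + 1)) z)) (fun N => ?_) ?_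
  · exact Finset.measurable_fun_sum _ fun n _ => measurable_integral_pow P hf (n + 1)
  · rw [tendsto_pi_nhds]
    intro z
    exact ((summable_nat_add_iff 1).2 (summable_integral_pow hr hr1 h z)).hasSum.tendsto_sum_nat

lemma abs_poissonTail_le (hD : 0 ≤ D) (hr : 0 < r) (hr1 : r < 1)
    (h : ∀ (n : ℕ) (z : Z), |∫ y, f y ∂((P ^ n) z)| ≤ D * r ^ n * Real.sqrt (V z)) (z : Z) :
    |poissonTail P f z| ≤ D * (1 - r)⁻¹ * Real.sqrt (V z) := by
  have hs : HasSum (fun n : ℕ => D * r ^ n * Real.sqrt (V z))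
      (D * (1 - r)⁻¹ * Real.sqrt (V z)) :=
    ((hasSum_geometric_of_lt_one hr.le hr1).mul_left D).mul_right _
  refine tsum_of_norm_bounded (f := fun n : ℕ => ∫ y, f y ∂((P ^ (n + 1)) z)) hs fun n =>
    (h (n + 1) z).trans ?_
  gcongr D * ?_ * _
  exact pow_le_pow_of_le_one hr.le hr1.le (Nat.le_succ n)

/-- Poisson's equation. -/
lemma integral_add_poissonTail [IsMarkovKernel P] {π : Measure Z} (hE : VUniformlyErgodic P V π)
    (hf : Measurable f) {K : ℝ} (hK : 0 ≤ K) (hfK : ∀ z, |f z| ≤ K * Real.sqrt (V z))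
    (hD : 0 ≤ D) (hr : 0 < r) (hr1 : r < 1)
    (h : ∀ (n : ℕ) (z : Z), |∫ y, f y ∂((P ^ n) z)| ≤ D * r ^ n * Real.sqrt (V z)) (z : Z) :
    ∫ y, (f y + poissonTail P f y) ∂(P z) = poissonTail P f z := by
  have hPV : Integrable V (P z) := by
    have := hE.integrable_weight_pow 1 z
    rwa [pow_one] at this
  have hfint : ∀ n, Integrable f ((P ^ n) z) := fun n =>
    VUniformlyErgodic.integrable_of_abs_le (hE.integrable_weight_pow n z) hf
      (hE.abs_le_mul_weight hK hfK)
  have hq : ∀ n y, |∫ w, f w ∂((P ^ n) y)| ≤ D * r ^ n * V y := fun n y =>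
    hE.abs_le_mul_weight (f := fun y => ∫ w, f w ∂((P ^ n) y)) (by positivity) (h n) y
  have hqint : ∀ n, Integrable (fun y => ∫ w, f w ∂((P ^ n) y)) (P z) := fun n =>
    VUniformlyErgodic.integrable_of_abs_le hPV (measurable_integral_pow P hf n) (hq n)
  have hqsum : Summable fun n : ℕ => ∫ y, ‖∫ w, f w ∂((P ^ (n + 1)) y)‖ ∂(P z) := by
    refine Summable.of_nonneg_of_le (fun n => integral_nonneg fun y => norm_nonneg _)
      (fun n => ?_) (((summable_nat_add_iff 1).2 (summable_geometric_of_lt_one hr.le hr1)).mul_left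
        (D * ∫ y, V y ∂(P z)))
    calc ∫ y, ‖∫ w, f w ∂((P ^ (n + 1)) y)‖ ∂(P z) ≤ ∫ y, D * r ^ (n + 1) * V y ∂(P z) :=
          integral_mono (hqint (n + 1)).norm (hPV.const_mul _) (hq (n + 1))
      _ = _ := by
          rw [integral_const_mul]
          ring
  -- Integration against `P z` raises each power of `P` by one, so the sum starts at `P² f`; the
  -- integral of `f` itself restores the term `P f`.
  have h1 : ∫ y, poissonTail P f y ∂(P z) = ∑' n : ℕ, ∫ y, f y ∂((P ^ (n + 1 + 1)) z) := by
    simp only [poissonTail]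
    rw [← integral_tsum_of_summable_integral_norm (fun n => hqint (n + 1)) hqsum]
    exact tsum_congr fun n => integral_integral_pow P (hfint _)
  have h2 : Integrable (poissonTail P f) (P z) :=
    VUniformlyErgodic.integrable_of_abs_le hPV (measurable_poissonTail hf hr hr1 h)
      (hE.abs_le_mul_weight (mul_nonneg hD (inv_nonneg.2 (by linarith)))
        (abs_poissonTail_le hD hr hr1 h))
  have h3 : Integrable f (P z) := by simpa using hfint 1
  rw [integral_add h3 h2, h1, poissonTail,
    ((summable_nat_add_iff 1).2 (summable_integral_pow hr hr1 h z)).tsum_eq_zero_add]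
  simp

/-- The sum of the autocovariances of `f` at positive lags against `g`. -/
lemma hasSum_integral_mul {π : Measure Z} (hE : VUniformlyErgodic P V π) {g : Z → ℝ}
    (hf : Measurable f) (hg : Measurable g) {K : ℝ}
    (hgK : ∀ z, |g z| ≤ K * Real.sqrt (V z)) (hD : 0 ≤ D) (hr : 0 < r) (hr1 : r < 1)
    (h : ∀ (n : ℕ) (z : Z), |∫ y, f y ∂((P ^ n) z)| ≤ D * r ^ n * Real.sqrt (V z)) :
    HasSum (fun n : ℕ => ∫ z, (∫ y, f y ∂((P ^ (n + 1)) z)) * g z ∂π)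
      (∫ z, poissonTail P f z * g z ∂π) := by
  have hV : ∀ z, 0 ≤ V z := fun z => zero_le_one.trans (hE.one_le_weight z)
  have hb : ∀ (n : ℕ) (z : Z), |(∫ y, f y ∂((P ^ n) z)) * g z| ≤ D * r ^ n * K * V z := by
    intro n z
    rw [abs_mul]
    calc _ ≤ (D * r ^ n * Real.sqrt (V z)) * (K * Real.sqrt (V z)) :=
          mul_le_mul (h n z) (hgK z) (abs_nonneg _) (by positivity)
      _ = D * r ^ n * K * (Real.sqrt (V z) * Real.sqrt (V z)) := by ring
      _ = _ := by rw [Real.mul_self_sqrt (hV z)]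
  have hint : ∀ n : ℕ, Integrable (fun z => (∫ y, f y ∂((P ^ n) z)) * g z) π := fun n =>
    VUniformlyErgodic.integrable_of_abs_le hE.integrable_weight
      ((measurable_integral_pow P hf n).mul hg) (hb n)
  have hsum : Summable fun n : ℕ => ∫ z, ‖(∫ y, f y ∂((P ^ (n + 1)) z)) * g z‖ ∂π := by
    refine Summable.of_nonneg_of_le (fun n => integral_nonneg fun y => norm_nonneg _)
      (fun n => ?_) (((summable_nat_add_iff 1).2 (summable_geometric_of_lt_one hr.le hr1)).mul_left
        (D * K * ∫ y, V y ∂π))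
    calc _ ≤ ∫ z, D * r ^ (n + 1) * K * V z ∂π :=
          integral_mono (hint (n + 1)).norm (hE.integrable_weight.const_mul _) (hb (n + 1))
      _ = _ := by
          rw [integral_const_mul]
          ring
  have := hasSum_integral_of_summable_integral_norm (fun n => hint (n + 1)) hsum
  convert! this using 3 with z
  simp only [poissonTail]
  rw [tsum_mul_right]

end Poisson

end LinearSA

namespace LinearSA

/-! ### The martingale decomposition of the noise -/

/-- `h` is the correction term of a solution `f + h` of Poisson's equation for the function `f`,
and both are dominated by `√V`. -/
structure IsPoissonCorrection {Z : Type*} [MeasurableSpace Z] {d : ℕ} (P : Kernel Z Z) (V : Z → ℝ)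
    (f h : Z → Fin d → ℝ) (K : ℝ) : Prop where
  nonneg : 0 ≤ K
  measurable_left : ∀ i, Measurable fun z => f z i
  measurable_right : ∀ i, Measurable fun z => h z i
  abs_left_le : ∀ i z, |f z i| ≤ K * Real.sqrt (V z)
  abs_right_le : ∀ i z, |h z i| ≤ K * Real.sqrt (V z)
  integral_add : ∀ i z, ∫ y, (f y i + h y i) ∂(P z) = h z i

lemma exists_abs_le_sqrt_weight {Z : Type*} [MeasurableSpace Z] {V : Z → ℝ} (hV : ∀ z, 1 ≤ V z)
    {d : ℕ} {f : Z → Fin d → ℝ} (hf : ∀ i, MemLV V fun z => f z i ^ 2) :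
    ∃ K : ℝ, 0 < K ∧ ∀ i z, |f z i| ≤ K * Real.sqrt (V z) := by
  choose c hc using fun i => (hf i).2
  have hc0 : 0 ≤ ∑ i, |c i| := Finset.sum_nonneg fun _ _ => abs_nonneg _
  refine ⟨1 + ∑ i, |c i|, by positivity, fun i z => ?_⟩
  have hVz : 0 < V z := one_pos.trans_le (hV z)
  have h1 : |f z i ^ 2| / V z ≤ c i := hc i ⟨z, rfl⟩
  rw [div_le_iff₀ hVz, abs_of_nonneg (sq_nonneg _)] at h1
  have h2 : c i ≤ ∑ i, |c i| := (le_abs_self _).trans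
    (Finset.single_le_sum (f := fun i => |c i|) (fun _ _ => abs_nonneg _) (Finset.mem_univ i))
  apply abs_le_of_sq_le_sq _ (by positivity)
  rw [mul_pow, Real.sq_sqrt hVz.le]
  refine h1.trans (mul_le_mul_of_nonneg_right ?_ hVz.le)
  nlinarith

/-- Positive lags sum to `π(h_i f_j)` and negative lags to `π(h_j f_i)`. With lag zero, `f_i f_j +
h_i f_j + h_j f_i = (f_i + h_i)(f_j + h_j) - h_i h_j`, the form in which `Σ_Δ` arises as the
limiting covariance of the martingale increments. -/
lemma exists_isPoissonCorrection {Z : Type*} [MeasurableSpace Z] {P : Kernel Z Z}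
    [IsMarkovKernel P] {V : Z → ℝ} {π : Measure Z} [IsProbabilityMeasure π]
    (hE : VUniformlyErgodic P V π) {d : ℕ} {f : Z → Fin d → ℝ}
    (hf : ∀ i, Measurable fun z => f z i) (hfV : ∀ i, MemLV V fun z => f z i ^ 2)
    (hπ : ∀ i, ∫ z, f z i ∂π = 0) :
    ∃ (h : Z → Fin d → ℝ) (K : ℝ), IsPoissonCorrection P V f h K ∧
      (∀ i j, Summable fun k : ℤ => autocov P π f k i j) ∧
      ∀ i j, asymptoticCov P π f i j =
        (∫ z, (f z i + h z i) * (f z j + h z j) ∂π) - ∫ z, h z i * h z j ∂π := by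
  obtain ⟨K, hK, hfK⟩ := exists_abs_le_sqrt_weight hE.one_le_weight hfV
  obtain ⟨r, D, hr, hr1, hD, hrD⟩ := hE.exists_abs_integral_pow_le hK
  have hdec := fun i => hrD (fun z => f z i) (hf i) (hfK i) (hπ i)
  set h : Z → Fin d → ℝ := fun z i => poissonTail P (fun y => f y i) z
  set K' := max K (D * (1 - r)⁻¹)
  have hK' : 0 ≤ K' := hK.le.trans (le_max_left _ _)
  have hh : ∀ i, Measurable fun z => h z i := fun i => measurable_poissonTail (hf i) hr hr1 (hdec i)
  have hfK' : ∀ i z, |f z i| ≤ K' * Real.sqrt (V z) := fun i z => (hfK i z).trans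
    (mul_le_mul_of_nonneg_right (le_max_left _ _) (Real.sqrt_nonneg _))
  have hhK' : ∀ i z, |h z i| ≤ K' * Real.sqrt (V z) := fun i z =>
    (abs_poissonTail_le hD hr hr1 (hdec i) z).trans
    (mul_le_mul_of_nonneg_right (le_max_right _ _) (Real.sqrt_nonneg _))
  have hsum : ∀ i j, HasSum (fun n : ℕ => autocovNat P π f (n + 1) i j)
      (∫ z, h z i * f z j ∂π) := fun i j =>
    hasSum_integral_mul hE (hf i) (hf j) (hfK j) hD hr hr1 (hdec i)
  have h0 : ∀ i j, autocovNat P π f 0 i j = ∫ z, f z i * f z j ∂π := by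
    intro i j
    simp only [autocovNat, Matrix.of_apply]
    refine integral_congr_ae (Eventually.of_forall fun z => ?_)
    simp only [integral_pow_zero P (hf i) z]
  have hall : ∀ i j, HasSum (fun k : ℤ => autocov P π f k i j)
      ((∫ z, f z i * f z j ∂π) + (∫ z, h z i * f z j ∂π) + ∫ z, h z j * f z i ∂π) := by
    intro i j
    have h1 : HasSum (fun n : ℕ => autocovNat P π f n i j)
        ((∫ z, f z i * f z j ∂π) + ∫ z, h z i * f z j ∂π) := by
      rw [← h0, ← hasSum_nat_add_iff' 1]
      simpa using hsum i j
    convert! h1.int_rec (hsum j i) using 1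
    ext k
    cases k <;> rfl
  refine ⟨h, K', ⟨hK', hf, hh, hfK', hhK', fun i z => integral_add_poissonTail hE (hf i) hK.le
    (hfK i) hD hr hr1 (hdec i) z⟩, fun i j => (hall i j).summable, fun i j => ?_⟩
  have hi : ∀ {u v : Z → ℝ}, Measurable u → Measurable v →
      (∀ z, |u z| ≤ K' * Real.sqrt (V z)) → (∀ z, |v z| ≤ K' * Real.sqrt (V z)) →
      Integrable (fun z => u z * v z) π := fun hu hv hu' hv' =>
    VUniformlyErgodic.integrable_of_abs_le hE.integrable_weight (hu.mul hv)
      (hE.abs_mul_le_mul_weight hK' hu' hv')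
  have i1 := hi (hf i) (hf j) (hfK' i) (hfK' j)
  have i2 := hi (hh i) (hf j) (hhK' i) (hfK' j)
  have i3 := hi (hh j) (hf i) (hhK' j) (hfK' i)
  have i4 := hi (hh i) (hh j) (hhK' i) (hhK' j)
  have e : (fun z => (f z i + h z i) * (f z j + h z j)) = fun z =>
      (f z i * f z j + h z i * f z j + h z j * f z i) + h z i * h z j := by
    ext z; ring
  simp only [asymptoticCov, Matrix.of_apply]
  have e1 := integral_add ((i1.add i2).add i3) i4
  have e2 := integral_add (i1.add i2) i3
  have e3 := integral_add i1 i2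
  simp only [Pi.add_apply] at e1 e2 e3
  rw [(hall i j).tsum_eq, e, e1, e2, e3]
  ring

lemma integral_bind_kernel {Z : Type*} [MeasurableSpace Z] {P : Kernel Z Z} [IsMarkovKernel P]
    {ν : Measure Z} [SFinite ν] {g : Z → ℝ} (hg : Integrable g (ν.bind P)) :
    ∫ z, g z ∂(ν.bind P) = ∫ z, (∫ y, g y ∂(P z)) ∂ν := by
  rw [Measure.comp_eq_comp_const_apply] at hg ⊢
  rw [Kernel.integral_comp hg, Kernel.const_apply]

section MarkovChain

variable {Z Ω : Type*} [MeasurableSpace Z] {mΩ : MeasurableSpace Ω} {P : Kernel Z Z}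
  {ℱ : Filtration ℕ mΩ} {Φ : ℕ → Ω → Z} {μ : Measure Ω}

namespace IsMarkovChain

lemma measurable (hM : IsMarkovChain P ℱ Φ μ) (n : ℕ) : Measurable (Φ n) :=
  (hM.adapted n).mono (ℱ.le n) le_rfl

variable [IsMarkovKernel P] [IsProbabilityMeasure μ]

/-- Restriction of `μ` to an event of `ℱ n` turns the Markov property for indicators into an
identity of measures, so it extends at once to integrable functions. The event `univ` gives the
marginal laws, general events give conditional expectations. -/
lemma map_restrict_succ (hM : IsMarkovChain P ℱ Φ μ) {n : ℕ} {s : Set Ω}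
    (hs : MeasurableSet[ℱ n] s) :
    (μ.restrict s).map (Φ (n + 1)) = ((μ.restrict s).map (Φ n)).bind P := by
  have hs' := ℱ.le n s hs
  ext B hB
  have hpre : MeasurableSet (Φ (n + 1) ⁻¹' B) := hM.measurable (n + 1) hB
  have h1 : ∫ ω in s, (Φ (n + 1) ⁻¹' B).indicator (fun _ => (1 : ℝ)) ω ∂μ =
      ∫ ω in s, (P (Φ n ω)).real B ∂μ := by
    rw [← setIntegral_condExp (ℱ.le n) ((integrable_const 1).indicator hpre) hs]
    exact setIntegral_congr_ae hs' ((hM.markov n B hB).mono fun ω h _ => h)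
  rw [integral_indicator_const _ hpre, smul_eq_mul, mul_one] at h1
  have hmeas : Measurable fun ω => P (Φ n ω) B := (P.measurable_coe hB).comp (hM.measurable n)
  have h2 : ∫ ω in s, (P (Φ n ω)).real B ∂μ = (∫⁻ ω in s, P (Φ n ω) B ∂μ).toReal := by
    simp only [Measure.real]
    exact integral_toReal hmeas.aemeasurable (Eventually.of_forall fun ω => measure_lt_top _ _)
  have h3 : ∫⁻ ω in s, P (Φ n ω) B ∂μ ≠ ⊤ := by
    refine ne_top_of_le_ne_top (measure_ne_top (μ.restrict s) Set.univ) ?_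
    refine (lintegral_mono fun ω => (prob_le_one : P (Φ n ω) B ≤ 1)).trans ?_
    simp
  rw [Measure.map_apply (hM.measurable _) hB, Measure.bind_apply hB P.aemeasurable,
    lintegral_map (P.measurable_coe hB) (hM.measurable n)]
  rw [h2, Measure.real] at h1
  exact (ENNReal.toReal_eq_toReal_iff' (measure_ne_top _ _) h3).1 h1

/-- The law of the chain at time `n`. -/
lemma map_eq (hM : IsMarkovChain P ℱ Φ μ) {z₀ : Z} (h0 : ∀ᵐ ω ∂μ, Φ 0 ω = z₀) (n : ℕ) :
    μ.map (Φ n) = (P ^ n) z₀ := by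
  induction n with
  | zero =>
    rw [pow_zero_apply, Measure.map_congr (g := fun _ => z₀) h0, Measure.map_const, measure_univ,
      one_smul]
  | succ n ih =>
    have h := hM.map_restrict_succ (n := n) (s := Set.univ) MeasurableSet.univ
    rw [Measure.restrict_univ, ih] at h
    rw [h, add_comm, Kernel.pow_add, pow_one, Kernel.comp_apply]

lemma integral_comp_eq (hM : IsMarkovChain P ℱ Φ μ) {z₀ : Z} (h0 : ∀ᵐ ω ∂μ, Φ 0 ω = z₀) (n : ℕ)
    {g : Z → ℝ} (hg : Measurable g) : ∫ ω, g (Φ n ω) ∂μ = ∫ y, g y ∂((P ^ n) z₀) := by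
  rw [← hM.map_eq h0 n, integral_map (hM.measurable n).aemeasurable hg.aestronglyMeasurable]

lemma integrable_comp (hM : IsMarkovChain P ℱ Φ μ) {z₀ : Z} (h0 : ∀ᵐ ω ∂μ, Φ 0 ω = z₀) (n : ℕ)
    {g : Z → ℝ} (hg : Integrable g ((P ^ n) z₀)) : Integrable (fun ω => g (Φ n ω)) μ := by
  rw [← hM.map_eq h0 n] at hg
  exact hg.comp_measurable (hM.measurable n)

lemma condExp_comp (hM : IsMarkovChain P ℱ Φ μ) {n : ℕ} {g : Z → ℝ} (hg : Measurable g)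
    (hint : Integrable (fun ω => g (Φ (n + 1) ω)) μ)
    (hint' : Integrable (fun ω => ∫ y, g y ∂(P (Φ n ω))) μ) :
    μ[fun ω => g (Φ (n + 1) ω) | ℱ n] =ᵐ[μ] fun ω => ∫ y, g y ∂(P (Φ n ω)) := by
  have hPg : Measurable fun z => ∫ y, g y ∂(P z) := hg.stronglyMeasurable.integral_kernel.measurable
  symm
  refine ae_eq_condExp_of_forall_setIntegral_eq (ℱ.le n) hint (fun s _ _ => hint'.integrableOn)
    (fun s hs _ => ?_) (hPg.comp (hM.adapted n)).stronglyMeasurable.aestronglyMeasurable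
  have h1 := hM.map_restrict_succ hs
  have h2 : Integrable g (((μ.restrict s).map (Φ n)).bind P) := by
    rw [← h1, integrable_map_measure hg.aestronglyMeasurable (hM.measurable _).aemeasurable]
    exact hint.integrableOn
  have h3 : ∫ ω in s, g (Φ (n + 1) ω) ∂μ = ∫ y, g y ∂(((μ.restrict s).map (Φ n)).bind P) := by
    rw [← h1, integral_map (hM.measurable _).aemeasurable hg.aestronglyMeasurable]
  rw [h3, integral_bind_kernel h2,
    integral_map (hM.measurable n).aemeasurable hPg.aestronglyMeasurable]

lemma memLp_comp (hM : IsMarkovChain P ℱ Φ μ) {z₀ : Z} (h0 : ∀ᵐ ω ∂μ, Φ 0 ω = z₀)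
    {V : Z → ℝ} {π : Measure Z} (hE : VUniformlyErgodic P V π) (n : ℕ) {g : Z → ℝ}
    (hg : Measurable g) {K : ℝ} (hK : 0 ≤ K) (hgK : ∀ z, |g z| ≤ K * Real.sqrt (V z)) :
    MemLp (fun ω => g (Φ n ω)) 2 μ := by
  refine (memLp_two_iff_integrable_sq (f := fun ω => g (Φ n ω))
    (hg.comp (hM.measurable n)).aestronglyMeasurable).2 ?_
  refine hM.integrable_comp h0 n (g := fun z => g z ^ 2) ?_
  refine VUniformlyErgodic.integrable_of_abs_le (hE.integrable_weight_pow n z₀) (hg.pow_const 2)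
    (c := K ^ 2) fun z => ?_
  rw [pow_two]
  exact hE.abs_mul_le_mul_weight hK hgK hgK z

variable {V : Z → ℝ} {π : Measure Z} {d : ℕ} {f h : Z → Fin d → ℝ} {K : ℝ}

lemma memLp_left (hM : IsMarkovChain P ℱ Φ μ) {z₀ : Z} (h0 : ∀ᵐ ω ∂μ, Φ 0 ω = z₀)
    (hE : VUniformlyErgodic P V π) (hP : IsPoissonCorrection P V f h K) (n : ℕ) (i : Fin d) :
    MemLp (fun ω => f (Φ n ω) i) 2 μ :=
  hM.memLp_comp h0 hE n (hP.measurable_left i) hP.nonneg (hP.abs_left_le i)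

lemma memLp_right (hM : IsMarkovChain P ℱ Φ μ) {z₀ : Z} (h0 : ∀ᵐ ω ∂μ, Φ 0 ω = z₀)
    (hE : VUniformlyErgodic P V π) (hP : IsPoissonCorrection P V f h K) (n : ℕ) (i : Fin d) :
    MemLp (fun ω => h (Φ n ω) i) 2 μ :=
  hM.memLp_comp h0 hE n (hP.measurable_right i) hP.nonneg (hP.abs_right_le i)

/-- The increments of the martingale part of the noise are orthogonal to the past. -/
lemma integral_mul_martingale_eq_zero (hM : IsMarkovChain P ℱ Φ μ) {z₀ : Z}
    (h0 : ∀ᵐ ω ∂μ, Φ 0 ω = z₀) (hE : VUniformlyErgodic P V π)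
    (hP : IsPoissonCorrection P V f h K) (n : ℕ) (i : Fin d) {Y : Ω → ℝ}
    (hY : StronglyMeasurable[ℱ n] Y) (hY2 : MemLp Y 2 μ) :
    ∫ ω, (f (Φ (n + 1) ω) i + h (Φ (n + 1) ω) i - h (Φ n ω) i) * Y ω ∂μ = 0 := by
  have hf1 := hM.memLp_left h0 hE hP (n + 1) i
  have hh1 := hM.memLp_right h0 hE hP (n + 1) i
  have hh0 := hM.memLp_right h0 hE hP n i
  have hg2 : MemLp (fun ω => f (Φ (n + 1) ω) i + h (Φ (n + 1) ω) i) 2 μ := hf1.add hh1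
  have hgY : Integrable (fun ω => (f (Φ (n + 1) ω) i + h (Φ (n + 1) ω) i) * Y ω) μ :=
    hg2.integrable_mul hY2
  have hhY : Integrable (fun ω => h (Φ n ω) i * Y ω) μ := hh0.integrable_mul hY2
  have hint := hg2.integrable one_le_two
  have hce := hM.condExp_comp (n := n) (g := fun z => f z i + h z i)
    ((hP.measurable_left i).add (hP.measurable_right i)) hint (by
      simp only [hP.integral_add]
      exact hh0.integrable one_le_two)
  simp only [hP.integral_add] at hce
  have hpull := condExp_mul_of_stronglyMeasurable_right (m := ℱ n) (μ := μ)
    (f := fun ω => f (Φ (n + 1) ω) i + h (Φ (n + 1) ω) i) hY hgY hint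
  have e1 : ∫ ω, (f (Φ (n + 1) ω) i + h (Φ (n + 1) ω) i) * Y ω ∂μ
      = ∫ ω, h (Φ n ω) i * Y ω ∂μ := by
    rw [← integral_condExp (ℱ.le n)]
    refine integral_congr_ae ?_
    filter_upwards [hpull, hce] with ω h1 h2
    exact h1.trans (by simp only [Pi.mul_apply, h2])
  simp only [sub_mul]
  rw [integral_sub hgY hhY, e1, sub_self]

/-- The increment is orthogonal to `h (Φ n)`, so expanding `(m + h (Φ n))_i (m + h (Φ n))_j` leaves
no cross terms, and the covariance depends on the marginal laws only. -/
lemma integral_martingale_mul_martingale (hM : IsMarkovChain P ℱ Φ μ) {z₀ : Z}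
    (h0 : ∀ᵐ ω ∂μ, Φ 0 ω = z₀) (hE : VUniformlyErgodic P V π)
    (hP : IsPoissonCorrection P V f h K) (n : ℕ) (i j : Fin d) :
    ∫ ω, (f (Φ (n + 1) ω) i + h (Φ (n + 1) ω) i - h (Φ n ω) i)
        * (f (Φ (n + 1) ω) j + h (Φ (n + 1) ω) j - h (Φ n ω) j) ∂μ =
      (∫ y, (f y i + h y i) * (f y j + h y j) ∂((P ^ (n + 1)) z₀))
        - ∫ y, h y i * h y j ∂((P ^ n) z₀) := by
  have hmf := hP.measurable_left
  have hmh := hP.measurable_right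
  have hstr : ∀ i, StronglyMeasurable[ℱ n] fun ω => h (Φ n ω) i := fun i =>
    ((hmh i).comp (hM.adapted n)).stronglyMeasurable
  have hf1 := fun i => hM.memLp_left h0 hE hP (n + 1) i
  have hh1 := fun i => hM.memLp_right h0 hE hP (n + 1) i
  have hh0 := fun i => hM.memLp_right h0 hE hP n i
  have hg : ∀ i, MemLp (fun ω => f (Φ (n + 1) ω) i + h (Φ (n + 1) ω) i) 2 μ :=
    fun i => (hf1 i).add (hh1 i)
  have hm : ∀ i, MemLp (fun ω => f (Φ (n + 1) ω) i + h (Φ (n + 1) ω) i - h (Φ n ω) i) 2 μ :=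
    fun i => (hg i).sub (hh0 i)
  have o1 := hM.integral_mul_martingale_eq_zero h0 hE hP n i (hstr j) (hh0 j)
  have o2 := hM.integral_mul_martingale_eq_zero h0 hE hP n j (hstr i) (hh0 i)
  rw [← hM.integral_comp_eq h0 (n + 1) (g := fun y => (f y i + h y i) * (f y j + h y j))
      (((hmf i).add (hmh i)).mul ((hmf j).add (hmh j))),
    ← hM.integral_comp_eq h0 n (g := fun y => h y i * h y j) ((hmh i).mul (hmh j))]
  have i1 := (hg i).integrable_mul (hg j)
  have i2 := (hm i).integrable_mul (hh0 j)
  have i3 := (hm j).integrable_mul (hh0 i)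
  have i4 := (hh0 i).integrable_mul (hh0 j)
  have e : (fun ω => (f (Φ (n + 1) ω) i + h (Φ (n + 1) ω) i - h (Φ n ω) i)
        * (f (Φ (n + 1) ω) j + h (Φ (n + 1) ω) j - h (Φ n ω) j)) = fun ω =>
      (f (Φ (n + 1) ω) i + h (Φ (n + 1) ω) i) * (f (Φ (n + 1) ω) j + h (Φ (n + 1) ω) j)
      - (f (Φ (n + 1) ω) i + h (Φ (n + 1) ω) i - h (Φ n ω) i) * h (Φ n ω) j
      - (f (Φ (n + 1) ω) j + h (Φ (n + 1) ω) j - h (Φ n ω) j) * h (Φ n ω) i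
      - h (Φ n ω) i * h (Φ n ω) j := by
    ext ω; ring
  have e1 := integral_sub ((i1.sub i2).sub i3) i4
  have e2 := integral_sub (i1.sub i2) i3
  have e3 := integral_sub i1 i2
  simp only [Pi.sub_apply, Pi.mul_apply] at e1 e2 e3
  rw [e, e1, e2, e3, o1, o2]
  ring

/-- The second moments of the martingale increments converge geometrically. -/
lemma exists_martingale_covariance_bound (hM : IsMarkovChain P ℱ Φ μ) {z₀ : Z}
    (h0 : ∀ᵐ ω ∂μ, Φ 0 ω = z₀) (hE : VUniformlyErgodic P V π)
    (hP : IsPoissonCorrection P V f h K) : ∃ ρ C : ℝ, 0 < ρ ∧ ρ < 1 ∧ 0 ≤ C ∧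
    ∀ (n : ℕ) (i j : Fin d),
      |(∫ ω, (f (Φ (n + 1) ω) i + h (Φ (n + 1) ω) i - h (Φ n ω) i)
          * (f (Φ (n + 1) ω) j + h (Φ (n + 1) ω) j - h (Φ n ω) j) ∂μ)
        - ((∫ y, (f y i + h y i) * (f y j + h y j) ∂π) - ∫ y, h y i * h y j ∂π)| ≤ C * ρ ^ n := by
  obtain ⟨ρ, B, hρ, hρ1, hB0, hB⟩ := hE.exists_bound
  have hK := hP.nonneg
  have hV : 0 ≤ V z₀ := zero_le_one.trans (hE.one_le_weight z₀)
  refine ⟨ρ, B * (2 * K) ^ 2 * V z₀ + B * K ^ 2 * V z₀, hρ, hρ1, by positivity, fun n i j => ?_⟩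
  have hmf := hP.measurable_left
  have hmh := hP.measurable_right
  have hg : ∀ i z, |f z i + h z i| ≤ 2 * K * Real.sqrt (V z) := fun i z =>
    (abs_add_le _ _).trans (by linarith [hP.abs_left_le i z, hP.abs_right_le i z])
  have h1 := hB (fun y => (f y i + h y i) * (f y j + h y j)) ((2 * K) ^ 2)
    (((hmf i).add (hmh i)).mul ((hmf j).add (hmh j))) (by positivity)
    (hE.abs_mul_le_mul_weight (by positivity) (hg i) (hg j)) z₀ (n + 1)
  have h2 := hB (fun y => h y i * h y j) (K ^ 2) ((hmh i).mul (hmh j)) (by positivity)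
    (hE.abs_mul_le_mul_weight hK (hP.abs_right_le i) (hP.abs_right_le j)) z₀ n
  rw [hM.integral_martingale_mul_martingale h0 hE hP]
  have h3 : B * (2 * K) ^ 2 * ρ ^ (n + 1) * V z₀ ≤ B * (2 * K) ^ 2 * ρ ^ n * V z₀ := by
    gcongr B * (2 * K) ^ 2 * ?_ * V z₀
    exact pow_le_pow_of_le_one hρ.le hρ1.le (Nat.le_succ n)
  rw [abs_le] at h1 h2 ⊢
  constructor <;> linarith

/-- `h² ≤ K² V`, and the expectations of `V` along the chain are bounded. This is the uniform `L²`
bound on the correction. -/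
lemma exists_integral_sq_right_le (hM : IsMarkovChain P ℱ Φ μ) {z₀ : Z}
    (h0 : ∀ᵐ ω ∂μ, Φ 0 ω = z₀) (hE : VUniformlyErgodic P V π)
    (hP : IsPoissonCorrection P V f h K) :
    ∃ C : ℝ, 0 ≤ C ∧ ∀ (n : ℕ) (i : Fin d), ∫ ω, h (Φ n ω) i ^ 2 ∂μ ≤ C := by
  obtain ⟨C, hC, hCV⟩ := hE.exists_integral_weight_le
  have hV : 0 ≤ V z₀ := zero_le_one.trans (hE.one_le_weight z₀)
  refine ⟨K ^ 2 * (C * V z₀), by positivity, fun n i => ?_⟩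
  have hb : ∀ z, |h z i ^ 2| ≤ K ^ 2 * V z := fun z => by
    rw [pow_two (h z i)]
    exact hE.abs_mul_le_mul_weight hP.nonneg (hP.abs_right_le i) (hP.abs_right_le i) z
  have hm := (hP.measurable_right i).pow_const 2
  rw [hM.integral_comp_eq h0 n (g := fun z => h z i ^ 2) hm]
  calc ∫ y, h y i ^ 2 ∂((P ^ n) z₀) ≤ ∫ y, K ^ 2 * V y ∂((P ^ n) z₀) :=
        integral_mono
          (VUniformlyErgodic.integrable_of_abs_le (hE.integrable_weight_pow n z₀) hm hb)
          ((hE.integrable_weight_pow n z₀).const_mul _) fun y => (le_abs_self _).trans (hb y)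
    _ = K ^ 2 * ∫ y, V y ∂((P ^ n) z₀) := integral_const_mul _ _
    _ ≤ _ := mul_le_mul_of_nonneg_left (hCV z₀ n) (by positivity)

end IsMarkovChain

end MarkovChain

end LinearSA

namespace LinearSA

open scoped InnerProductSpace ComplexConjugate ComplexOrder

/-! ### Square integrable recursions -/

section SquareIntegrable

variable {Ω : Type*} {mΩ : MeasurableSpace Ω} {μ : Measure Ω} {d : ℕ}

lemma inner_toLp_real {u v : Ω → ℝ} (hu : MemLp u 2 μ) (hv : MemLp v 2 μ) :
    ⟪hu.toLp u, hv.toLp v⟫_ℝ = ∫ ω, u ω * v ω ∂μ := by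
  rw [L2.inner_def]
  refine integral_congr_ae ?_
  filter_upwards [hu.coeFn_toLp, hv.coeFn_toLp] with ω h1 h2
  rw [h1, h2, RCLike.inner_apply, conj_trivial, mul_comm]

lemma inner_toLp_complex {u v : Ω → ℂ} (hu : MemLp u 2 μ) (hv : MemLp v 2 μ) :
    ⟪hu.toLp u, hv.toLp v⟫_ℂ = ∫ ω, conj (u ω) * v ω ∂μ := by
  rw [L2.inner_def]
  refine integral_congr_ae ?_
  filter_upwards [hu.coeFn_toLp, hv.coeFn_toLp] with ω h1 h2
  rw [h1, h2, RCLike.inner_apply, mul_comm]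

lemma norm_sq_toLp_complex {u : Ω → ℂ} (hu : MemLp u 2 μ) :
    ‖hu.toLp u‖ ^ 2 = ∫ ω, ‖u ω‖ ^ 2 ∂μ := by
  have h1 : ((‖hu.toLp u‖ ^ 2 : ℝ) : ℂ) = ((∫ ω, ‖u ω‖ ^ 2 ∂μ : ℝ) : ℂ) := by
    rw [Complex.ofReal_pow]
    refine (inner_self_eq_norm_sq_to_K (𝕜 := ℂ) (hu.toLp u)).symm.trans ?_
    rw [inner_toLp_complex hu hu, ← integral_complex_ofReal]
    refine integral_congr_ae (Eventually.of_forall fun ω => ?_)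
    simp only
    rw [mul_comm, Complex.mul_conj, Complex.normSq_eq_norm_sq]
  exact_mod_cast h1

lemma norm_toLp_real_le {u : Ω → ℝ} (hu : MemLp u 2 μ) {K : ℝ} (h : ∫ ω, u ω ^ 2 ∂μ ≤ K) :
    ‖hu.toLp u‖ ≤ Real.sqrt K := by
  refine Real.le_sqrt_of_sq_le ?_
  rw [← real_inner_self_eq_norm_sq, inner_toLp_real]
  simpa only [pow_two] using h

lemma memLp_dotProduct {x : Ω → Fin d → ℝ} (hx : ∀ i, MemLp (fun ω => x ω i) 2 μ)
    (v : Fin d → ℂ) : MemLp (fun ω => v ⬝ᵥ fun i => (x ω i : ℂ)) 2 μ :=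
  memLp_finsetSum _ fun i _ => ((hx i).ofReal (K := ℂ)).const_mul (v i)

lemma integral_conj_dotProduct_mul {x y : Ω → Fin d → ℝ} (hx : ∀ i, MemLp (fun ω => x ω i) 2 μ)
    (hy : ∀ i, MemLp (fun ω => y ω i) 2 μ) (v : Fin d → ℂ) :
    ∫ ω, conj (v ⬝ᵥ fun i => (x ω i : ℂ)) * (v ⬝ᵥ fun i => (y ω i : ℂ)) ∂μ =
      ∑ i, ∑ j, conj (v i) * v j * ((∫ ω, x ω i * y ω j ∂μ : ℝ) : ℂ) := by
  have hint : ∀ i j, Integrable (fun ω => conj (v i) * v j * ((x ω i * y ω j : ℝ) : ℂ)) μ :=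
    fun i j => (((hx i).integrable_mul (hy j)).ofReal (𝕜 := ℂ)).const_mul _
  have e : ∀ ω, conj (v ⬝ᵥ fun i => (x ω i : ℂ)) * (v ⬝ᵥ fun i => (y ω i : ℂ)) =
      ∑ i, ∑ j, conj (v i) * v j * ((x ω i * y ω j : ℝ) : ℂ) := by
    intro ω
    simp only [dotProduct, map_sum, map_mul, Complex.conj_ofReal, Finset.sum_mul_sum]
    refine Finset.sum_congr rfl fun i _ => Finset.sum_congr rfl fun j _ => ?_
    push_cast
    ring
  simp only [e]
  rw [integral_finsetSum _ fun i _ => integrable_finsetSum _ fun j _ => hint i j]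
  refine Finset.sum_congr rfl fun i _ => ?_
  rw [integral_finsetSum _ fun j _ => hint i j]
  refine Finset.sum_congr rfl fun j _ => ?_
  rw [integral_const_mul, integral_complex_ofReal]

lemma star_dotProduct_mulVec_eq (Q : Matrix (Fin d) (Fin d) ℝ) (v : Fin d → ℂ) :
    star v ⬝ᵥ (toComplex Q *ᵥ v) = ∑ i, ∑ j, conj (v i) * v j * (Q i j : ℂ) := by
  simp only [dotProduct, mulVec, toComplex, Matrix.map_apply, Finset.mul_sum, Pi.star_apply]
  refine Finset.sum_congr rfl fun i _ => Finset.sum_congr rfl fun j _ => ?_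
  rw [RCLike.star_def]
  ring

lemma tendsto_integral_norm_sq_dotProduct {m : ℕ → Ω → Fin d → ℝ}
    (hm : ∀ n i, MemLp (fun ω => m n ω i) 2 μ) {Q : Matrix (Fin d) (Fin d) ℝ}
    (hQ : ∀ i j, Tendsto (fun n => ∫ ω, m n ω i * m n ω j ∂μ) atTop (𝓝 (Q i j)))
    (v : Fin d → ℂ) :
    Tendsto (fun n => ((∫ ω, ‖v ⬝ᵥ fun i => (m n ω i : ℂ)‖ ^ 2 ∂μ : ℝ) : ℂ)) atTop
      (𝓝 (star v ⬝ᵥ (toComplex Q *ᵥ v))) := by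
  have e : ∀ n, ((∫ ω, ‖v ⬝ᵥ fun i => (m n ω i : ℂ)‖ ^ 2 ∂μ : ℝ) : ℂ) =
      ∑ i, ∑ j, conj (v i) * v j * ((∫ ω, m n ω i * m n ω j ∂μ : ℝ) : ℂ) := by
    intro n
    rw [← integral_conj_dotProduct_mul (hm n) (hm n), ← integral_complex_ofReal]
    refine integral_congr_ae (Eventually.of_forall fun ω => ?_)
    simp only
    rw [mul_comm, Complex.mul_conj, Complex.normSq_eq_norm_sq]
  simp only [e, star_dotProduct_mulVec_eq]
  exact tendsto_finsetSum _ fun i _ => tendsto_finsetSum _ fun j _ =>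
    ((Complex.continuous_ofReal.tendsto _).comp (hQ i j)).const_mul _

/-- Quadratic forms of second-moment matrices are integrals of squares, and the sign passes to the
limit. Complex vectors are needed because eigenvectors are complex. -/
lemma posSemidef_of_tendsto_covariance {m : ℕ → Ω → Fin d → ℝ}
    (hm : ∀ n i, MemLp (fun ω => m n ω i) 2 μ) {Q : Matrix (Fin d) (Fin d) ℝ}
    (hQ : ∀ i j, Tendsto (fun n => ∫ ω, m n ω i * m n ω j ∂μ) atTop (𝓝 (Q i j))) :
    (toComplex Q).PosSemidef := by
  rw [posSemidef_iff_dotProduct_mulVec]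
  constructor
  · ext i j
    simp only [toComplex, conjTranspose_apply, Matrix.map_apply, RCLike.star_def,
      Complex.conj_ofReal]
    congr 1
    refine tendsto_nhds_unique (hQ j i) ((hQ i j).congr fun n => ?_)
    simp only [mul_comm]
  · intro v
    refine ge_of_tendsto' (tendsto_integral_norm_sq_dotProduct hm hQ v) fun n => ?_
    rw [Complex.zero_le_real]
    exact integral_nonneg fun ω => by positivity

variable {A Q : Matrix (Fin d) (Fin d) ℝ} {x m h : ℕ → Ω → Fin d → ℝ} {K : ℝ}

/-- Rates along a left eigenvector of a linear recursion driven by orthogonal noise and a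
coboundary. -/
lemma convergesAtRate_dotProduct (hx : ∀ n i, MemLp (fun ω => x n ω i) 2 μ)
    (hm : ∀ n i, MemLp (fun ω => m n ω i) 2 μ) (hh : ∀ n i, MemLp (fun ω => h n ω i) 2 μ)
    (hrec : ∀ (n : ℕ) (ω : Ω), x (n + 1) ω = x n ω
      + (1 / ((n : ℝ) + 1)) • (A *ᵥ x n ω + (m (n + 1) ω + h n ω - h (n + 1) ω)))
    (hmx : ∀ n i j, ∫ ω, m (n + 1) ω i * x n ω j ∂μ = 0)
    (hmh : ∀ n i j, ∫ ω, m (n + 1) ω i * h n ω j ∂μ = 0)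
    (hK : ∀ n i, ∫ ω, h n ω i ^ 2 ∂μ ≤ K)
    (hQ : ∀ i j, Tendsto (fun n => ∫ ω, m n ω i * m n ω j ∂μ) atTop (𝓝 (Q i j)))
    {l : ℂ} {v : Fin d → ℂ} (hv : v ᵥ* toComplex A = l • v) (hl : -(1 / 2) < l.re)
    (hQv : toComplex Q *ᵥ v ≠ 0) :
    ConvergesAtRate (fun n => ∫ ω, ‖v ⬝ᵥ fun i => (x n ω i : ℂ)‖ ^ 2 ∂μ) (2 * (-l.re)) := by
  have hx' := fun n => memLp_dotProduct (hx n) v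
  have hm' := fun n => memLp_dotProduct (hm n) v
  have hh' := fun n => memLp_dotProduct (hh n) v
  have hpsd := posSemidef_of_tendsto_covariance hm hQ
  have hlim := tendsto_integral_norm_sq_dotProduct hm hQ v
  -- For a positive semidefinite matrix, `v* Q v = 0` would force `Q v = 0`.
  have hpos : 0 < star v ⬝ᵥ (toComplex Q *ᵥ v) :=
    lt_of_le_of_ne (hpsd.dotProduct_mulVec_nonneg v) fun h =>
      hQv ((hpsd.dotProduct_mulVec_zero_iff v).1 h.symm)
  have hσ : 0 < (star v ⬝ᵥ (toComplex Q *ᵥ v)).re := (Complex.pos_iff.1 hpos).1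
  have horth : ∀ {u w : Ω → Fin d → ℝ} (hu : ∀ i, MemLp (fun ω => u ω i) 2 μ)
      (hw : ∀ i, MemLp (fun ω => w ω i) 2 μ), (∀ i j, ∫ ω, u ω i * w ω j ∂μ = 0) →
      ⟪(memLp_dotProduct hu v).toLp _, (memLp_dotProduct hw v).toLp _⟫_ℂ = 0 := by
    intro u w hu hw h
    rw [inner_toLp_complex, integral_conj_dotProduct_mul hu hw]
    simp [h]
  have key := convergesAtRate_norm_sq (x := fun n => (hx' n).toLp _) (m := fun n => (hm' n).toLp _)
    (h := fun n => (hh' n).toLp _) (l := l) (K := ∑ i, ‖v i‖ * Real.sqrt K) hl hσ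
    (fun n => ?_) (fun n => horth (hm (n + 1)) (hx n) (hmx n))
    (fun n => horth (hm (n + 1)) (hh n) (hmh n)) (fun n => ?_) ?_
  · simpa only [norm_sq_toLp_complex] using key
  · rw [← Complex.coe_smul, ← MemLp.toLp_const_smul l, ← MemLp.toLp_add, ← MemLp.toLp_sub,
      ← MemLp.toLp_add, ← MemLp.toLp_const_smul, ← MemLp.toLp_add]
    refine MemLp.toLp_congr _ _ (Eventually.of_forall fun ω => ?_)
    -- The left eigenvector equation is what closes the recursion for `vᵀ x`.
    have e1 : l * (v ⬝ᵥ fun i => (x n ω i : ℂ)) =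
        v ⬝ᵥ fun i => (((A *ᵥ x n ω) i : ℝ) : ℂ) := by
      rw [← smul_eq_mul, ← smul_dotProduct, ← hv, ← dotProduct_mulVec]
      congr 1
      ext i
      simp [mulVec, dotProduct, toComplex]
    simp only [Pi.add_apply, Pi.smul_apply, Pi.sub_apply, smul_eq_mul]
    rw [e1, hrec]
    simp only [dotProduct, Pi.add_apply, Pi.smul_apply, Pi.sub_apply, smul_eq_mul,
      ← Finset.sum_add_distrib, ← Finset.sum_sub_distrib, Finset.mul_sum]
    refine Finset.sum_congr rfl fun i _ => ?_
    push_cast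
    ring
  · have e : (hh' n).toLp _ = ∑ i, v i • ((hh n i).ofReal (K := ℂ)).toLp _ := by
      refine Lp.ext ?_
      have h1 : ∀ i, ⇑(v i • ((hh n i).ofReal (K := ℂ)).toLp _) =ᵐ[μ]
          fun ω => v i * (h n ω i : ℂ) := fun i => by
        filter_upwards [Lp.coeFn_smul (v i) (((hh n i).ofReal (K := ℂ)).toLp _),
          ((hh n i).ofReal (K := ℂ)).coeFn_toLp] with ω h2 h3
        rw [h2, Pi.smul_apply, h3]
        rfl
      filter_upwards [(hh' n).coeFn_toLp, Lp.coeFn_finsetSum Finset.univ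
        fun i => v i • ((hh n i).ofReal (K := ℂ)).toLp _, eventually_all.2 h1] with ω h2 h3 h4
      rw [h2, h3, Finset.sum_apply]
      exact Finset.sum_congr rfl fun i _ => (h4 i).symm
    rw [e]
    refine (norm_sum_le _ _).trans (Finset.sum_le_sum fun i _ => ?_)
    rw [norm_smul]
    refine mul_le_mul_of_nonneg_left ?_ (norm_nonneg _)
    refine Real.le_sqrt_of_sq_le ?_
    rw [norm_sq_toLp_complex]
    refine le_trans (le_of_eq ?_) (hK n i)
    refine integral_congr_ae (Eventually.of_forall fun ω => ?_)
    simp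
  · simp only [norm_sq_toLp_complex]
    exact ((Complex.continuous_re.tendsto _).comp hlim)

/-- The second moments of a linear recursion driven by orthogonal noise and a coboundary. -/
lemma integral_mul_asymptotics {a : ℝ} {N : Matrix (Fin d) (Fin d) ℝ → ℝ}
    (hN : IsAdaptedNorm A a N) (ha1 : 1 / 2 < a) (ha : a < 5 / 8)
    {S : Matrix (Fin d) (Fin d) ℝ} (hS : SolvesLyapunov A Q S)
    (hx : ∀ n i, MemLp (fun ω => x n ω i) 2 μ)
    (hm : ∀ n i, MemLp (fun ω => m n ω i) 2 μ) (hh : ∀ n i, MemLp (fun ω => h n ω i) 2 μ)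
    (hrec : ∀ (n : ℕ) (ω : Ω), x (n + 1) ω = x n ω
      + (1 / ((n : ℝ) + 1)) • (A *ᵥ x n ω + (m (n + 1) ω + h n ω - h (n + 1) ω)))
    (hmx : ∀ n i j, ∫ ω, m (n + 1) ω i * x n ω j ∂μ = 0)
    (hmh : ∀ n i j, ∫ ω, m (n + 1) ω i * h n ω j ∂μ = 0)
    (hK : ∀ n i, ∫ ω, h n ω i ^ 2 ∂μ ≤ K) {c : ℝ} (hc : 0 ≤ c)
    (hQ : ∀ (n : ℕ) i j, |(∫ ω, m (n + 1) ω i * m (n + 1) ω j ∂μ) - Q i j| ≤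
      c * ((n : ℝ) + 1) ^ (-(1 / 4 : ℝ))) :
    ∃ D : ℝ, 0 ≤ D ∧ ∀ᶠ n : ℕ in atTop, ∀ i j,
      |(∫ ω, x n ω i * x n ω j ∂μ) - (n : ℝ)⁻¹ * S i j| ≤ D * (n : ℝ) ^ (-(2 * a)) := by
  have key := inner_asymptotics hN ha1 ha hS (x := fun n i => (hx n i).toLp _)
    (m := fun n i => (hm n i).toLp _) (h := fun n i => (hh n i).toLp _) (κ := Real.sqrt K) (c := c)
    (fun n => ?_) (fun n i j => ?_) (fun n i j => ?_) (Real.sqrt_nonneg K)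
    (fun n i => norm_toLp_real_le _ (hK n i)) hc (fun n i j => ?_)
  · simpa only [inner_toLp_real] using key
  · ext1 i
    have e : matrixAct A (fun i => (hx n i).toLp _) i =
        (memLp_finsetSum Finset.univ fun j _ => (hx n j).const_mul (A i j)).toLp _ := by
      rw [matrixAct_apply]
      refine Lp.ext ?_
      have h1 : ∀ j, ⇑(A i j • (hx n j).toLp _) =ᵐ[μ] fun ω => A i j * x n ω j := fun j => by
        filter_upwards [Lp.coeFn_smul (A i j) ((hx n j).toLp _), (hx n j).coeFn_toLp]
          with ω h2 h3
        rw [h2, Pi.smul_apply, h3]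
        rfl
      filter_upwards [(memLp_finsetSum Finset.univ fun j _ =>
        (hx n j).const_mul (A i j)).coeFn_toLp, Lp.coeFn_finsetSum Finset.univ
        fun j => A i j • (hx n j).toLp _, eventually_all.2 h1] with ω h2 h3 h4
      rw [h2, h3, Finset.sum_apply]
      exact Finset.sum_congr rfl fun j _ => h4 j
    simp only [Pi.add_apply, Pi.smul_apply, Pi.sub_apply]
    rw [e, ← MemLp.toLp_add, ← MemLp.toLp_sub, ← MemLp.toLp_add,
      ← MemLp.toLp_const_smul, ← MemLp.toLp_add]
    refine MemLp.toLp_congr _ _ (Eventually.of_forall fun ω => ?_)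
    simp only [hrec n ω, Pi.add_apply, Pi.smul_apply, Pi.sub_apply, mulVec, dotProduct]
  · rw [inner_toLp_real]
    exact hmx n i j
  · rw [inner_toLp_real]
    exact hmh n i j
  · rw [inner_toLp_real]
    exact hQ n i j

end SquareIntegrable

end LinearSA

namespace LinearSA

/-! ### From asymptotics of second moments to the rates -/

section Rates

variable {Ω : Type*} {mΩ : MeasurableSpace Ω} {μ : Measure Ω} {d : ℕ}

lemma exists_forall_le_of_eventually {e : ℕ → Fin d → Fin d → ℝ} {b D : ℝ} (hD : 0 ≤ D)
    (h : ∀ᶠ n : ℕ in atTop, ∀ i j, |e n i j| ≤ D * (n : ℝ) ^ (-b)) :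
    ∃ C : ℝ, ∀ n : ℕ, 1 ≤ n → ∀ i j, |e n i j| ≤ C * (n : ℝ) ^ (-b) := by
  obtain ⟨M, hM⟩ := eventually_atTop.1 h
  set s : ℕ → ℝ := fun n => (∑ i, ∑ j, |e n i j|) / (n : ℝ) ^ (-b)
  have hs0 : ∀ n, 0 ≤ s n := fun n => div_nonneg
    (Finset.sum_nonneg fun _ _ => Finset.sum_nonneg fun _ _ => abs_nonneg _) (by positivity)
  have hs1 : 0 ≤ ∑ k ∈ Finset.range M, s k := Finset.sum_nonneg fun k _ => hs0 k
  refine ⟨D + ∑ k ∈ Finset.range M, s k, fun n hn i j => ?_⟩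
  have hn' : (0 : ℝ) < n := by exact_mod_cast hn
  have hp : 0 < (n : ℝ) ^ (-b) := Real.rpow_pos_of_pos hn' _
  rcases le_or_gt M n with hMn | hMn
  · exact (hM n hMn i j).trans (mul_le_mul_of_nonneg_right (by linarith) hp.le)
  · have h1 : s n ≤ ∑ k ∈ Finset.range M, s k :=
      Finset.single_le_sum (fun k _ => hs0 k) (Finset.mem_range.2 hMn)
    have h2 : |e n i j| ≤ ∑ i, ∑ j, |e n i j| :=
      (Finset.single_le_sum (f := fun j => |e n i j|) (fun _ _ => abs_nonneg _)
        (Finset.mem_univ j)).trans (Finset.single_le_sum (f := fun i => ∑ j, |e n i j|)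
        (fun _ _ => Finset.sum_nonneg fun _ _ => abs_nonneg _) (Finset.mem_univ i))
    rw [← div_le_iff₀ hp]
    calc |e n i j| / (n : ℝ) ^ (-b) ≤ s n := div_le_div_of_nonneg_right h2 hp.le
      _ ≤ _ := by linarith

/-- `(n + 1) ρ ^ n` is at most the partial sum of the geometric series. The exponent `1/4` is the
one at which the noise covariance is compared with its limit. -/
lemma pow_le_mul_rpow {ρ : ℝ} (hρ : 0 < ρ) (hρ1 : ρ < 1) (n : ℕ) :
    ρ ^ n ≤ (1 - ρ)⁻¹ * ((n : ℝ) + 1) ^ (-(1 / 4 : ℝ)) := by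
  have h1 : ((n : ℝ) + 1) * ρ ^ n ≤ (1 - ρ)⁻¹ := by
    calc ((n : ℝ) + 1) * ρ ^ n = ∑ _k ∈ Finset.range (n + 1), ρ ^ n := by simp
      _ ≤ ∑ k ∈ Finset.range (n + 1), ρ ^ k := Finset.sum_le_sum fun k hk =>
          pow_le_pow_of_le_one hρ.le hρ1.le (Nat.lt_succ_iff.1 (Finset.mem_range.1 hk))
      _ ≤ ∑' k : ℕ, ρ ^ k := (summable_geometric_of_lt_one hρ.le hρ1).sum_le_tsum _
          fun k _ => by positivity
      _ = _ := tsum_geometric_of_lt_one hρ.le hρ1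
  have h2 : ((n : ℝ) + 1)⁻¹ ≤ ((n : ℝ) + 1) ^ (-(1 / 4 : ℝ)) := by
    rw [← Real.rpow_neg_one]
    exact Real.rpow_le_rpow_of_exponent_le
      (by linarith [(Nat.cast_nonneg n : (0 : ℝ) ≤ n)]) (by norm_num)
  have h3 : 0 ≤ (1 - ρ)⁻¹ := inv_nonneg.2 (by linarith)
  calc ρ ^ n = (((n : ℝ) + 1) * ρ ^ n) * ((n : ℝ) + 1)⁻¹ := by field_simp
    _ ≤ _ := mul_le_mul h1 h2 (by positivity) h3

variable {x : ℕ → Ω → Fin d → ℝ} {S : Matrix (Fin d) (Fin d) ℝ} {b D : ℝ}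

lemma tendsto_mul_of_asymptotics (hb : 1 < b)
    (h : ∀ᶠ n : ℕ in atTop, ∀ i j,
      |(∫ ω, x n ω i * x n ω j ∂μ) - (n : ℝ)⁻¹ * S i j| ≤ D * (n : ℝ) ^ (-b)) (i j : Fin d) :
    Tendsto (fun n : ℕ => (n : ℝ) * ∫ ω, x n ω i * x n ω j ∂μ) atTop (𝓝 (S i j)) := by
  rw [tendsto_iff_norm_sub_tendsto_zero]
  refine tendsto_of_tendsto_of_tendsto_of_le_of_le' tendsto_const_nhds
    (tendsto_mul_rpow_neg (b := b) (D := D) hb) (Eventually.of_forall fun _ => norm_nonneg _) ?_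
  filter_upwards [h, eventually_ge_atTop 1] with n hn hn1
  have hn' : (0 : ℝ) < n := by exact_mod_cast hn1
  have e : (n : ℝ) * (∫ ω, x n ω i * x n ω j ∂μ) - S i j =
      n * ((∫ ω, x n ω i * x n ω j ∂μ) - (n : ℝ)⁻¹ * S i j) := by
    field_simp
  rw [e, norm_mul, Real.norm_of_nonneg hn'.le]
  exact mul_le_mul_of_nonneg_left (hn i j) hn'.le

open scoped ComplexOrder in
/-- The limit of the scaled second moments is positive semidefinite. -/
lemma posSemidef_of_asymptotics (hx : ∀ n i, MemLp (fun ω => x n ω i) 2 μ) (hb : 1 < b)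
    (h : ∀ᶠ n : ℕ in atTop, ∀ i j,
      |(∫ ω, x n ω i * x n ω j ∂μ) - (n : ℝ)⁻¹ * S i j| ≤ D * (n : ℝ) ^ (-b)) :
    S.PosSemidef := by
  have hlim : ∀ i j, Tendsto (fun n : ℕ =>
      ∫ ω, (Real.sqrt n * x n ω i) * (Real.sqrt n * x n ω j) ∂μ) atTop (𝓝 (S i j)) := by
    intro i j
    refine (tendsto_mul_of_asymptotics hb h i j).congr fun n => ?_
    rw [← integral_const_mul]
    refine integral_congr_ae (Eventually.of_forall fun ω => ?_)
    have := Real.mul_self_sqrt (Nat.cast_nonneg n : (0 : ℝ) ≤ n)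
    simp only
    rw [mul_mul_mul_comm, this]
  have hC := posSemidef_of_tendsto_covariance (m := fun n ω i => Real.sqrt n * x n ω i)
    (fun n i => (hx n i).const_mul _) hlim
  rw [posSemidef_iff_dotProduct_mulVec] at hC ⊢
  constructor
  · ext i j
    have := congrFun (congrFun hC.1 i) j
    simp only [toComplex, conjTranspose_apply, Matrix.map_apply, RCLike.star_def,
      Complex.conj_ofReal] at this
    simpa using this
  · intro u
    have h1 := hC.2 fun i => (u i : ℂ)
    have e : (star fun i => (u i : ℂ)) ⬝ᵥ (toComplex S *ᵥ fun i => (u i : ℂ)) =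
        ((star u ⬝ᵥ (S *ᵥ u) : ℝ) : ℂ) := by
      simp [dotProduct, mulVec, toComplex]
    rw [e, Complex.zero_le_real] at h1
    exact h1

lemma sum_sq_bounds (hx : ∀ n i, MemLp (fun ω => x n ω i) 2 μ)
    (h : ∀ᶠ n : ℕ in atTop, ∀ i j,
      |(∫ ω, x n ω i * x n ω j ∂μ) - (n : ℝ)⁻¹ * S i j| ≤ D * (n : ℝ) ^ (-b)) :
    ∀ᶠ n : ℕ in atTop,
      |(∫ ω, ∑ i, x n ω i ^ 2 ∂μ) - (n : ℝ)⁻¹ * S.trace| ≤ d * D * (n : ℝ) ^ (-b) := by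
  filter_upwards [h] with n hn
  rw [integral_finsetSum _ fun i _ => (hx n i).integrable_sq, Matrix.trace, Finset.mul_sum,
    ← Finset.sum_sub_distrib]
  refine (Finset.abs_sum_le_sum_abs _ _).trans ?_
  calc _ ≤ ∑ _i : Fin d, D * (n : ℝ) ^ (-b) :=
        Finset.sum_le_sum fun i _ => by simpa only [pow_two, diag_apply] using hn i i
    _ = d * D * (n : ℝ) ^ (-b) := by
        simp
        ring

lemma sum_sq_upper (hx : ∀ n i, MemLp (fun ω => x n ω i) 2 μ) (hb : 1 < b) (hD : 0 ≤ D)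
    (h : ∀ᶠ n : ℕ in atTop, ∀ i j,
      |(∫ ω, x n ω i * x n ω j ∂μ) - (n : ℝ)⁻¹ * S i j| ≤ D * (n : ℝ) ^ (-b)) :
    ∀ᶠ n : ℕ in atTop,
      |∫ ω, ∑ i, x n ω i ^ 2 ∂μ| ≤ (|S.trace| + d * D) * (n : ℝ) ^ (-1 : ℝ) := by
  filter_upwards [sum_sq_bounds hx h, eventually_ge_atTop 1] with n hn hn1
  have hn' : (1 : ℝ) ≤ n := by exact_mod_cast hn1
  have h1 := abs_sub_abs_le_abs_sub (∫ ω, ∑ i, x n ω i ^ 2 ∂μ) ((n : ℝ)⁻¹ * S.trace)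
  rw [abs_mul, abs_of_nonneg (by positivity : 0 ≤ (n : ℝ)⁻¹)] at h1
  have h2 : (n : ℝ) ^ (-b) ≤ (n : ℝ) ^ (-1 : ℝ) :=
    Real.rpow_le_rpow_of_exponent_le hn' (by linarith)
  have h3 : d * D * (n : ℝ) ^ (-b) ≤ d * D * (n : ℝ) ^ (-1 : ℝ) := by gcongr
  rw [Real.rpow_neg_one] at h3 ⊢
  linarith

/-- The error is `o(1 / n)`, so eventually it takes at most half of the leading term `S.trace / n`.
-/
lemma sum_sq_lower (hx : ∀ n i, MemLp (fun ω => x n ω i) 2 μ) (hb : 1 < b) (hS : 0 < S.trace)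
    (h : ∀ᶠ n : ℕ in atTop, ∀ i j,
      |(∫ ω, x n ω i * x n ω j ∂μ) - (n : ℝ)⁻¹ * S i j| ≤ D * (n : ℝ) ^ (-b)) :
    ∀ᶠ n : ℕ in atTop,
      S.trace / 2 * (n : ℝ) ^ (-1 : ℝ) ≤ |∫ ω, ∑ i, x n ω i ^ 2 ∂μ| := by
  have hsmall := (tendsto_mul_rpow_neg (b := b) (D := d * D) hb).eventually
    (ge_mem_nhds (show 0 < S.trace / 2 by positivity))
  filter_upwards [sum_sq_bounds hx h, eventually_ge_atTop 1, hsmall] with n hn hn1 h1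
  have hn' : (0 : ℝ) < n := by exact_mod_cast hn1
  have h2 : d * D * (n : ℝ) ^ (-b) ≤ S.trace / 2 * (n : ℝ)⁻¹ := by
    rw [← div_eq_mul_inv, le_div_iff₀ hn']
    linarith
  rw [Real.rpow_neg_one]
  have h3 := (abs_le.1 hn).1
  have h4 := le_abs_self (∫ ω, ∑ i, x n ω i ^ 2 ∂μ)
  linarith

end Rates

/-! ### The recursion driven by a Markov chain -/

section ErrorSeq

variable {Z Ω : Type*} {mΩ : MeasurableSpace Ω} {Φ : ℕ → Ω → Z} {μ : Measure Ω} {d : ℕ}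
  {A : Matrix (Fin d) (Fin d) ℝ} {x₀ : Fin d → ℝ} {f : Z → Fin d → ℝ}

lemma errorSeq_succ (A : Matrix (Fin d) (Fin d) ℝ) (x₀ : Fin d → ℝ) (f : Z → Fin d → ℝ)
    (Φ : ℕ → Ω → Z) (n : ℕ) (ω : Ω) :
    errorSeq A x₀ f Φ (n + 1) ω = errorSeq A x₀ f Φ n ω
      + (1 / ((n : ℝ) + 1)) • (A *ᵥ errorSeq A x₀ f Φ n ω + f (Φ (n + 1) ω)) := rfl

lemma errorSeq_succ_apply (A : Matrix (Fin d) (Fin d) ℝ) (x₀ : Fin d → ℝ) (f : Z → Fin d → ℝ)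
    (Φ : ℕ → Ω → Z) (n : ℕ) (ω : Ω) (i : Fin d) :
    errorSeq A x₀ f Φ (n + 1) ω i = errorSeq A x₀ f Φ n ω i
      + (1 / ((n : ℝ) + 1)) * (∑ j, A i j * errorSeq A x₀ f Φ n ω j + f (Φ (n + 1) ω) i) := rfl

lemma memLp_errorSeq [IsProbabilityMeasure μ] (hf : ∀ n i, MemLp (fun ω => f (Φ n ω) i) 2 μ)
    (n : ℕ) (i : Fin d) : MemLp (fun ω => errorSeq A x₀ f Φ n ω i) 2 μ := by
  induction n generalizing i with
  | zero => exact memLp_const _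
  | succ n ih =>
    simp only [errorSeq_succ_apply]
    exact (ih i).add (((memLp_finsetSum _ fun j _ => (ih j).const_mul (A i j)).add
      (hf (n + 1) i)).const_mul _)

variable [MeasurableSpace Z] {P : Kernel Z Z} {ℱ : Filtration ℕ mΩ}

lemma IsMarkovChain.stronglyMeasurable_errorSeq (hM : IsMarkovChain P ℱ Φ μ)
    (hf : ∀ i, Measurable fun z => f z i) (n : ℕ) (i : Fin d) :
    StronglyMeasurable[ℱ n] fun ω => errorSeq A x₀ f Φ n ω i := by
  induction n generalizing i with
  | zero => exact stronglyMeasurable_const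
  | succ n ih =>
    have h1 : ∀ j, StronglyMeasurable[ℱ (n + 1)] fun ω => errorSeq A x₀ f Φ n ω j := fun j =>
      (ih j).mono (ℱ.mono (Nat.le_succ n))
    have h2 : StronglyMeasurable[ℱ (n + 1)] fun ω => f (Φ (n + 1) ω) i :=
      ((hf i).comp (hM.adapted (n + 1))).stronglyMeasurable
    simp only [errorSeq_succ_apply]
    exact (h1 i).add (((Finset.stronglyMeasurable_fun_sum _ fun j _ =>
      (h1 j).const_mul (A i j)).add h2).const_mul _)

end ErrorSeq

/-- A rate `δ` that is determined by `A`. -/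
lemma exists_rate_exponent {d : ℕ} (A : Matrix (Fin d) (Fin d) ℝ) : ∃ δ : ℝ, 0 < δ ∧
    ((∀ l : ℂ, IsEigenvalue A l → l.re < -(1 / 2)) →
      ∃ a N, IsAdaptedNorm A a N ∧ 1 / 2 < a ∧ a < 5 / 8 ∧ δ = 2 * a - 1) := by
  by_cases hA : ∀ l : ℂ, IsEigenvalue A l → l.re < -(1 / 2)
  -- The bound `2 a > 1` puts the error below `1 / n`, and `2 a < 5/4` is the limit set by
  -- remainders of size `n ^ (-1/4)`.
  · obtain ⟨a, N, h1, h2, h3⟩ := exists_isAdaptedNorm A (by norm_num : (0 : ℝ) < 1 / 2)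
      (by norm_num : (1 / 2 : ℝ) < 5 / 8) hA
    exact ⟨2 * a - 1, by linarith, fun _ => ⟨a, N, h3, h1, h2, rfl⟩⟩
  -- An arbitrary positive value: the claim is void for such `A`.
  · exact ⟨1, one_pos, fun h => absurd h hA⟩

end LinearSA

theorem theorem2p1 (d : ℕ) :
    -- the exponent depends on `A` and on the asymptotic covariance of the noise only
    ∃ δ : Matrix (Fin d) (Fin d) ℝ → Matrix (Fin d) (Fin d) ℝ → ℝ, (∀ A S, 0 < δ A S) ∧
    ∀ (Z : Type*) [TopologicalSpace Z] [PolishSpace Z] [MeasurableSpace Z] [BorelSpace Z]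
      (P : Kernel Z Z) [IsMarkovKernel P] (π : Measure Z) [IsProbabilityMeasure π] (V : Z → ℝ)
      (A : Matrix (Fin d) (Fin d) ℝ) (f : Z → Fin d → ℝ)
      (Ω : Type*) (mΩ : MeasurableSpace Ω) (μ : Measure Ω) [IsProbabilityMeasure μ]
      (ℱ : Filtration ℕ mΩ) (Φ : ℕ → Ω → Z) (z₀ : Z) (x₀ : Fin d → ℝ),
      -- the chain is `V`-uniformly ergodic, with a fixed initial state
      LinearSA.VUniformlyErgodic P V π →
      LinearSA.IsMarkovChain P ℱ Φ μ →
      (∀ᵐ ω ∂μ, Φ 0 ω = z₀) →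
      -- `A` is Hurwitz (the step size `1 / n` is part of the recursion)
      LinearSA.IsHurwitz A →
      -- the noise function
      (∀ i, Measurable fun z => f z i) →
      (∀ i, LinearSA.MemLV V fun z => f z i ^ 2) →
      (∀ i, ∫ z, f z i ∂π = 0) →
      -- the series that defines the asymptotic covariance converges absolutely
      (∀ i j, Summable fun k : ℤ => LinearSA.autocov P π f k i j) ∧
      -- all the second moments below are finite
      (∀ n i, MemLp (fun ω => LinearSA.errorSeq A x₀ f Φ n ω i) 2 μ) ∧
      -- (i)
      ((∀ l : ℂ, LinearSA.IsEigenvalue A l → l.re < -(1 / 2)) →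
        (∃ S : Matrix (Fin d) (Fin d) ℝ,
          S.PosSemidef ∧
          LinearSA.SolvesLyapunov A (LinearSA.asymptoticCov P π f) S ∧
          (∀ S', LinearSA.SolvesLyapunov A (LinearSA.asymptoticCov P π f) S' → S' = S) ∧
          ∃ C : ℝ, ∀ n : ℕ, 1 ≤ n → ∀ i j,
            |LinearSA.secondMoment μ (LinearSA.errorSeq A x₀ f Φ n) i j - (n : ℝ)⁻¹ * S i j|
              ≤ C * (n : ℝ) ^ (-1 - δ A (LinearSA.asymptoticCov P π f))) ∧
        (∀ s < (1 : ℝ), Tendsto (fun n : ℕ =>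
          (n : ℝ) ^ s * ∫ ω, ∑ i, LinearSA.errorSeq A x₀ f Φ n ω i ^ 2 ∂μ) atTop (𝓝 0)) ∧
        (LinearSA.asymptoticCov P π f ≠ 0 →
          LinearSA.ConvergesAtRate
            (fun n => ∫ ω, ∑ i, LinearSA.errorSeq A x₀ f Φ n ω i ^ 2 ∂μ) 1)) ∧
      -- (ii)
      (∀ (l : ℂ) (v : Fin d → ℂ), v ≠ 0 → v ᵥ* LinearSA.toComplex A = l • v →
        -(1 / 2) < l.re →
        LinearSA.toComplex (LinearSA.asymptoticCov P π f) *ᵥ v ≠ 0 →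
        LinearSA.ConvergesAtRate
          (fun n => ∫ ω, ‖v ⬝ᵥ (fun i => (LinearSA.errorSeq A x₀ f Φ n ω i : ℂ))‖ ^ 2 ∂μ)
          (2 * (-l.re))) := by
  -- The exponent is fixed from `A` alone, before any chain is given.
  choose δ hδ hδA using LinearSA.exists_rate_exponent (d := d)
  refine ⟨fun A _ => δ A, fun A _ => hδ A, ?_⟩
  intro Z _ _ _ _ P _ π _ V A f Ω mΩ μ _ ℱ Φ z₀ x₀ hE hM h0 _ hf hfV hπ
  obtain ⟨h, K, hP, hsum, hcov⟩ := LinearSA.exists_isPoissonCorrection hE hf hfV hπ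
  have hfL := fun n i => hM.memLp_left h0 hE hP n i
  have hhL := fun n i => hM.memLp_right h0 hE hP n i
  have hx : ∀ n i, MemLp (fun ω => LinearSA.errorSeq A x₀ f Φ n ω i) 2 μ :=
    LinearSA.memLp_errorSeq hfL
  -- Truncated subtraction gives `m 0 = f (Φ 0)`; only the terms `m (n + 1)` are martingale
  -- increments, and only they enter the recursion.
  set m : ℕ → Ω → Fin d → ℝ := fun n ω => f (Φ n ω) + h (Φ n ω) - h (Φ (n - 1) ω)
  have hm : ∀ n i, MemLp (fun ω => m n ω i) 2 μ := fun n i =>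
    ((hfL n i).add (hhL n i)).sub (hhL (n - 1) i)
  have hmx : ∀ n i j, ∫ ω, m (n + 1) ω i * LinearSA.errorSeq A x₀ f Φ n ω j ∂μ = 0 :=
    fun n i j => hM.integral_mul_martingale_eq_zero h0 hE hP n i
      (hM.stronglyMeasurable_errorSeq hf n j) (hx n j)
  have hmh : ∀ n i j, ∫ ω, m (n + 1) ω i * h (Φ n ω) j ∂μ = 0 := fun n i j =>
    hM.integral_mul_martingale_eq_zero h0 hE hP n i
      ((hP.measurable_right j).comp (hM.adapted n)).stronglyMeasurable (hhL n j)
  have hrec : ∀ (n : ℕ) (ω : Ω), LinearSA.errorSeq A x₀ f Φ (n + 1) ω =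
      LinearSA.errorSeq A x₀ f Φ n ω + (1 / ((n : ℝ) + 1)) •
        (A *ᵥ LinearSA.errorSeq A x₀ f Φ n ω + (m (n + 1) ω + h (Φ n ω) - h (Φ (n + 1) ω))) := by
    intro n ω
    have e : m (n + 1) ω + h (Φ n ω) - h (Φ (n + 1) ω) = f (Φ (n + 1) ω) := by
      simp only [m, Nat.add_sub_cancel]
      abel
    rw [e, LinearSA.errorSeq_succ]
  obtain ⟨C, hC, hCh⟩ := hM.exists_integral_sq_right_le h0 hE hP
  obtain ⟨ρ, B, hρ, hρ1, hB, hBm⟩ := hM.exists_martingale_covariance_bound h0 hE hP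
  have hQ : ∀ (n : ℕ) i j, |(∫ ω, m (n + 1) ω i * m (n + 1) ω j ∂μ)
      - LinearSA.asymptoticCov P π f i j| ≤ B * ρ ^ n := fun n i j => by
    rw [hcov]
    exact hBm n i j
  refine ⟨hsum, hx, fun hA => ?_, fun l v _ hv hl hQv => ?_⟩
  · obtain ⟨a, N, hN, ha1, ha, hδa⟩ := hδA A hA
    obtain ⟨S, hS, hSu⟩ := hN.existsUnique_lyapunov ha ha1 (LinearSA.asymptoticCov P π f)
    have hρ2 : 0 ≤ (1 - ρ)⁻¹ := inv_nonneg.2 (by linarith)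
    obtain ⟨D, hD0, hD⟩ := LinearSA.integral_mul_asymptotics hN ha1 ha hS hx hm
      (h := fun n ω => h (Φ n ω)) hhL hrec hmx hmh hCh
      (mul_nonneg hB hρ2) (fun n i j => (hQ n i j).trans (by
        rw [mul_assoc]
        exact mul_le_mul_of_nonneg_left (LinearSA.pow_le_mul_rpow hρ hρ1 n) hB))
    have h2a : 1 < 2 * a := by linarith
    have hSpos := LinearSA.posSemidef_of_asymptotics hx h2a hD
    have hup := LinearSA.sum_sq_upper hx h2a hD0 hD
    refine ⟨⟨S, hSpos, hS, hSu, ?_⟩, fun s hs => ?_, fun hne => ?_⟩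
    · obtain ⟨C', hC'⟩ := LinearSA.exists_forall_le_of_eventually hD0 hD
      refine ⟨C', fun n hn i j => ?_⟩
      have e : -1 - δ A = -(2 * a) := by
        rw [hδa]
        ring
      have := hC' n hn i j
      rw [← e] at this
      exact this
    · refine (LinearSA.tendsto_rpow_mul_abs_zero hup hs).congr fun n => ?_
      rw [abs_of_nonneg (integral_nonneg fun ω => Finset.sum_nonneg fun i _ => sq_nonneg _)]
    -- With `S = 0` the Lyapunov equation would read `Σ_Δ = 0`; a nonzero positive semidefinite
    -- matrix has positive trace.
    · have hS0 : S ≠ 0 := by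
        rintro rfl
        apply hne
        simpa [LinearSA.SolvesLyapunov] using hS
      have htr : 0 < S.trace := lt_of_le_of_ne hSpos.trace_nonneg fun h' =>
        hS0 (hSpos.trace_eq_zero_iff.1 h'.symm)
      exact LinearSA.convergesAtRate_of_bounds (half_pos htr)
        (LinearSA.sum_sq_lower hx h2a htr hD) hup
  · refine LinearSA.convergesAtRate_dotProduct hx hm (h := fun n ω => h (Φ n ω)) hhL hrec hmx hmh
      hCh (fun i j => ?_) hv hl hQv
    rw [← tendsto_add_atTop_iff_nat 1, tendsto_iff_norm_sub_tendsto_zero]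
    refine squeeze_zero (fun n => norm_nonneg _) (fun n => hQ n i j) ?_
    simpa using (tendsto_pow_atTop_nhds_zero_of_lt_one hρ.le hρ1).const_mul B
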